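/- Identify $\mathbb R^2$ with $\mathbb C$. For a regular non-self-intersecting curve $z=z(\alpha)$, $\alpha\in\mathbb R$, let $$\mathfrak H f(\alpha)=\frac1{\pi i}\,\mathrm{p.v.}\!\int_{\mathbb R}\frac{z_\beta(\beta)}{z(\alpha)-z(\beta)}f(\beta)\,d\beta .$$ Let $T>0$ and let $z=z(\alpha,t)\in\mathbb C$, with a real function $\mathfrak a=\mathfrak a(\alpha,t)$, be a solution for $0<t<T$ of the two-dimensional water wave system $$z_{tt}+i=i\,\mathfrak a\,z_\alpha,\qquad \bar z_t=\mathfrak H\bar z_t ,$$ where $\mathfrak H$ is taken along the curve $z(\cdot,t)$. Here $z$ is $C^1$ in $(\alpha,t)$, $z_t$ and $z_\alpha-1$ belong to $C^1((0,T);H^1(\mathbb R))$, and for each $t$ the curve $z(\cdot,t)$ is injective with $z_\alpha\neq0$ and $\operatorname{Im}z(\cdot,t)\in L^p(\mathbb R)$ for some $1<p<\infty$. Let $\Pi:=(I-\mathfrak H)(z-\bar z)$. Let $k(\cdot,t):\mathbb R\to\mathbb R$, $0<t<T$, be an arbitrary family of diffeomorphisms with $k_\alpha>0$, of class $C^1$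 in $(\alpha,t)$. With compositions in the space variable put $$\zeta:=z\circ k^{-1},\quad b:=k_t\circ k^{-1},\quad A:=(\mathfrak a k_\alpha)\circ k^{-1},\quad D_t:=\partial_t+b\,\partial_\alpha .$$ Then $\mathfrak H(z-\bar z)$ exists at every point, $D_t\zeta=z_t\circ k^{-1}$, the function $\zeta$ is differentiable in $(\alpha,t)$, $D_t\zeta$ is differentiable in $\alpha$, $\Pi\circ k^{-1}$ and $D_t(\Pi\circ k^{-1})$ are differentiable in $(\alpha,t)$, the two integrals below converge absolutely, and for all $\alpha\in\mathbb R$ and $0<t<T$ $$\begin{aligned}(D_t^2-iA\partial_\alpha)(\Pi\circ k^{-1})(\alpha,t) &=\frac4\pi\int_{\mathbb R}\frac{(D_t\zeta(\alpha,t)-D_t\zeta(\beta,t))(\operatorname{Im}\zeta(\alpha,t)-\operatorname{Im}\zeta(\beta,t))}{|\zeta(\alpha,t)-\zeta(\beta,t)|^2}\,\partial_\beta D_t\zeta(\beta,t)\,d\beta\\ &\quad+\frac2\pi\int_{\mathbb R}\left(\frac{D_t\zeta(\alpha,t)-D_t\zeta(\beta,t)}{\zeta(\alpha,t)-\zeta(\beta,t)}\right)^2\partial_\beta\operatorname{Im}\zeta(\beta,t)\,d\beta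 .\end{aligned}$$ -/

import Mathlib

open MeasureTheory Set Filter Topology
open scoped ENNReal ContDiff

noncomputable section

namespace WaterWave

/-! Functions of space and time are written `u α t` with `α` the space variable. -/

/-- The partial derivative in the space variable. -/
def dSpace {F : Type*} [NormedAddCommGroup F] [NormedSpace ℝ F] (u : ℝ → ℝ → F) : ℝ → ℝ → F :=
  fun α t => deriv (fun x => u x t) α

/-- The partial derivative in the time variable. -/
def dTime {F : Type*} [NormedAddCommGroup F] [NormedSpace ℝ F] (u : ℝ → ℝ → F) : ℝ → ℝ → F :=
  fun α t => deriv (fun s => u α s) t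

/-- `v` is the weak (distributional) derivative of `u`, for `u` and `v` in `L²(ℝ; ℂ)`. -/
def IsWeakDeriv (u v : Lp ℂ 2 (volume : Measure ℝ)) : Prop :=
  ∀ φ : ℝ → ℝ, ContDiff ℝ ∞ φ → HasCompactSupport φ →
    ∫ x, ((deriv φ x : ℝ) : ℂ) * u x = -∫ x, (φ x : ℂ) * v x

/-- `u ∈ C¹(J; H¹(ℝ))`. Since `H¹(ℝ)` is normed by the `L²` norms of a function and of its weak
derivative, this says that `t ↦ u(·, t)` and its weak space derivative are `C¹` maps into `L²`. -/
def IsC1H1 (J : Set ℝ) (u : ℝ → ℝ → ℂ) : Prop :=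
  ∃ U V : ℝ → Lp ℂ 2 (volume : Measure ℝ),
    ContDiffOn ℝ 1 U J ∧ ContDiffOn ℝ 1 V J ∧
      ∀ t ∈ J, (∀ᵐ α, u α t = U t α) ∧ IsWeakDeriv (U t) (V t)

/-- The principal value integral of `g` with singularity at `a` exists and equals `v`. -/
def HasPV (g : ℝ → ℂ) (a : ℝ) (v : ℂ) : Prop :=
  (∀ ε > 0, IntegrableOn g {β | ε < |a - β|}) ∧
    Tendsto (fun ε : ℝ => ∫ β in {β | ε < |a - β|}, g β) (𝓝[>] 0) (𝓝 v)

/-- The integrand of the Hilbert transform along the curve `z`, at the point with parameter `α`. -/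
def hilbertIntegrand (z f : ℝ → ℂ) (α : ℝ) : ℝ → ℂ :=
  fun β => 1 / (Real.pi * Complex.I) * (deriv z β / (z α - z β) * f β)

/-- The Hilbert transform of `f` along the curve `z` exists at `α` and equals `v`. -/
def HasHilbert (z f : ℝ → ℂ) (α : ℝ) (v : ℂ) : Prop :=
  HasPV (hilbertIntegrand z f α) α v

/-- The Hilbert transform along the curve `z`; meaningful where `HasHilbert z f α v` holds for
some `v`, and then equal to `v`. -/
def hilbert (z f : ℝ → ℂ) (α : ℝ) : ℂ :=
  limUnder (𝓝[>] (0 : ℝ))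
    (fun ε : ℝ => ∫ β in {β | ε < |α - β|}, hilbertIntegrand z f α β)

theorem HasHilbert.hilbert_eq {z f : ℝ → ℂ} {α : ℝ} {v : ℂ} (h : HasHilbert z f α v) :
    hilbert z f α = v :=
  h.2.limUnder_eq

/-- `z` is a solution of the two dimensional water wave system in Lagrangian coordinates,
`z_tt + i = i 𝔞 z_α` and `z̄_t = 𝔥 z̄_t`, on the time interval `(0, T)`, where `𝔥` is the Hilbert
transform along the interface `z(·, t)` and `𝔞` is real valued. The interface is regular,
non-self-intersecting and horizontal at infinity. -/
structure IsSolution (T : ℝ) (z : ℝ → ℝ → ℂ) (a : ℝ → ℝ → ℝ) : Prop where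
  contDiffOn : ContDiffOn ℝ 1 (fun p : ℝ × ℝ => z p.1 p.2) (univ ×ˢ Ioo 0 T)
  velocity : IsC1H1 (Ioo 0 T) (dTime z)
  slope : IsC1H1 (Ioo 0 T) (fun α t => dSpace z α t - 1)
  height : ∀ t ∈ Ioo 0 T, ∃ p : ℝ≥0∞, 1 < p ∧ p < ⊤ ∧ MemLp (fun α => (z α t).im) p volume
  injective : ∀ t ∈ Ioo 0 T, Function.Injective (fun α => z α t)
  regular : ∀ t ∈ Ioo 0 T, ∀ α, dSpace z α t ≠ 0
  momentum : ∀ t ∈ Ioo 0 T, ∀ α,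
    dTime (dTime z) α t + Complex.I = Complex.I * a α t * dSpace z α t
  holomorphic : ∀ t ∈ Ioo 0 T, ∀ α,
    HasHilbert (fun β => z β t) (fun β => starRingEnd ℂ (dTime z β t)) α
      (starRingEnd ℂ (dTime z α t))

/-- `k(·, t)`, `0 < t < T`, is a family of diffeomorphisms of `ℝ` with `k_α > 0`, of class `C¹` in
space and time. -/
structure IsDiffeoFamily (T : ℝ) (k : ℝ → ℝ → ℝ) : Prop where
  contDiffOn : ContDiffOn ℝ 1 (fun p : ℝ × ℝ => k p.1 p.2) (univ ×ˢ Ioo 0 T)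
  bijective : ∀ t ∈ Ioo 0 T, Function.Bijective (fun α => k α t)
  deriv_pos : ∀ t ∈ Ioo 0 T, ∀ α, 0 < dSpace k α t

/-- The composition `u ∘ k⁻¹` in the space variable. -/
def compInv {F : Type*} (k : ℝ → ℝ → ℝ) (u : ℝ → ℝ → F) : ℝ → ℝ → F :=
  fun α t => u (Function.invFun (fun x => k x t) α) t

/-- The material derivative `D_t = ∂_t + b ∂_α` with `b = k_t ∘ k⁻¹`. -/
def matDeriv (k : ℝ → ℝ → ℝ) (u : ℝ → ℝ → ℂ) : ℝ → ℝ → ℂ :=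
  fun α t => dTime u α t + ((compInv k (dTime k) α t : ℝ) : ℂ) * dSpace u α t

/-- The coefficient `A = (𝔞 k_α) ∘ k⁻¹`. -/
def coeffA (k a : ℝ → ℝ → ℝ) : ℝ → ℝ → ℝ :=
  compInv k (fun α t => a α t * dSpace k α t)

/-- The function `z - z̄`, whose image under `I - 𝔥` is `Π`. -/
def zSubConj (z : ℝ → ℝ → ℂ) : ℝ → ℝ → ℂ :=
  fun α t => z α t - starRingEnd ℂ (z α t)

/-- The quantity `Π = (I - 𝔥)(z - z̄)`. -/
def bigPi (z : ℝ → ℝ → ℂ) : ℝ → ℝ → ℂ :=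
  fun α t => zSubConj z α t - hilbert (fun β => z β t) (fun β => zSubConj z β t) α

/-- The integrand of the first integral on the right hand side, `w` standing for `D_t ζ`. -/
def integrand₁ (ζ w : ℝ → ℝ → ℂ) (α t β : ℝ) : ℂ :=
  (w α t - w β t) * (((ζ α t).im - (ζ β t).im : ℝ) : ℂ) / ((‖ζ α t - ζ β t‖ ^ 2 : ℝ) : ℂ)
    * dSpace w β t

/-- The integrand of the second integral on the right hand side, `w` standing for `D_t ζ`. -/
def integrand₂ (ζ w : ℝ → ℝ → ℂ) (α t β : ℝ) : ℂ :=
  ((w α t - w β t) / (ζ α t - ζ β t)) ^ 2 * ((dSpace (fun x s => (ζ x s).im) β t : ℝ) : ℂ)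

end WaterWave

end

/-! Write y = Im z, Δf = f(α) − f(β) and C w(α) = p.v. ∫ w(β)/Δz dβ. Then 𝔥f = C(z_β f)/(πi), and z
− z̄ = 2iy gives Π = 2iy − (2/π) C(z_β y). The identity is proved in Lagrangian coordinates, where
D_t is ∂_t, and is transported by k only at the end.

Two rules govern the calculus. The time derivative of the kernel z_β/Δz is minus the β-derivative of
Δz_t/Δz, so integration by parts gives ∂_t C(z_β u) = C(z_β u_t) + ∫ (Δz_t/Δz) u_β
(`Curve.integral_cauchyDerivKer`, `hasDerivAt_cauchyInt_time`). Along the curve, ∂_α C(z_β u) = z_α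
C(u_β) (`Curve.hasDerivAt_cauchyInt`). Since 2iy_t = z_t − z̄_t and z̄_t = 𝔥z̄_t, the first rule
gives Π_t = (I − 𝔥)z_t − (2/π) ∫ (Δz_t/Δz) y_β.

On differentiating again, z_tt appears inside the integrals. As 𝔞 is real, the momentum equation
gives (z_tt + i)·2iy_α = z_α(z_tt + z̄_tt). This cancels C(z_β z_tt), leaves C(z_β z̄_tt) to be
removed by the time derivative of z̄_t = 𝔥z̄_t, and matches the other part of the Δz_tt term with
i𝔞Π_α. The local terms disappear because z_tt + z̄_tt = −2𝔞y_α. What remains is the integral of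
(Δz_t/Δz)² y_β and a multiple of ∫ (Δz_t/Δz) z_tβ (`IsSolution.identity`).

The last integral is cubic in disguise: ∫ (Δz̄_t/Δz) z̄_tβ = 0, and subtracting the conjugate of
this replaces 1/Δz by 1/Δz − 1/Δz̄ = −2i Im Δz/|Δz|². The vanishing (`Curve.dqInt_self_eq_zero`)
uses only the skew symmetry of C. If f is a boundary value, C(z_β f) = πi f, then z_β C(f_β) = πi
f_β, and the divided difference of f from a fixed point is again a boundary value. Pairing one
relation with the other equates the integral with its negative.

The difficulty is low regularity. The quantities z_t, z_α − 1, z_tt, z_tα are only in H¹, hence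
bounded, 1/2-Hölder and square integrable. Principal values are therefore written as integrals over
s > 0 of kernels symmetrised about α; these are O(s^(-1/2)) with tails O(R^(-1/2)), locally
uniformly in the parameters, which is enough for continuity and for differentiation under the
integral. The fact that the constant 1 has symmetric Cauchy integral 0 comes from a global logarithm
of Δz/(α − β). -/

noncomputable section

namespace WaterWave

/-! ### Weakly singular integrals over the half line -/

/-- A kernel on the half line that is `O(s^{-1/2})`, with tails of size `O(R^{-1/2})`. -/
structure Tame (C : ℝ) (k : ℝ → ℂ) : Prop where
  meas : AEStronglyMeasurable k (volume.restrict (Ioi 0))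
  bound : ∀ s > 0, ‖k s‖ ≤ C / √s
  tail : ∀ R ≥ 1, ∫⁻ s in Ioi R, ‖k s‖ₑ ≤ ENNReal.ofReal (C / √R)

theorem Tame.nonneg {C : ℝ} {k : ℝ → ℂ} (h : Tame C k) : 0 ≤ C := by
  have := (norm_nonneg _).trans (h.bound 1 one_pos)
  simpa using this

theorem Tame.add {C D : ℝ} {k l : ℝ → ℂ} (hk : Tame C k) (hl : Tame D l) :
    Tame (C + D) (fun s => k s + l s) where
  meas := hk.meas.add hl.meas
  bound s hs := (norm_add_le _ _).trans (by rw [add_div]; exact add_le_add (hk.bound s hs) (hl.bound s hs))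
  tail R hR := by
    have hk0 := hk.nonneg
    have hl0 := hl.nonneg
    have hm : AEMeasurable (fun s => ‖k s‖ₑ) (volume.restrict (Ioi R)) :=
      (hk.meas.mono_set (Ioi_subset_Ioi (by linarith))).enorm
    rw [add_div, ENNReal.ofReal_add (by positivity) (by positivity)]
    calc ∫⁻ s in Ioi R, ‖k s + l s‖ₑ ≤ ∫⁻ s in Ioi R, (‖k s‖ₑ + ‖l s‖ₑ) :=
          lintegral_mono fun s => enorm_add_le _ _
      _ = _ := lintegral_add_left' hm _
      _ ≤ _ := add_le_add (hk.tail R hR) (hl.tail R hR)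

theorem integrableOn_Ioc_div_sqrt (C R : ℝ) : IntegrableOn (fun s : ℝ => C / √s) (Ioc 0 R) := by
  have h : IntervalIntegrable (fun s : ℝ => s ^ (-(1 / 2) : ℝ)) volume 0 R :=
    intervalIntegral.intervalIntegrable_rpow' (by norm_num)
  rcases le_total R 0 with hR | hR
  · simp [Ioc_eq_empty_of_le hR]
  rw [intervalIntegrable_iff_integrableOn_Ioc_of_le hR] at h
  refine IntegrableOn.congr_fun (h.const_mul C) (fun s hs => ?_) measurableSet_Ioc
  rw [Real.rpow_neg hs.1.le, ← Real.sqrt_eq_rpow, div_eq_mul_inv]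

theorem Tame.integrableOn_Ioc {C : ℝ} {k : ℝ → ℂ} (h : Tame C k) (R : ℝ) :
    IntegrableOn k (Ioc 0 R) :=
  (integrableOn_Ioc_div_sqrt C R).mono' (h.meas.mono_set Ioc_subset_Ioi_self)
    ((ae_restrict_iff' measurableSet_Ioc).2 <| .of_forall fun s hs => h.bound s hs.1)

theorem Tame.integrableOn_tail {C : ℝ} {k : ℝ → ℂ} (h : Tame C k) {R : ℝ} (hR : 1 ≤ R) :
    IntegrableOn k (Ioi R) :=
  ⟨h.meas.mono_set (Ioi_subset_Ioi (by linarith)), (h.tail R hR).trans_lt ENNReal.ofReal_lt_top⟩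

theorem Tame.integrableOn {C : ℝ} {k : ℝ → ℂ} (h : Tame C k) : IntegrableOn k (Ioi 0) := by
  rw [← Ioc_union_Ioi_eq_Ioi (zero_le_one' ℝ)]
  exact (h.integrableOn_Ioc 1).union (h.integrableOn_tail le_rfl)

theorem Tame.norm_tail_le {C : ℝ} {k : ℝ → ℂ} (h : Tame C k) {R : ℝ} (hR : 1 ≤ R) :
    ‖∫ s in Ioi R, k s‖ ≤ C / √R := by
  have h0 := h.nonneg
  have := (enorm_integral_le_lintegral_enorm (μ := volume.restrict (Ioi R)) k).trans (h.tail R hR)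
  rw [← ofReal_norm] at this
  exact (ENNReal.ofReal_le_ofReal_iff (by positivity)).1 this

theorem Tame.integral_sub {C : ℝ} {k : ℝ → ℂ} (h : Tame C k) {R : ℝ} (hR : 1 ≤ R) :
    (∫ s in Ioi 0, k s) - ∫ s in Ioc 0 R, k s = ∫ s in Ioi R, k s := by
  rw [← Ioc_union_Ioi_eq_Ioi (show (0 : ℝ) ≤ R by linarith),
    setIntegral_union (by simp) measurableSet_Ioi (h.integrableOn_Ioc R)
    (h.integrableOn_tail hR)]
  ring

/-- A family of kernels that are tame near a parameter, uniformly. -/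
def TameAt {X : Type*} [TopologicalSpace X] (K : X → ℝ → ℂ) (x₀ : X) : Prop :=
  ∃ C, ∀ᶠ x in 𝓝 x₀, Tame C (K x)

theorem tendsto_div_sqrt_atTop (C : ℝ) : Tendsto (fun R : ℝ => C / √R) atTop (𝓝 0) :=
  tendsto_const_nhds.div_atTop Real.tendsto_sqrt_atTop

/-- The tails need have no common integrable majorant, since their size comes from a square
integrable factor that moves with the parameter. Instead the integrals over `Ioc 0 R`, continuous by
domination, converge locally uniformly as R grows. -/
theorem TameAt.continuousAt {X : Type*} [TopologicalSpace X] [FirstCountableTopology X]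
    {K : X → ℝ → ℂ} {x₀ : X} (hK : TameAt K x₀)
    (hc : ∀ s > 0, ContinuousAt (fun x => K x s) x₀) :
    ContinuousAt (fun x => ∫ s in Ioi 0, K x s) x₀ := by
  obtain ⟨C, hC⟩ := hK
  refine continuousAt_of_locally_uniform_approx_of_continuousAt fun u hu => ?_
  obtain ⟨ε, hε, hεu⟩ := Metric.mem_uniformity_dist.1 hu
  obtain ⟨R, hR1, hR⟩ :=
    ((eventually_ge_atTop (1 : ℝ)).and ((tendsto_div_sqrt_atTop C).eventually (gt_mem_nhds hε))).exists
  refine ⟨_, hC, fun x => ∫ s in Ioc 0 R, K x s, ?_, fun x hx => hεu ?_⟩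
  · refine continuousAt_of_dominated (bound := fun s => C / √s) ?_ ?_
      (integrableOn_Ioc_div_sqrt C R) ?_
    · filter_upwards [hC] with x hx using hx.meas.mono_set Ioc_subset_Ioi_self
    · filter_upwards [hC] with x hx
      exact (ae_restrict_iff' measurableSet_Ioc).2 <| .of_forall fun s hs => hx.bound s hs.1
    · exact (ae_restrict_iff' measurableSet_Ioc).2 <| .of_forall fun s hs => hc s hs.1
  · rw [dist_eq_norm, Tame.integral_sub hx hR1]
    exact (Tame.norm_tail_le hx hR1).trans_lt hR

/-- Two stages: dominated differentiation on `Ioc 0 R`, then the theorem on limits of derivatives.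
Only the differentiated kernel has to be uniformly tame; the kernel itself may be barely integrable,
as it is for the height. -/
theorem TameAt.hasDerivAt {K K' : ℝ → ℝ → ℂ} {t₀ : ℝ} (hK' : TameAt K' t₀)
    (hK : ∀ᶠ t in 𝓝 t₀, IntegrableOn (K t) (Ioi 0))
    (hd : ∀ᶠ t in 𝓝 t₀, ∀ s > 0, HasDerivAt (fun τ => K τ s) (K' t s) t) :
    HasDerivAt (fun t => ∫ s in Ioi 0, K t s) (∫ s in Ioi 0, K' t₀ s) t₀ := by
  obtain ⟨C, hC⟩ := hK'
  have hU := hC.and (hK.and hd)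
  refine hasDerivAt_of_tendstoUniformlyOnFilter (l := atTop (α := ℝ))
    (f := fun R t => ∫ s in Ioc 0 R, K t s) (f' := fun R t => ∫ s in Ioc 0 R, K' t s) 
    (g' := fun t => ∫ s in Ioi 0, K' t s) ?_ ?_ ?_
  · rw [Metric.tendstoUniformlyOnFilter_iff]
    intro ε hε
    have h1 := (eventually_ge_atTop (1 : ℝ)).and
      ((tendsto_div_sqrt_atTop C).eventually (gt_mem_nhds hε))
    filter_upwards [h1.prod_mk hC] with ⟨R, t⟩ ⟨⟨hR1, hR⟩, ht⟩
    rw [dist_eq_norm, Tame.integral_sub ht hR1]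
    exact (Tame.norm_tail_le ht hR1).trans_lt hR
  · have : ∀ᶠ t in 𝓝 t₀, ∀ R : ℝ,
        HasDerivAt (fun t => ∫ s in Ioc 0 R, K t s) (∫ s in Ioc 0 R, K' t s) t := by
      filter_upwards [hU.eventually_nhds] with t ht R
      refine (hasDerivAt_integral_of_dominated_loc_of_deriv_le (bound := fun s => C / √s) ht ?_ ?_
        ?_ ?_ (integrableOn_Ioc_div_sqrt C R) ?_).2
      · filter_upwards [ht] with τ hτ using hτ.2.1.1.mono_set Ioc_subset_Ioi_self
      · exact ht.self_of_nhds.2.1.mono_set Ioc_subset_Ioi_self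
      · exact ht.self_of_nhds.1.meas.mono_set Ioc_subset_Ioi_self
      · exact (ae_restrict_iff' measurableSet_Ioc).2 <| .of_forall fun s hs τ hτ =>
          hτ.1.bound s hs.1
      · exact (ae_restrict_iff' measurableSet_Ioc).2 <| .of_forall fun s hs τ hτ =>
          hτ.2.2 s hs.1
    have h2 := (eventually_ge_atTop (1 : ℝ)).prod_mk this
    filter_upwards [h2] with n hn using hn.2 _
  · filter_upwards [hK] with t ht
    have := intervalIntegral_tendsto_integral_Ioi 0 ht tendsto_id
    refine this.congr' ?_
    filter_upwards [eventually_ge_atTop 0] with R hR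
    rw [id, intervalIntegral.integral_of_le hR]

/-! ### Symmetric integrals about a point -/

/-- The sum of the values of `g` at the two points at distance `s` from `α`. -/
def sym (g : ℝ → ℂ) (α s : ℝ) : ℂ := g (α + s) + g (α - s)

theorem sym_congr {g h : ℝ → ℂ} {α s : ℝ} (hs : 0 < s) (H : ∀ β ≠ α, g β = h β) :
    sym g α s = sym h α s := by
  rw [sym, sym, H (α + s) (by intro h'; linarith), H (α - s) (by intro h'; linarith)]

theorem sym_add (g h : ℝ → ℂ) (α s : ℝ) :
    sym (fun β => g β + h β) α s = sym g α s + sym h α s := by simp only [sym]; ring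

theorem aestronglyMeasurable_sym {g : ℝ → ℂ} {α : ℝ} (hg : ContinuousOn g {α}ᶜ) :
    AEStronglyMeasurable (sym g α) (volume.restrict (Ioi 0)) := by
  refine ContinuousOn.aestronglyMeasurable ?_ measurableSet_Ioi
  refine ContinuousOn.add (hg.comp (by fun_prop) ?_) (hg.comp (by fun_prop) ?_)
  · intro s hs h
    have := (mem_Ioi.1 hs).ne'
    simp at h
    exact this h
  · intro s hs h
    have := (mem_Ioi.1 hs).ne'
    simp at h
    exact this h

theorem integrableOn_sym_of_integrableOn {g : ℝ → ℂ} {α ε : ℝ}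
    (hg : IntegrableOn g {β | ε < |α - β|}) (hε : 0 ≤ ε) : IntegrableOn (sym g α) (Ioi ε) ∧
      ∫ s in Ioi ε, sym g α s = ∫ β in {β | ε < |α - β|}, g β := by
  have hset : {β | ε < |α - β|} = Ioi (α + ε) ∪ Iio (α - ε) := by
    ext β
    simp only [mem_ofPred_eq, mem_union, mem_Ioi, mem_Iio, lt_abs]
    constructor
    · rintro (h | h)
      · right; linarith
      · left; linarith
    · rintro (h | h)
      · right; linarith
      · left; linarith
  rw [hset] at hg ⊢
  have h1 := hg.mono_set subset_union_left
  have h2 := hg.mono_set subset_union_right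
  have e1 : MeasurePreserving (fun s : ℝ => α + s) := measurePreserving_add_left volume α
  have e2 : MeasurePreserving (fun s : ℝ => α - s) := Measure.measurePreserving_sub_left volume α
  have m1 : MeasurableEmbedding (fun s : ℝ => α + s) := measurableEmbedding_addLeft α
  have m2 : MeasurableEmbedding (fun s : ℝ => α - s) := measurableEmbedding_subLeft α
  have p1 : (fun s : ℝ => α + s) ⁻¹' Ioi (α + ε) = Ioi ε := by ext; simp
  have p2 : (fun s : ℝ => α - s) ⁻¹' Iio (α - ε) = Ioi ε := by ext; simp
  have i1 : IntegrableOn (fun s => g (α + s)) (Ioi ε) := by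
    rw [← p1]; exact (e1.integrableOn_comp_preimage m1).2 h1
  have i2 : IntegrableOn (fun s => g (α - s)) (Ioi ε) := by
    rw [← p2]; exact (e2.integrableOn_comp_preimage m2).2 h2
  refine ⟨i1.add i2, ?_⟩
  have hd : Disjoint (Ioi (α + ε)) (Iio (α - ε)) := by
    rw [Set.disjoint_left]; intro x hx hx'
    simp only [mem_Ioi, mem_Iio] at hx hx'; linarith
  rw [setIntegral_union hd measurableSet_Iio h1 h2, ← e1.setIntegral_preimage_emb m1 g (Ioi _),
    ← e2.setIntegral_preimage_emb m2 g (Iio _), p1, p2, ← integral_add i1 i2]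
  rfl

theorem integral_sym {g : ℝ → ℂ} (hg : Integrable g) (α : ℝ) :
    IntegrableOn (sym g α) (Ioi 0) ∧ ∫ s in Ioi 0, sym g α s = ∫ β, g β := by
  have h := integrableOn_sym_of_integrableOn (α := α) (hg.integrableOn (s := {β | 0 < |α - β|})) le_rfl
  refine ⟨h.1, h.2.trans ?_⟩
  have : {β | 0 < |α - β|} = {α}ᶜ := by
    ext β; simp [sub_eq_zero, eq_comm]
  rw [this]
  refine setIntegral_eq_integral_of_ae_compl_eq_zero ?_
  filter_upwards [compl_mem_ae_iff.2 (show volume ({α} : Set ℝ) = 0 by simp)] with x hx hx'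
  exact absurd hx hx'

/-- Cancellation between the two sides of the singularity can make the symmetrised kernel absolutely
integrable; the principal value is then an ordinary integral, to which the theory of tame kernels
applies. -/
theorem hasPV_of_integrableOn_sym {g : ℝ → ℂ} {α : ℝ}
    (hg : ∀ ε > 0, IntegrableOn g {β | ε < |α - β|}) (hs : IntegrableOn (sym g α) (Ioi 0)) :
    HasPV g α (∫ s in Ioi 0, sym g α s) := by
  refine ⟨hg, ?_⟩
  have h : Tendsto (fun ε : ℝ => ∫ s in Ioi ε, sym g α s) (𝓝[>] 0) (𝓝 (∫ s in Ioi 0, sym g α s)) := by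
    have hc : ContinuousWithinAt (fun ε : ℝ => ∫ s in Ioi ε, sym g α s) (Ici 0) 0 := by
      exact hs.continuousWithinAt_Ici_primitive_Ioi
    exact hc.tendsto.mono_left (nhdsWithin_mono _ Ioi_subset_Ici_self)
  refine h.congr' ?_
  filter_upwards [self_mem_nhdsWithin] with ε hε
  exact (integrableOn_sym_of_integrableOn (hg ε hε) (mem_Ioi.1 hε).le).2

/-! ### Bounded Hölder functions and square integrable functions -/

/-- Bounded and Hölder continuous of exponent `1/2`, with constant `C`. -/
structure Hold (C : ℝ) (w : ℝ → ℂ) : Prop where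
  bound : ∀ x, ‖w x‖ ≤ C
  holder : ∀ x y, ‖w x - w y‖ ≤ C * √|x - y|

/-- Square integrable, with norm at most `C`. -/
structure SqInt (C : ℝ) (w : ℝ → ℂ) : Prop where
  memLp : MemLp w 2 volume
  norm_le : eLpNorm w 2 volume ≤ ENNReal.ofReal C

theorem Hold.nonneg {C : ℝ} {w : ℝ → ℂ} (h : Hold C w) : 0 ≤ C := (norm_nonneg _).trans (h.bound 0)

theorem Hold.mono {C D : ℝ} {w : ℝ → ℂ} (h : Hold C w) (hCD : C ≤ D) : Hold D w where
  bound x := (h.bound x).trans hCD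
  holder x y := (h.holder x y).trans (by gcongr)

theorem SqInt.mono {C D : ℝ} {w : ℝ → ℂ} (h : SqInt C w) (hCD : C ≤ D) : SqInt D w where
  memLp := h.memLp
  norm_le := h.norm_le.trans (ENNReal.ofReal_le_ofReal hCD)

theorem Hold.continuous {C : ℝ} {w : ℝ → ℂ} (h : Hold C w) : Continuous w := by
  rw [continuous_iff_continuousAt]
  intro x
  rw [ContinuousAt, tendsto_iff_norm_sub_tendsto_zero]
  refine squeeze_zero (fun _ => norm_nonneg _) (fun y => h.holder y x) ?_
  have : Continuous fun y : ℝ => C * √|y - x| := by fun_prop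
  simpa using this.tendsto x

theorem Hold.const (a : ℂ) : Hold ‖a‖ (fun _ => a) where
  bound _ := le_rfl
  holder x y := by simpa using by positivity

theorem Hold.add {C D : ℝ} {f g : ℝ → ℂ} (hf : Hold C f) (hg : Hold D g) :
    Hold (C + D) (fun x => f x + g x) where
  bound x := (norm_add_le _ _).trans (add_le_add (hf.bound x) (hg.bound x))
  holder x y := by
    rw [add_sub_add_comm, add_mul]
    exact (norm_add_le _ _).trans (add_le_add (hf.holder x y) (hg.holder x y))

theorem Hold.mul {C D : ℝ} {f g : ℝ → ℂ} (hf : Hold C f) (hg : Hold D g) :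
    Hold (2 * C * D) (fun x => f x * g x) where
  bound x := by
    have h1 := hf.nonneg
    have h2 := hg.nonneg
    rw [norm_mul]
    have := mul_le_mul (hf.bound x) (hg.bound x) (norm_nonneg _) h1
    nlinarith
  holder x y := by
    have h1 := hf.nonneg
    have h2 := hg.nonneg
    have e : f x * g x - f y * g y = f x * (g x - g y) + (f x - f y) * g y := by ring
    rw [e]
    refine (norm_add_le _ _).trans ?_
    rw [norm_mul, norm_mul]
    have a := mul_le_mul (hf.bound x) (hg.holder x y) (norm_nonneg _) h1
    have b := mul_le_mul (hf.holder x y) (hg.bound y) (norm_nonneg _) (by positivity)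
    linarith

theorem Hold.neg {C : ℝ} {f : ℝ → ℂ} (hf : Hold C f) : Hold C (fun x => -f x) where
  bound x := by simpa using hf.bound x
  holder x y := by
    rw [neg_sub_neg, norm_sub_rev]; exact hf.holder x y

theorem Hold.sub {C D : ℝ} {f g : ℝ → ℂ} (hf : Hold C f) (hg : Hold D g) :
    Hold (C + D) (fun x => f x - g x) := by
  simpa [sub_eq_add_neg] using hf.add hg.neg

theorem Hold.conj {C : ℝ} {f : ℝ → ℂ} (hf : Hold C f) :
    Hold C (fun x => starRingEnd ℂ (f x)) where
  bound x := by simpa using hf.bound x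
  holder x y := by
    rw [← map_sub, RCLike.norm_conj]; exact hf.holder x y

theorem Hold.inv {c D : ℝ} {g : ℝ → ℂ} (hc : 0 < c) (hg : Hold D g) (h : ∀ x, c ≤ ‖g x‖) :
    Hold (1 / c + D / c ^ 2) (fun x => (g x)⁻¹) where
  bound x := by
    have := hg.nonneg
    rw [norm_inv]
    have h1 : ‖g x‖⁻¹ ≤ 1 / c := by rw [one_div]; exact inv_anti₀ hc (h x)
    have : 0 ≤ D / c ^ 2 := by positivity
    linarith
  holder x y := by
    have h0 := hg.nonneg
    have hx : g x ≠ 0 := norm_pos_iff.1 (hc.trans_le (h x))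
    have hy : g y ≠ 0 := norm_pos_iff.1 (hc.trans_le (h y))
    rw [inv_sub_inv hx hy, norm_div, norm_mul, norm_sub_rev]
    have h1 : c ^ 2 ≤ ‖g x‖ * ‖g y‖ := by
      rw [sq]; exact mul_le_mul (h x) (h y) hc.le (norm_nonneg _)
    calc ‖g x - g y‖ / (‖g x‖ * ‖g y‖) ≤ (D * √|x - y|) / c ^ 2 :=
          div_le_div₀ (by positivity) (hg.holder x y) (by positivity) h1
      _ = D / c ^ 2 * √|x - y| := by ring
      _ ≤ _ := by
          gcongr
          have : 0 < 1 / c := by positivity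
          linarith

theorem Hold.div {c C D : ℝ} {f g : ℝ → ℂ} (hc : 0 < c) (hf : Hold C f) (hg : Hold D g)
    (h : ∀ x, c ≤ ‖g x‖) : Hold (2 * C * (1 / c + D / c ^ 2)) (fun x => f x / g x) := by
  simpa [div_eq_mul_inv] using hf.mul (hg.inv hc h)

theorem SqInt.of_norm_le {C A : ℝ} {f g : ℝ → ℂ} (hf : SqInt C f)
    (hg : AEStronglyMeasurable g volume) (h : ∀ x, ‖g x‖ ≤ A * ‖f x‖) (hA : 0 ≤ A) :
    SqInt (A * C) g where
  memLp := hf.memLp.of_le_mul hg (.of_forall h)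
  norm_le := by
    rw [ENNReal.ofReal_mul hA]
    exact (eLpNorm_le_mul_eLpNorm_of_ae_le_mul (.of_forall h) 2).trans (by gcongr; exact hf.norm_le)

theorem SqInt.mul_hold {C D : ℝ} {f g : ℝ → ℂ} (hf : SqInt C f) (hg : Hold D g) :
    SqInt (D * C) (fun x => g x * f x) :=
  hf.of_norm_le (hg.continuous.aestronglyMeasurable.mul hf.memLp.1)
    (fun x => by rw [norm_mul]; gcongr; exact hg.bound x) hg.nonneg

theorem SqInt.conj {C : ℝ} {f : ℝ → ℂ} (hf : SqInt C f) :
    SqInt C (fun x => starRingEnd ℂ (f x)) := by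
  simpa using hf.of_norm_le (A := 1)
    (Complex.continuous_conj.comp_aestronglyMeasurable hf.memLp.1) (fun x => by simp) zero_le_one

/-! ### Averages along segments -/

/-- The average of `v` over the segment from `x` to `y`. -/
def avg (v : ℝ → ℂ) (x y : ℝ) : ℂ := ∫ θ in (0 : ℝ)..1, v (x + θ * (y - x))

theorem avg_self (v : ℝ → ℂ) (x : ℝ) : avg v x x = v x := by simp [avg]

/-- The factor α − β carries the whole vanishing of a chord, and the remaining average stays Hölder
across the diagonal. -/
theorem sub_eq_avg {z v : ℝ → ℂ} (hz : ∀ x, HasDerivAt z (v x) x) (hv : Continuous v) (x y : ℝ) :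
    z x - z y = ((x : ℂ) - y) * avg v x y := by
  have hd : ∀ θ ∈ uIcc (0 : ℝ) 1, HasDerivAt (fun θ : ℝ => z (x + θ * (y - x)))
      ((y - x) • v (x + θ * (y - x))) θ := by
    intro θ _
    have h1 : HasDerivAt (fun θ : ℝ => x + θ * (y - x)) (y - x) θ := by
      simpa using ((hasDerivAt_id θ).mul_const (y - x)).const_add x
    exact (hz _).scomp θ h1
  have h := intervalIntegral.integral_eq_sub_of_hasDerivAt hd
    (Continuous.intervalIntegrable (by fun_prop) _ _)
  rw [intervalIntegral.integral_smul] at h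
  simp only [one_mul, add_sub_cancel, zero_mul, add_zero, Complex.real_smul,
    Complex.ofReal_sub] at h
  rw [avg]
  linear_combination h

theorem avg_eq_div {z v : ℝ → ℂ} (hz : ∀ x, HasDerivAt z (v x) x) (hv : Continuous v) {x y : ℝ}
    (hxy : x ≠ y) : avg v x y = (z x - z y) / ((x : ℂ) - y) := by
  have : (x : ℂ) - y ≠ 0 := by rw [sub_ne_zero]; exact_mod_cast hxy
  rw [sub_eq_avg hz hv, mul_div_cancel_left₀ _ this]

theorem Hold.norm_avg_le {C : ℝ} {v : ℝ → ℂ} (hv : Hold C v) (x y : ℝ) : ‖avg v x y‖ ≤ C := by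
  simpa [WaterWave.avg] using intervalIntegral.norm_integral_le_of_norm_le_const
    (a := 0) (b := 1) (fun θ _ => hv.bound (x + θ * (y - x)))

theorem Hold.avg {C : ℝ} {v : ℝ → ℂ} (hv : Hold C v) (x : ℝ) : Hold C (avg v x) where
  bound := hv.norm_avg_le x
  holder y y' := by
    have hc := hv.continuous
    have h0 := hv.nonneg
    rw [WaterWave.avg, WaterWave.avg, ← intervalIntegral.integral_sub
      (Continuous.intervalIntegrable (by fun_prop) _ _)
      (Continuous.intervalIntegrable (by fun_prop) _ _)]
    have := intervalIntegral.norm_integral_le_of_norm_le_const (a := 0) (b := 1)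
      (f := fun θ : ℝ => v (x + θ * (y - x)) - v (x + θ * (y' - x))) (C := C * √|y - y'|) ?_
    · simpa using this
    intro θ hθ
    rw [uIoc_of_le zero_le_one] at hθ
    refine (hv.holder _ _).trans ?_
    have e : x + θ * (y - x) - (x + θ * (y' - x)) = θ * (y - y') := by ring
    rw [e, abs_mul, abs_of_pos hθ.1]
    gcongr
    exact mul_le_of_le_one_left (abs_nonneg _) hθ.2

/-! ### Chord-arc curves -/

/-- A chord-arc curve `z` with derivative `v`. -/
structure Curve (c C : ℝ) (z v : ℝ → ℂ) : Prop where
  pos : 0 < c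
  hasDerivAt : ∀ x, HasDerivAt z (v x) x
  hold : Hold C v
  chord : ∀ x y, c * |x - y| ≤ ‖z x - z y‖

section Curve
variable {c C : ℝ} {z v : ℝ → ℂ}

theorem Curve.continuous (h : Curve c C z v) : Continuous z :=
  continuous_iff_continuousAt.2 fun x => (h.hasDerivAt x).continuousAt

theorem Curve.sub_ne_zero (h : Curve c C z v) {x y : ℝ} (hxy : x ≠ y) : z x - z y ≠ 0 := by
  refine norm_pos_iff.1 (lt_of_lt_of_le ?_ (h.chord x y))
  have := h.pos
  have := abs_pos.2 (_root_.sub_ne_zero.2 hxy)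
  positivity

theorem Curve.sub_eq (h : Curve c C z v) (x y : ℝ) : z x - z y = ((x : ℂ) - y) * avg v x y :=
  sub_eq_avg h.hasDerivAt h.hold.continuous x y

/-- Off the diagonal this is the chord-arc inequality; the diagonal follows by continuity. -/
theorem Curve.le_norm_avg (h : Curve c C z v) (x y : ℝ) : c ≤ ‖avg v x y‖ := by
  have key : ∀ y ≠ x, c ≤ ‖avg v x y‖ := by
    intro y hy
    have h1 := h.chord x y
    have h2 : 0 < |x - y| := abs_pos.2 (_root_.sub_ne_zero.2 hy.symm)
    rw [h.sub_eq, norm_mul, ← Complex.ofReal_sub, Complex.norm_real, Real.norm_eq_abs,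
      mul_comm c] at h1
    exact le_of_mul_le_mul_left h1 h2
  rcases eq_or_ne y x with rfl | hy
  · have h1 : Tendsto (fun x => ‖avg v y x‖) (𝓝[≠] y) (𝓝 ‖avg v y y‖) :=
      ((h.hold.avg y).continuous.norm.tendsto y).mono_left nhdsWithin_le_nhds
    exact ge_of_tendsto h1 (by filter_upwards [self_mem_nhdsWithin] with a ha using key a ha)
  · exact key y hy

theorem Curve.const_nonneg (h : Curve c C z v) : 0 ≤ C := h.hold.nonneg

/-- The divided difference of a function with derivative `u'`, along the curve. -/
def dq (v u' : ℝ → ℂ) (x y : ℝ) : ℂ := avg u' x y / avg v x y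

theorem Curve.dq_eq (h : Curve c C z v) {u u' : ℝ → ℂ} (hu : ∀ x, HasDerivAt u (u' x) x)
    (hc : Continuous u') {x y : ℝ} (hxy : x ≠ y) : dq v u' x y = (u x - u y) / (z x - z y) := by
  have : (x : ℂ) - y ≠ 0 := by rw [_root_.sub_ne_zero]; exact_mod_cast hxy
  rw [dq, h.sub_eq, sub_eq_avg hu hc, mul_div_mul_left _ _ this]

theorem Curve.hold_dq (h : Curve c C z v) {D : ℝ} {u' : ℝ → ℂ} (hu : Hold D u') (x : ℝ) :
    Hold (2 * D * (1 / c + C / c ^ 2)) (dq v u' x) :=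
  (hu.avg x).div h.pos (h.hold.avg x) (h.le_norm_avg x)

theorem Curve.norm_dq_le (h : Curve c C z v) {D : ℝ} {u' : ℝ → ℂ} (hu : Hold D u') (x y : ℝ) :
    ‖dq v u' x y‖ ≤ D / c := by
  rw [dq, norm_div]
  exact div_le_div₀ hu.nonneg (hu.norm_avg_le x y) h.pos (h.le_norm_avg x y)

theorem Curve.norm_div_sub_le (h : Curve c C z v) {a : ℂ} {D x y : ℝ} (hxy : x ≠ y)
    (ha : ‖a‖ ≤ D) : ‖a / (z x - z y)‖ ≤ D / c / |x - y| := by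
  have h2 : 0 < |x - y| := abs_pos.2 (_root_.sub_ne_zero.2 hxy)
  have := h.pos
  rw [norm_div, div_div]
  exact div_le_div₀ ((norm_nonneg a).trans ha) ha (by positivity) (h.chord x y)

theorem Curve.norm_dq_le' (h : Curve c C z v) {D : ℝ} {u u' : ℝ → ℂ}
    (hu : ∀ x, HasDerivAt u (u' x) x) (hc : Continuous u') (hb : ∀ x, ‖u x‖ ≤ D) {x y : ℝ}
    (hxy : x ≠ y) : ‖dq v u' x y‖ ≤ 2 * D / c / |x - y| := by
  rw [h.dq_eq hu hc hxy]
  refine h.norm_div_sub_le hxy ((norm_sub_le _ _).trans ?_)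
  linarith [hb x, hb y]

end Curve

/-! ### Tameness of the symmetrised kernels -/

/-- Cauchy–Schwarz on (R, ∞): the function 1/s has L² norm R^(-1/2) there, and the remaining 1/s²
integrates to 1/R ≤ 1/√R. -/
theorem tail_sym_le {g w : ℝ → ℂ} {α A C R : ℝ} (hA : 0 ≤ A) (hC : 0 ≤ C) (hw : SqInt C w)
    (hR : 1 ≤ R) (hg : ∀ β, 1 ≤ |α - β| → ‖g β‖ ≤ A * (‖w β‖ + 1 / |α - β|) / |α - β|) :
    ∫⁻ s in Ioi R, ‖sym g α s‖ₑ ≤ ENNReal.ofReal (2 * A * (C + 1) / √R) := by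
  have hR0 : 0 < R := by linarith
  have hsq : ∫⁻ s in Ioi R, ENNReal.ofReal (1 / s) ^ (2 : ℝ) = ENNReal.ofReal (1 / R) := by
    have h1 : ∫ s in Ioi R, s ^ (-2 : ℝ) = 1 / R := by
      rw [integral_Ioi_rpow_of_lt (by norm_num) hR0]
      norm_num [Real.rpow_neg hR0.le]
    rw [← h1, ofReal_integral_eq_lintegral_ofReal
      (integrableOn_Ioi_rpow_of_lt (by norm_num) hR0)]
    · refine setLIntegral_congr_fun measurableSet_Ioi fun s hs => ?_
      have hs0 : 0 < s := hR0.trans hs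
      rw [ENNReal.ofReal_rpow_of_nonneg (by positivity) (by norm_num)]
      congr 1
      rw [one_div, Real.inv_rpow hs0.le, Real.rpow_neg hs0.le]
    · refine (ae_restrict_iff' measurableSet_Ioi).2 (.of_forall fun s hs => ?_)
      have hs0 : 0 < s := hR0.trans hs
      simp only [Pi.zero_apply]
      positivity
  have hhalf : ∀ w : ℝ → ℂ, SqInt C w →
      ∫⁻ s in Ioi R, ‖w s‖ₑ * ENNReal.ofReal (1 / s) ≤ ENNReal.ofReal (C / √R) := by
    intro w hw
    have := ENNReal.lintegral_mul_le_Lp_mul_Lq (volume.restrict (Ioi R))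
      Real.HolderConjugate.two_two (f := fun s => ‖w s‖ₑ)
      (g := fun s => ENNReal.ofReal (1 / s)) hw.memLp.1.restrict.enorm
      (by fun_prop)
    refine this.trans ?_
    rw [hsq, div_eq_mul_inv C, ENNReal.ofReal_mul hC]
    have h2 := hw.norm_le
    rw [eLpNorm_eq_lintegral_rpow_enorm_toReal (by norm_num) (by norm_num)] at h2
    simp only [ENNReal.toReal_ofNat] at h2
    refine mul_le_mul ((ENNReal.rpow_le_rpow (setLIntegral_le_lintegral _ _) (by norm_num)).trans
      h2) (le_of_eq ?_) (by positivity) (by positivity)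
    rw [ENNReal.ofReal_rpow_of_pos (by positivity), one_div R, Real.inv_rpow hR0.le,
      Real.sqrt_eq_rpow]
  have w1 : SqInt C (fun s => w (α + s)) := by
    have e1 : MeasurePreserving (fun s : ℝ => α + s) := measurePreserving_add_left volume α
    exact ⟨hw.memLp.comp_measurePreserving e1,
      (eLpNorm_comp_measurePreserving hw.memLp.1 e1).trans_le hw.norm_le⟩
  have w2 : SqInt C (fun s => w (α - s)) := by
    have e1 : MeasurePreserving (fun s : ℝ => α - s) := Measure.measurePreserving_sub_left volume α
    exact ⟨hw.memLp.comp_measurePreserving e1,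
      (eLpNorm_comp_measurePreserving hw.memLp.1 e1).trans_le hw.norm_le⟩
  have hpt : ∀ s ∈ Ioi R, ‖sym g α s‖ₑ ≤ ENNReal.ofReal A *
      ((‖w (α + s)‖ₑ * ENNReal.ofReal (1 / s) + ‖w (α - s)‖ₑ * ENNReal.ofReal (1 / s)) +
        2 * ENNReal.ofReal (1 / s) ^ (2 : ℝ)) := by
    intro s hs
    have hs0 : 0 < s := hR0.trans hs
    have hs1 : 1 ≤ s := hR.trans (mem_Ioi.1 hs).le
    have g1 := hg (α + s) (by simpa [abs_of_pos hs0] using hs1)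
    have g2 := hg (α - s) (by simpa [abs_of_pos hs0] using hs1)
    rw [show |α - (α + s)| = s by simp [abs_of_pos hs0]] at g1
    rw [show |α - (α - s)| = s by simp [abs_of_pos hs0]] at g2
    have : ‖sym g α s‖ ≤ A * ((‖w (α + s)‖ * (1 / s) + ‖w (α - s)‖ * (1 / s)) +
        2 * (1 / s) ^ (2 : ℝ)) := by
      refine (norm_add_le _ _).trans ((add_le_add g1 g2).trans (le_of_eq ?_))
      norm_num
      field_simp
      ring
    rw [← ofReal_norm]
    refine (ENNReal.ofReal_le_ofReal this).trans (le_of_eq ?_)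
    rw [ENNReal.ofReal_mul hA, ENNReal.ofReal_add (by positivity) (by positivity),
      ENNReal.ofReal_add (by positivity) (by positivity), ENNReal.ofReal_mul (norm_nonneg _),
      ENNReal.ofReal_mul (norm_nonneg _), ENNReal.ofReal_mul (by norm_num), ofReal_norm,
      ofReal_norm, ENNReal.ofReal_rpow_of_nonneg (by positivity) (by norm_num)]
    norm_num
  refine (setLIntegral_mono' measurableSet_Ioi hpt).trans ?_
  rw [lintegral_const_mul' _ _ (by simp)]
  have m1 : AEMeasurable (fun s => ‖w (α + s)‖ₑ * ENNReal.ofReal (1 / s))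
      (volume.restrict (Ioi R)) :=
    (w1.memLp.1.restrict.enorm).mul (by fun_prop)
  have m2 : AEMeasurable (fun s => ‖w (α - s)‖ₑ * ENNReal.ofReal (1 / s))
      (volume.restrict (Ioi R)) :=
    (w2.memLp.1.restrict.enorm).mul (by fun_prop)
  have m3 : AEMeasurable (fun s => ‖w (α + s)‖ₑ * ENNReal.ofReal (1 / s) +
      ‖w (α - s)‖ₑ * ENNReal.ofReal (1 / s)) (volume.restrict (Ioi R)) := m1.add m2
  rw [lintegral_add_left' m3, lintegral_add_left' m1,
    lintegral_const_mul' _ _ (by simp), hsq]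
  have hroot : 1 / R ≤ 1 / √R := by
    refine one_div_le_one_div_of_le (by positivity) ?_
    rw [Real.sqrt_le_iff]; exact ⟨hR0.le, by nlinarith⟩
  calc _ ≤ ENNReal.ofReal A * ((ENNReal.ofReal (C / √R) + ENNReal.ofReal (C / √R)) +
        2 * ENNReal.ofReal (1 / √R)) := by
        gcongr
        · exact hhalf _ w1
        · exact hhalf _ w2
    _ = _ := by
        rw [show (2 : ℝ≥0∞) = ENNReal.ofReal 2 by norm_num,
          ← ENNReal.ofReal_mul (by norm_num), ← ENNReal.ofReal_add (by positivity) (by positivity),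
          ← ENNReal.ofReal_add (by positivity) (by positivity), ← ENNReal.ofReal_mul hA]
        congr 1
        ring

theorem norm_sym_le_of_bound {g : ℝ → ℂ} {α D s : ℝ} (hs : 0 < s)
    (hg : ∀ β ≠ α, ‖g β‖ ≤ D / √|α - β|) : ‖sym g α s‖ ≤ 2 * D / √s := by
  have g1 := hg (α + s) (by intro h; linarith)
  have g2 := hg (α - s) (by intro h; linarith)
  rw [show |α - (α + s)| = s by simp [abs_of_pos hs]] at g1
  rw [show |α - (α - s)| = s by simp [abs_of_pos hs]] at g2
  refine (norm_add_le _ _).trans ((add_le_add g1 g2).trans (le_of_eq (by ring)))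

/-- The odd factor 1/(α − β) turns the symmetric sum into the difference quotient (e(α − s) − e(α +
s))/s, and the Hölder bound leaves s^(-1/2). -/
theorem norm_sym_le_of_hold {e : ℝ → ℂ} {α D s : ℝ} (hs : 0 < s) (he : Hold D e) :
    ‖sym (fun β => e β / ((α : ℂ) - β)) α s‖ ≤ 2 * D / √s := by
  have h0 := he.nonneg
  have e1 : sym (fun β => e β / ((α : ℂ) - β)) α s = (e (α - s) - e (α + s)) / (s : ℂ) := by
    have : (s : ℂ) ≠ 0 := by exact_mod_cast hs.ne'
    simp only [sym]
    push_cast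
    rw [show (α : ℂ) - (α + s) = -s by ring, show (α : ℂ) - (α - s) = s by ring]
    field_simp
    ring
  rw [e1, norm_div, Complex.norm_real, Real.norm_eq_abs, abs_of_pos hs]
  have h1 := he.holder (α - s) (α + s)
  rw [show |α - s - (α + s)| = 2 * s by
    rw [show α - s - (α + s) = -(2 * s) by ring, abs_neg, abs_of_pos (by positivity)]] at h1
  have h2 : √(2 * s) ≤ 2 * √s := by
    rw [Real.sqrt_mul (by norm_num)]
    gcongr
    rw [Real.sqrt_le_iff]; norm_num
  have h3 := Real.mul_self_sqrt hs.le
  have h4 : 0 < √s := Real.sqrt_pos.2 hs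
  rw [div_le_div_iff₀ hs h4]
  calc ‖e (α - s) - e (α + s)‖ * √s ≤ (D * (2 * √s)) * √s := by gcongr; exact h1.trans (by gcongr)
    _ = 2 * D * s := by linear_combination 2 * D * h3

theorem tame_sym {g w : ℝ → ℂ} {α A C D : ℝ} (hA : 0 ≤ A) (hC : 0 ≤ C) (hD : 0 ≤ D)
    (hgc : ContinuousOn g {α}ᶜ) (hw : SqInt C w) (hb : ∀ s > 0, ‖sym g α s‖ ≤ 2 * D / √s)
    (hg : ∀ β, 1 ≤ |α - β| → ‖g β‖ ≤ A * (‖w β‖ + 1 / |α - β|) / |α - β|) :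
    Tame (2 * D + 2 * A * (C + 1)) (sym g α) where
  meas := aestronglyMeasurable_sym hgc
  bound s hs := (hb s hs).trans (by gcongr; have : 0 ≤ 2 * A * (C + 1) := by positivity
                                    linarith)
  tail R hR := (tail_sym_le hA hC hw hR hg).trans (by gcongr; linarith)

/-- Because min(1, 1/r) ≤ r^(-1/2). -/
theorem le_div_sqrt_of_le {x A r : ℝ} (hr : 0 < r) (hA : 0 ≤ A) (h1 : x ≤ A) (h2 : x ≤ A / r) :
    x ≤ A / √r := by
  have h4 : 0 < √r := Real.sqrt_pos.2 hr
  have h3 := Real.mul_self_sqrt hr.le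
  rw [le_div_iff₀ h4]
  rcases le_total r 1 with h | h
  · have : √r ≤ 1 := Real.sqrt_le_one.2 h
    rcases le_total x 0 with hx | hx <;> nlinarith
  · rw [le_div_iff₀ hr] at h2
    have : 1 ≤ √r := by rwa [Real.one_le_sqrt]
    rcases le_total x 0 with hx | hx
    · nlinarith
    · nlinarith [mul_nonneg hx h4.le]

/-! ### The Cauchy and divided difference kernels, and their time derivatives -/

section Kernels
variable {c C : ℝ} {z v : ℝ → ℂ}

/-- The kernel of the Cauchy integral. -/
def cauchyKer (z w : ℝ → ℂ) (α : ℝ) : ℝ → ℂ := fun β => w β / (z α - z β)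

/-- The principal value Cauchy integral of `w` along `z`. -/
def cauchyInt (z w : ℝ → ℂ) (α : ℝ) : ℂ := ∫ s in Ioi 0, sym (cauchyKer z w α) α s

theorem Curve.continuousOn_sub_inv (h : Curve c C z v) (α : ℝ) :
    ContinuousOn (fun β => (z α - z β)⁻¹) {α}ᶜ :=
  ContinuousOn.inv₀ (by have := h.continuous; fun_prop) fun β hβ => h.sub_ne_zero (Ne.symm hβ)

theorem Curve.continuousOn_cauchyKer (h : Curve c C z v) {w : ℝ → ℂ} (hw : Continuous w) (α : ℝ) :
    ContinuousOn (cauchyKer z w α) {α}ᶜ := by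
  unfold cauchyKer
  simp only [div_eq_mul_inv]
  exact hw.continuousOn.mul (h.continuousOn_sub_inv α)

theorem Curve.norm_sym_cauchyKer_le (h : Curve c C z v) {D : ℝ} {w : ℝ → ℂ} (hw : Hold D w)
    (α : ℝ) {s : ℝ} (hs : 0 < s) :
    ‖sym (cauchyKer z w α) α s‖ ≤ 2 * (2 * D * (1 / c + C / c ^ 2)) / √s := by
  have := norm_sym_le_of_hold (α := α) hs (hw.div h.pos (h.hold.avg α) (h.le_norm_avg α))
  rwa [sym_congr hs (h := cauchyKer z w α)] at this
  intro β _
  rw [cauchyKer, h.sub_eq, div_div, mul_comm]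

theorem Curve.tame_cauchyKer (h : Curve c C z v) {D E : ℝ} {w : ℝ → ℂ} (hw : Hold D w)
    (hE : 0 ≤ E) (hw2 : SqInt E w) (α : ℝ) :
    Tame (2 * (2 * D * (1 / c + C / c ^ 2)) + 2 * (1 / c) * (E + 1)) (sym (cauchyKer z w α) α) := by
  have hc := h.pos
  have hC := h.const_nonneg
  have hD := hw.nonneg
  refine tame_sym (by positivity) hE (by positivity)
    (h.continuousOn_cauchyKer hw.continuous α) hw2 (fun s hs => h.norm_sym_cauchyKer_le hw α hs) ?_
  intro β hβ
  have hne : α ≠ β := by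
    rintro rfl; norm_num at hβ
  refine (h.norm_div_sub_le hne le_rfl).trans ?_
  have : 0 ≤ 1 / |α - β| := by positivity
  rw [show ‖w β‖ / c = 1 / c * ‖w β‖ by ring]
  gcongr
  linarith

/-- The kernel `(u(α) - u(β)) / (z(α) - z(β)) * w(β)`. -/
def dqKer (z u w : ℝ → ℂ) (α : ℝ) : ℝ → ℂ := fun β => (u α - u β) / (z α - z β) * w β

theorem Curve.continuousOn_dqKer (h : Curve c C z v) {u w : ℝ → ℂ} (hu : Continuous u)
    (hw : Continuous w) (α : ℝ) : ContinuousOn (dqKer z u w α) {α}ᶜ := by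
  unfold dqKer
  simp only [div_eq_mul_inv]
  exact ((by fun_prop : ContinuousOn (fun β => u α - u β) _).mul (h.continuousOn_sub_inv α)).mul
    hw.continuousOn

theorem Curve.norm_dq_le_div_sqrt (h : Curve c C z v) {D : ℝ} {u u' : ℝ → ℂ}
    (hu : ∀ x, HasDerivAt u (u' x) x) (hu' : Hold D u') (hb : ∀ x, ‖u x‖ ≤ D) {α β : ℝ}
    (hne : α ≠ β) : ‖(u α - u β) / (z α - z β)‖ ≤ 2 * D / c / √|α - β| := by
  have hc := h.pos
  have hD := hu'.nonneg
  refine le_div_sqrt_of_le (abs_pos.2 (_root_.sub_ne_zero.2 hne)) (by positivity) ?_ ?_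
  · rw [← h.dq_eq hu hu'.continuous hne]
    refine (h.norm_dq_le hu' _ _).trans ?_
    gcongr; linarith
  · rw [← h.dq_eq hu hu'.continuous hne]
    exact h.norm_dq_le' hu hu'.continuous hb hne

theorem Curve.tame_dqKer (h : Curve c C z v) {D : ℝ} {u u' w : ℝ → ℂ}
    (hu : ∀ x, HasDerivAt u (u' x) x) (hu' : Hold D u') (hb : ∀ x, ‖u x‖ ≤ D)
    (hw : Hold D w) (hw2 : SqInt D w) (α : ℝ) :
    Tame (2 * (2 * D / c * D) + 2 * (2 * D / c) * (D + 1)) (sym (dqKer z u w α) α) := by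
  have hc := h.pos
  have hD := hw.nonneg
  have huc : Continuous u := continuous_iff_continuousAt.2 fun x => (hu x).continuousAt
  refine tame_sym (by positivity) hD (by positivity)
    (h.continuousOn_dqKer huc hw.continuous α) hw2 (fun s hs => ?_) ?_
  · refine norm_sym_le_of_bound hs fun β hβ => ?_
    rw [dqKer, norm_mul]
    refine (mul_le_mul (h.norm_dq_le_div_sqrt hu hu' hb hβ.symm) (hw.bound β) (norm_nonneg _)
      (by positivity)).trans (le_of_eq (by ring))
  · intro β hβ
    have hne : α ≠ β := by
      rintro rfl; norm_num at hβ
    rw [dqKer, norm_mul, ← h.dq_eq hu hu'.continuous hne]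
    have h1 := h.norm_dq_le' hu hu'.continuous hb hne
    calc _ ≤ 2 * D / c / |α - β| * ‖w β‖ := by gcongr
      _ = 2 * D / c * (‖w β‖ + 0) / |α - β| := by ring
      _ ≤ _ := by gcongr; positivity

/-- The time derivative of the kernel `z'(β) / (z(α) - z(β))`, times `u(β)`, when `z` moves with
velocity `q`. -/
def cauchyDerivKer (z v q q' u : ℝ → ℂ) (α : ℝ) : ℝ → ℂ := fun β =>
  (q' β / (z α - z β) - v β * (q α - q β) / (z α - z β) ^ 2) * u β

/-- The apparent double pole is milder: over a single factor α − β the numerator q'(β)·avg v −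
v(β)·avg q' is Hölder and vanishes at β = α, so the kernel is O(|α − β|^(-1/2)) without
symmetrisation. Only boundedness of `u` is used, so the height, which need not be square integrable,
is admissible. -/
theorem Curve.tame_cauchyDerivKer (h : Curve c C z v) {D : ℝ} {q q' u : ℝ → ℂ}
    (hq : ∀ x, HasDerivAt q (q' x) x) (hq' : Hold D q') (hq2 : SqInt D q') (hb : ∀ x, ‖q x‖ ≤ D)
    (hu : Continuous u) (hub : ∀ x, ‖u x‖ ≤ D) (α : ℝ) :
    Tame (2 * ((2 * D * C + 2 * C * D) / c ^ 2 * D) + 2 * (D / c * (1 + C * 2 * D / c)) * (D + 1))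
      (sym (cauchyDerivKer z v q q' u α) α) := by
  have hc := h.pos
  have hC := h.const_nonneg
  have hD := hq'.nonneg
  have hqc : Continuous q := continuous_iff_continuousAt.2 fun x => (hq x).continuousAt
  refine tame_sym (by positivity) hD (by positivity) ?_ hq2 (fun s hs => ?_) ?_
  · unfold cauchyDerivKer
    simp only [div_eq_mul_inv, ← inv_pow]
    have h1 := h.continuousOn_sub_inv α
    have h2 := h.hold.continuous
    have h3 := hq'.continuous
    fun_prop
  · refine norm_sym_le_of_bound hs fun β hβ => ?_
    have hr : 0 < |α - β| := abs_pos.2 (_root_.sub_ne_zero.2 hβ.symm)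
    have hne : (α : ℂ) - β ≠ 0 := by rw [_root_.sub_ne_zero]; exact_mod_cast hβ.symm
    have hp : avg v α β ≠ 0 := norm_pos_iff.1 (hc.trans_le (h.le_norm_avg α β))
    have e : cauchyDerivKer z v q q' u α β =
        (q' β * avg v α β - v β * avg q' α β) / (((α : ℂ) - β) * avg v α β ^ 2) * u β := by
      rw [cauchyDerivKer, h.sub_eq, sub_eq_avg hq hq'.continuous]
      field_simp
    have hn := ((hq'.mul (h.hold.avg α)).sub (h.hold.mul (hq'.avg α))).holder β α
    simp only [avg_self] at hn
    rw [show q' α * v α - v α * q' α = 0 by ring, sub_zero, abs_sub_comm] at hn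
    rw [e, norm_mul, norm_div, norm_mul, norm_pow, ← Complex.ofReal_sub, Complex.norm_real,
      Real.norm_eq_abs]
    have hsq := Real.mul_self_sqrt hr.le
    have hs0 : 0 < √|α - β| := Real.sqrt_pos.2 hr
    calc _ ≤ ((2 * D * C + 2 * C * D) * √|α - β|) / (|α - β| * c ^ 2) * D := by
          gcongr
          · exact h.le_norm_avg α β
          · exact hub β
      _ = _ := by
          rw [show (2 * D * C + 2 * C * D) * √|α - β| / (|α - β| * c ^ 2) =
            (2 * D * C + 2 * C * D) * √|α - β| / (√|α - β| * √|α - β| * c ^ 2) by rw [hsq]]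
          field_simp
  · intro β hβ
    have hr : 0 < |α - β| := by linarith
    have hne : α ≠ β := by
      rintro rfl; norm_num at hβ
    have h1 : ‖q' β / (z α - z β)‖ ≤ ‖q' β‖ / c / |α - β| := h.norm_div_sub_le hne le_rfl
    have h2 : ‖v β * (q α - q β) / (z α - z β) ^ 2‖ ≤ C * (2 * D / c / |α - β|) * (1 / c / |α - β|) := by
      rw [show v β * (q α - q β) / (z α - z β) ^ 2 =
        v β * ((q α - q β) / (z α - z β)) * (1 / (z α - z β)) by
          have := h.sub_ne_zero hne; field_simp]
      rw [norm_mul, norm_mul]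
      gcongr
      · exact h.hold.bound β
      · refine h.norm_div_sub_le hne ((norm_sub_le _ _).trans ?_)
        linarith [hb α, hb β]
      · exact h.norm_div_sub_le hne (by simp)
    rw [cauchyDerivKer, norm_mul]
    calc _ ≤ (‖q' β‖ / c / |α - β| + C * (2 * D / c / |α - β|) * (1 / c / |α - β|)) * D := by
          gcongr
          · exact (norm_sub_le _ _).trans (add_le_add h1 h2)
          · exact hub β
      _ = D / c * (‖q' β‖ + C * 2 * D / c * (1 / |α - β|)) / |α - β| := by field_simp
      _ ≤ D / c * ((1 + C * 2 * D / c) * ‖q' β‖ + (1 + C * 2 * D / c) * (1 / |α - β|)) / |α - β| := by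
          gcongr
          · have : 0 ≤ C * 2 * D / c * ‖q' β‖ := by positivity
            linarith
          · linarith
      _ = _ := by ring

/-- The time derivative of the divided difference of the velocity `q`, times `w(β)`, for the
acceleration `r`. -/
def dqDerivKer (z q r w : ℝ → ℂ) (α : ℝ) : ℝ → ℂ := fun β =>
  ((r α - r β) / (z α - z β) - ((q α - q β) / (z α - z β)) ^ 2) * w β

/-- The acceleration enters only through its Hölder bound, which against a chord already gives |α −
β|^(-1/2); the divided difference of the velocity is bounded and decays. -/
theorem Curve.tame_dqDerivKer (h : Curve c C z v) {D : ℝ} {q q' r w : ℝ → ℂ}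
    (hq : ∀ x, HasDerivAt q (q' x) x) (hq' : Hold D q') (hb : ∀ x, ‖q x‖ ≤ D)
    (hr : Hold D r) (hw : Hold D w) (hw2 : SqInt D w) (α : ℝ) :
    Tame (2 * ((D / c + 2 * D / c * (D / c)) * D) + 2 * (2 * D / c + 2 * D / c * (D / c)) * (D + 1))
      (sym (dqDerivKer z q r w α) α) := by
  have hc := h.pos
  have hD := hw.nonneg
  have hqc : Continuous q := continuous_iff_continuousAt.2 fun x => (hq x).continuousAt
  refine tame_sym (by positivity) hD (by positivity) ?_ hw2 (fun s hs => ?_) ?_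
  · unfold dqDerivKer
    simp only [div_eq_mul_inv]
    have h1 := h.continuousOn_sub_inv α
    have h2 := hr.continuous
    have h3 := hw.continuous
    fun_prop
  · refine norm_sym_le_of_bound hs fun β hβ => ?_
    have hpos : 0 < |α - β| := abs_pos.2 (_root_.sub_ne_zero.2 hβ.symm)
    have hs0 : 0 < √|α - β| := Real.sqrt_pos.2 hpos
    have h1 : ‖(r α - r β) / (z α - z β)‖ ≤ D / c / √|α - β| := by
      refine (h.norm_div_sub_le hβ.symm (hr.holder α β)).trans (le_of_eq ?_)
      have hsq := Real.mul_self_sqrt hpos.le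
      rw [show D * √|α - β| / c / |α - β| = D * √|α - β| / c / (√|α - β| * √|α - β|) by rw [hsq]]
      field_simp
    have h2 : ‖((q α - q β) / (z α - z β)) ^ 2‖ ≤ 2 * D / c / √|α - β| * (D / c) := by
      rw [sq, norm_mul]
      refine mul_le_mul (h.norm_dq_le_div_sqrt hq hq' hb hβ.symm) ?_ (norm_nonneg _) (by positivity)
      rw [← h.dq_eq hq hq'.continuous hβ.symm]
      exact h.norm_dq_le hq' _ _
    rw [dqDerivKer, norm_mul]
    refine (mul_le_mul ((norm_sub_le _ _).trans (add_le_add h1 h2)) (hw.bound β) (norm_nonneg _)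
      (by positivity)).trans (le_of_eq (by ring))
  · intro β hβ
    have hpos : 0 < |α - β| := by linarith
    have hne : α ≠ β := by
      rintro rfl; norm_num at hβ
    have h1 : ‖(r α - r β) / (z α - z β)‖ ≤ 2 * D / c / |α - β| := by
      refine h.norm_div_sub_le hne ((norm_sub_le _ _).trans ?_)
      linarith [hr.bound α, hr.bound β]
    have h2 : ‖((q α - q β) / (z α - z β)) ^ 2‖ ≤ 2 * D / c / |α - β| * (D / c) := by
      rw [sq, norm_mul, ← h.dq_eq hq hq'.continuous hne]
      exact mul_le_mul (h.norm_dq_le' hq hq'.continuous hb hne) (h.norm_dq_le hq' _ _)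
        (norm_nonneg _) (by positivity)
    rw [dqDerivKer, norm_mul]
    calc _ ≤ (2 * D / c / |α - β| + 2 * D / c / |α - β| * (D / c)) * ‖w β‖ := by
          gcongr; exact (norm_sub_le _ _).trans (add_le_add h1 h2)
      _ = (2 * D / c + 2 * D / c * (D / c)) * (‖w β‖ + 0) / |α - β| := by ring
      _ ≤ _ := by gcongr; positivity

end Kernels

/-! ### The Cauchy integral of a constant -/

/-- The averages of `v` over segments tend to `1` at infinity. -/
def Flat (v : ℝ → ℂ) : Prop :=
  ∀ ε > 0, ∃ M, ∀ x y, (M < |x| ∨ M < |y|) → ‖avg v x y - 1‖ < ε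

theorem continuous_avg {v : ℝ → ℂ} (hv : Continuous v) :
    Continuous (fun p : ℝ × ℝ => avg v p.1 p.2) := by
  unfold avg
  exact intervalIntegral.continuous_parametric_intervalIntegral_of_continuous'
    (by simp only [Function.uncurry_def]; fun_prop) 0 1

/-- The plane of pairs (x, y) is simply connected, so a nowhere vanishing average has a global
logarithm. For a chord-arc curve the hypothesis expresses non-self-intersection off the diagonal and
regularity on it. -/
theorem exists_continuous_log_avg {v : ℝ → ℂ} (hv : Continuous v) (h : ∀ x y, avg v x y ≠ 0) :
    ∃ L : ℝ × ℝ → ℂ, Continuous L ∧ ∀ p, Complex.exp (L p) = avg v p.1 p.2 := by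
  have hs : IsSimplyConnected (univ : Set (ℝ × ℝ)) := by
    have : ContractibleSpace (univ : Set (ℝ × ℝ)) :=
      (convex_univ : Convex ℝ (univ : Set (ℝ × ℝ))).contractibleSpace univ_nonempty
    exact (inferInstance : SimplyConnectedSpace (univ : Set (ℝ × ℝ)))
  obtain ⟨L, hL, hexp⟩ := Complex.exists_continuousOn_eqOn_exp_comp hs isOpen_univ
    (continuous_avg hv).continuousOn (by rintro ⟨p, -, hp⟩; exact h _ _ hp)
  exact ⟨L, continuousOn_univ.1 hL, fun p => hexp (mem_univ p)⟩

/-- By continuity, f agrees near x with f(x) plus the principal logarithm of exp f(y)/exp f(x), a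
quotient close to 1. -/
theorem hasDerivAt_of_exp {f : ℝ → ℂ} {x : ℝ} {d : ℂ} (hf : ContinuousAt f x)
    (h : HasDerivAt (fun y => Complex.exp (f y)) d x) :
    HasDerivAt f (d / Complex.exp (f x)) x := by
  have h1 : HasDerivAt (fun y => f x + Complex.log (Complex.exp (f y) / Complex.exp (f x)))
      (d / Complex.exp (f x)) x := by
    have := ((h.div_const (Complex.exp (f x))).clog_real (by
      rw [div_self (Complex.exp_ne_zero _)]; exact Complex.one_mem_slitPlane)).const_add (f x)
    simpa [div_self (Complex.exp_ne_zero _)] using this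
  refine h1.congr_of_eventuallyEq ?_
  have hc : Tendsto (fun y => ‖f y - f x‖) (𝓝 x) (𝓝 0) := by
    simpa using Tendsto.norm (Tendsto.sub_const hf (f x))
  filter_upwards [hc.eventually (gt_mem_nhds Real.pi_pos)] with y hy
  have him := abs_lt.1 ((Complex.abs_im_le_norm _).trans_lt hy)
  rw [← Complex.exp_sub, Complex.log_exp him.1 him.2.le]
  ring

/-- The imaginary part over 2π is continuous with integer values, so its image on a connected set
cannot contain two integers without the half-integers in between. -/
theorem eq_of_exp_eq_one {X : Type*} [TopologicalSpace X] {S : Set X} (hS : IsPreconnected S)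
    {g : X → ℂ} (hg : ContinuousOn g S) (h : ∀ p ∈ S, Complex.exp (g p) = 1) {p q : X}
    (hp : p ∈ S) (hq : q ∈ S) : g p = g q := by
  have key : ∀ p ∈ S, ∃ n : ℤ, g p = n * (2 * Real.pi * Complex.I) := fun p hp =>
    Complex.exp_eq_one_iff.1 (h p hp)
  have himg : IsPreconnected ((fun p => (g p).im / (2 * Real.pi)) '' S) :=
    hS.image _ ((Complex.continuous_im.comp_continuousOn hg).div_const _)
  have hval : ∀ p ∈ S, ∃ n : ℤ, g p = n * (2 * Real.pi * Complex.I) ∧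
      (g p).im / (2 * Real.pi) = n := by
    intro p hp
    obtain ⟨n, hn⟩ := key p hp
    refine ⟨n, hn, ?_⟩
    have : (g p).im = n * (2 * Real.pi) := by rw [hn]; simp
    rw [this]
    field_simp
  obtain ⟨n, hn, hn'⟩ := hval p hp
  obtain ⟨m, hm, hm'⟩ := hval q hq
  have hno : ∀ p ∈ S, ∀ q ∈ S, ∀ n m : ℤ, (g p).im / (2 * Real.pi) = n →
      (g q).im / (2 * Real.pi) = m → ¬ n < m := by
    intro p hp q hq n m hn hm hlt
    have hlt' : (n : ℝ) + 1 ≤ m := by exact_mod_cast hlt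
    have := himg.ordConnected.out (mem_image_of_mem _ hp) (mem_image_of_mem _ hq)
      (show (n : ℝ) + 1 / 2 ∈ Icc _ _ from ⟨by rw [hn]; linarith, by rw [hm]; linarith⟩)
    obtain ⟨r, hr, hr'⟩ := this
    obtain ⟨k, -, hk⟩ := hval r hr
    simp only at hr'
    rw [hk] at hr'
    have h1 : (k : ℝ) > n := by linarith
    have h2 : (k : ℝ) < n + 1 := by linarith
    have h1' : n < k := by exact_mod_cast h1
    have h2' : k < n + 1 := by exact_mod_cast h2
    omega
  have : n = m := le_antisymm (not_lt.1 (hno q hq p hp m n hm' hn'))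
    (not_lt.1 (hno p hp q hq n m hn' hm'))
  rw [hn, hm, this]

/-- The point is that L uses the same branch at both ends. On S the average is within 1 of 1, so its
principal logarithm is continuous; S is connected, the half-planes y < −M and y > M being joined
through x > M. Hence L differs from the principal logarithm by one constant on S, and the principal
logarithms tend to log 1 = 0. -/
theorem tendsto_log_avg {v : ℝ → ℂ} (hv : Continuous v) (hf : Flat v) {L : ℝ × ℝ → ℂ}
    (hL : Continuous L) (hexp : ∀ p, Complex.exp (L p) = avg v p.1 p.2) (γ : ℝ) :
    Tendsto (fun R => L (γ, γ - R) - L (γ, γ + R)) atTop (𝓝 0) := by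
  obtain ⟨M, hM⟩ := hf 1 one_pos
  set S : Set (ℝ × ℝ) := ({p | p.2 < -M} ∪ {p | M < p.1}) ∪ {p | M < p.2} with hSdef
  have hslit : ∀ p ∈ S, avg v p.1 p.2 ∈ Complex.slitPlane := by
    intro p hp
    refine Complex.mem_slitPlane_of_norm_lt_one (z := avg v p.1 p.2 - 1) (hM _ _ ?_) |> fun h => by
      simpa using h
    rcases hp with (hp | hp) | hp
    · right; rw [lt_abs]; right; simp only [mem_ofPred_eq] at hp; linarith
    · left; exact lt_of_lt_of_le hp (le_abs_self _)
    · right; exact lt_of_lt_of_le hp (le_abs_self _)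
  have hS : IsPreconnected S := by
    have c1 : Convex ℝ {p : ℝ × ℝ | p.2 < -M} :=
      convex_halfSpace_lt (LinearMap.snd ℝ ℝ ℝ).isLinear _
    have c2 : Convex ℝ {p : ℝ × ℝ | M < p.1} :=
      convex_halfSpace_gt (LinearMap.fst ℝ ℝ ℝ).isLinear _
    have c3 : Convex ℝ {p : ℝ × ℝ | M < p.2} :=
      convex_halfSpace_gt (LinearMap.snd ℝ ℝ ℝ).isLinear _
    refine (IsPreconnected.union (M + 1, -M - 1) ?_ ?_ c1.isPreconnected c2.isPreconnected).union
      (M + 1, M + 1) ?_ ?_ c3.isPreconnected <;> simp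
  have hconst := fun p q (hp : p ∈ S) (hq : q ∈ S) => eq_of_exp_eq_one hS
    (g := fun p => L p - Complex.log (avg v p.1 p.2))
    (hL.continuousOn.sub ((continuous_avg hv).continuousOn.clog hslit))
    (fun p hp => by
      rw [Complex.exp_sub, hexp, Complex.exp_log (Complex.slitPlane_ne_zero (hslit p hp))]
      exact div_self (Complex.slitPlane_ne_zero (hslit p hp))) hp hq
  have h1 : ∀ᶠ R in atTop, Complex.log (avg v γ (γ - R)) - Complex.log (avg v γ (γ + R)) =
      L (γ, γ - R) - L (γ, γ + R) := by
    filter_upwards [eventually_gt_atTop (M + γ), eventually_gt_atTop (M - γ)] with R h1 h2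
    have := hconst (γ, γ - R) (γ, γ + R)
      (Or.inl (Or.inl (by simp only [mem_ofPred_eq]; linarith)))
      (Or.inr (by simp only [mem_ofPred_eq]; linarith))
    simp only at this
    linear_combination -this
  refine Tendsto.congr' h1 ?_
  have t1 : Tendsto (fun R => avg v γ (γ - R)) atTop (𝓝 1) := by
    rw [Metric.tendsto_nhds]
    intro ε hε
    obtain ⟨M, hM⟩ := hf ε hε
    filter_upwards [eventually_gt_atTop (M + γ)] with R h1
    rw [dist_eq_norm]
    exact hM _ _ (Or.inr (by rw [lt_abs]; right; linarith))
  have t2 : Tendsto (fun R => avg v γ (γ + R)) atTop (𝓝 1) := by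
    rw [Metric.tendsto_nhds]
    intro ε hε
    obtain ⟨M, hM⟩ := hf ε hε
    filter_upwards [eventually_gt_atTop (M - γ)] with R h1
    rw [dist_eq_norm]
    exact hM _ _ (Or.inr (by rw [lt_abs]; left; linarith))
  simpa using (t1.clog Complex.one_mem_slitPlane).sub (t2.clog Complex.one_mem_slitPlane)

section Curve
variable {c C : ℝ} {z v : ℝ → ℂ}

theorem Curve.integrableOn_sym_cauchyKer (h : Curve c C z v) {D : ℝ} {w : ℝ → ℂ} (hw : Hold D w)
    (α R : ℝ) : IntegrableOn (sym (cauchyKer z w α) α) (Ioc 0 R) :=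
  (integrableOn_Ioc_div_sqrt _ R).mono'
    ((aestronglyMeasurable_sym (h.continuousOn_cauchyKer hw.continuous α)).mono_set
      Ioc_subset_Ioi_self)
    ((ae_restrict_iff' measurableSet_Ioc).2 <| .of_forall fun _ hs =>
      h.norm_sym_cauchyKer_le hw α hs.1)

/-- In ∂_β L(γ, β) = 1/(γ − β) − v(β)/(z(γ) − z(β)) the first term is odd about γ, so the
symmetrised kernel has the primitive L(γ, γ − s) − L(γ, γ + s), which vanishes at s = 0 and tends to
0. -/
theorem Curve.tendsto_integral_cauchyKer (h : Curve c C z v) (hf : Flat v) (γ : ℝ) :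
    Tendsto (fun R => ∫ s in (0 : ℝ)..R, sym (cauchyKer z v γ) γ s) atTop (𝓝 0) := by
  have hv := h.hold.continuous
  have hne : ∀ x y, avg v x y ≠ 0 := fun x y => norm_pos_iff.1 (h.pos.trans_le (h.le_norm_avg x y))
  obtain ⟨L, hL, hexp⟩ := exists_continuous_log_avg hv hne
  refine Tendsto.congr' ?_ (tendsto_log_avg hv hf hL hexp γ)
  filter_upwards [eventually_gt_atTop 0] with R hR
  have hd : ∀ β ≠ γ, HasDerivAt (fun β => L (γ, β)) (1 / ((γ : ℂ) - β) - cauchyKer z v γ β) β := by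
    intro β hβ
    have hγβ : (γ : ℂ) - β ≠ 0 := by rw [_root_.sub_ne_zero]; exact_mod_cast hβ.symm
    have hz := h.sub_ne_zero hβ.symm
    have h1 : HasDerivAt (fun y : ℝ => (z γ - z y) / ((γ : ℂ) - y))
        ((-v β * ((γ : ℂ) - β) - (z γ - z β) * (-1)) / ((γ : ℂ) - β) ^ 2) β :=
      ((h.hasDerivAt β).const_sub (z γ)).div
        ((Complex.ofRealCLM.hasDerivAt (x := β)).const_sub (γ : ℂ)) hγβ
    have h2 := hasDerivAt_of_exp (f := fun β => L (γ, β)) (x := β)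
      (d := (-v β * ((γ : ℂ) - β) - (z γ - z β) * (-1)) / ((γ : ℂ) - β) ^ 2)
      (by fun_prop) (h1.congr_of_eventuallyEq ?_)
    · convert h2 using 1
      rw [hexp, avg_eq_div h.hasDerivAt hv hβ.symm, cauchyKer]
      field_simp
      ring
    · filter_upwards [isOpen_ne.mem_nhds hβ] with y hy
      rw [hexp, avg_eq_div h.hasDerivAt hv (Ne.symm hy)]
  have hFTC := intervalIntegral.integral_eq_sub_of_hasDerivAt_of_le hR.le
    (f := fun s => L (γ, γ - s) - L (γ, γ + s)) (f' := sym (cauchyKer z v γ) γ)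
    (by fun_prop) ?_ ?_
  · rw [hFTC]; simp
  · intro s hs
    have hs0 : (s : ℂ) ≠ 0 := by exact_mod_cast hs.1.ne'
    have a1 : HasDerivAt (fun s => L (γ, γ + s)) _ s := 
      (hd (γ + s) (by have := hs.1; intro h'; linarith)).comp_const_add γ s
    have a2 : HasDerivAt (fun s => L (γ, γ - s)) _ s := 
      (hd (γ - s) (by have := hs.1; intro h'; linarith)).comp_const_sub γ s
    refine (a2.sub a1).congr_deriv ?_
    simp only [sym]
    push_cast
    rw [show (γ : ℂ) - (γ + s) = -s by ring, show (γ : ℂ) - (γ - s) = s by ring]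
    field_simp
    ring
  · rw [intervalIntegrable_iff_integrableOn_Ioc_of_le hR.le]
    exact h.integrableOn_sym_cauchyKer h.hold γ R

end Curve

/-! ### Differentiation of Cauchy integrals along a fixed curve -/

theorem SqInt.of_memLp {w : ℝ → ℂ} (h : MemLp w 2 volume) :
    ∃ E, 0 ≤ E ∧ SqInt E w :=
  ⟨(eLpNorm w 2 volume).toReal, ENNReal.toReal_nonneg, h, by rw [ENNReal.ofReal_toReal h.2.ne]⟩

theorem exists_sqInt_of_decay {W : ℝ → ℂ} {A α : ℝ} (hW : Continuous W) (h1 : ∀ β, ‖W β‖ ≤ A)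
    (h2 : ∀ β ≠ α, ‖W β‖ ≤ A / |α - β|) : ∃ E, 0 ≤ E ∧ SqInt E W := by
  refine SqInt.of_memLp ?_
  rw [memLp_two_iff_integrable_sq_norm hW.aestronglyMeasurable]
  have hi : Integrable (fun β : ℝ => 2 * A ^ 2 * (1 + (α - β) ^ 2)⁻¹) :=
    (integrable_inv_one_add_sq.comp_sub_left α).const_mul _
  refine hi.mono' (by fun_prop) (.of_forall fun β => ?_)
  rw [Real.norm_eq_abs, abs_of_nonneg (by positivity), ← div_eq_mul_inv,
    le_div_iff₀ (by positivity)]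
  have h3 : ‖W β‖ ^ 2 ≤ A ^ 2 := by gcongr; exact h1 β
  have h4 : ‖W β‖ ^ 2 * (α - β) ^ 2 ≤ A ^ 2 := by
    rcases eq_or_ne β α with rfl | hne
    · simp; positivity
    · have hpos : 0 < |α - β| := abs_pos.2 (sub_ne_zero.2 hne.symm)
      have := (le_div_iff₀ hpos).1 (h2 β hne)
      rw [← sq_abs (α - β), ← mul_pow]
      gcongr
  linarith

section Curve
variable {c C : ℝ} {z v : ℝ → ℂ}

/-- The integral of `(u(α) - u(β)) / (z(α) - z(β)) * w(β)`. -/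
def dqInt (z u w : ℝ → ℂ) (α : ℝ) : ℂ := ∫ s in Ioi 0, sym (dqKer z u w α) α s

theorem Curve.continuousAt_cauchyInt (h : Curve c C z v) {D E : ℝ} {w : ℝ → ℂ} (hw : Hold D w)
    (hE : 0 ≤ E) (hw2 : SqInt E w) (α : ℝ) : ContinuousAt (cauchyInt z w) α := by
  refine TameAt.continuousAt (K := fun α s => sym (cauchyKer z w α) α s)
    ⟨_, .of_forall fun α => h.tame_cauchyKer hw hE hw2 α⟩ fun s hs => ?_
  have hz := h.continuous
  have hwc := hw.continuous
  simp only [sym, cauchyKer]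
  refine ContinuousAt.add (ContinuousAt.div (by fun_prop) (by fun_prop) ?_)
    (ContinuousAt.div (by fun_prop) (by fun_prop) ?_)
  · exact h.sub_ne_zero (by intro h'; linarith)
  · exact h.sub_ne_zero (by intro h'; linarith)

theorem dq_comm {u u' : ℝ → ℂ} (h : Curve c C z v) (hu : ∀ x, HasDerivAt u (u' x) x)
    (hc : Continuous u') (x y : ℝ) : dq v u' x y = dq v u' y x := by
  rcases eq_or_ne x y with rfl | hxy
  · rfl
  · rw [h.dq_eq hu hc hxy, h.dq_eq hu hc hxy.symm, ← neg_sub (u y), ← neg_sub (z y), neg_div_neg_eq]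

theorem Curve.exists_sqInt_dq (h : Curve c C z v) {D : ℝ} {u u' : ℝ → ℂ}
    (hu : ∀ x, HasDerivAt u (u' x) x) (hu' : Hold D u') (hb : ∀ x, ‖u x‖ ≤ D) (α : ℝ) :
    ∃ E, 0 ≤ E ∧ SqInt E (dq v u' α) := by
  have := h.pos
  have := hu'.nonneg
  refine exists_sqInt_of_decay (A := 2 * D / c) (α := α) (h.hold_dq hu' α).continuous
    (fun β => (h.norm_dq_le hu' _ _).trans (by gcongr; linarith)) fun β hβ => ?_
  exact h.norm_dq_le' hu hu'.continuous hb hβ.symm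

/-- Integration by parts against the divided difference of `q`. -/
theorem Curve.integral_cauchyDerivKer (h : Curve c C z v) {D : ℝ} {q q' u u' : ℝ → ℂ}
    (hq : ∀ x, HasDerivAt q (q' x) x) (hq' : Hold D q') (hq2 : SqInt D q') (hb : ∀ x, ‖q x‖ ≤ D)
    (hu : ∀ x, HasDerivAt u (u' x) x) (hu' : Hold D u') (hu2 : SqInt D u')
    (hub : ∀ x, ‖u x‖ ≤ D) (α : ℝ) :
    ∫ s in Ioi 0, sym (cauchyDerivKer z v q q' u α) α s = dqInt z q u' α := by
  have huc : Continuous u := continuous_iff_continuousAt.2 fun x => (hu x).continuousAt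
  have hc := h.pos
  have hD := hq'.nonneg
  have t1 := (h.tame_cauchyDerivKer hq hq' hq2 hb huc hub α).integrableOn
  have t2 := (h.tame_dqKer hq hq' hb hu' hu2 α).integrableOn
  have hcd : Continuous (dq v q' α) := (h.hold_dq hq' α).continuous
  -- The differentiated Cauchy kernel is minus the β-derivative of the divided difference of q.
  have hd : ∀ β ≠ α, HasDerivAt (fun β => dq v q' α β * u β)
      (dqKer z q u' α β - cauchyDerivKer z v q q' u α β) β := by
    intro β hβ
    have hz := h.sub_ne_zero hβ.symm
    have h1 : HasDerivAt (fun y : ℝ => (q α - q y) / (z α - z y) * u y) _ β :=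
      (((hq β).const_sub (q α)).div ((h.hasDerivAt β).const_sub (z α)) hz).mul (hu β)
    refine (h1.congr_of_eventuallyEq ?_).congr_deriv ?_
    · filter_upwards [isOpen_ne.mem_nhds hβ] with y hy
      rw [h.dq_eq hq hq'.continuous (Ne.symm hy)]
    · simp only [dqKer, cauchyDerivKer, Pi.div_apply]
      field_simp
      ring
  -- No boundary terms: at s = 0 the two sides agree because the divided difference extends
  -- continuously to the diagonal, and at infinity it is O(1/s) while u is bounded.
  have key := integral_Ioi_of_hasDerivAt_of_tendsto (a := 0) (m := 0)
    (f := fun s => dq v q' α (α + s) * u (α + s) - dq v q' α (α - s) * u (α - s))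
    (f' := fun s => sym (dqKer z q u' α) α s - sym (cauchyDerivKer z v q q' u α) α s)
    (by fun_prop) ?_ (t2.sub t1) ?_
  · rw [integral_sub t2 t1] at key
    simp only [add_zero, sub_zero, sub_self] at key
    rw [dqInt]
    exact (sub_eq_zero.1 key).symm
  · intro s hs
    have hs : 0 < s := hs
    have a1 := (hd (α + s) (by intro h'; linarith)).comp_const_add α s
    have a2 := (hd (α - s) (by intro h'; linarith)).comp_const_sub α s
    refine (a1.sub a2).congr_deriv ?_
    simp only [sym]
    ring
  · have hto : Tendsto (fun s : ℝ => 2 * (2 * D / c / s * D)) atTop (𝓝 0) := by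
      have : Tendsto (fun s : ℝ => 2 * D / c / s) atTop (𝓝 0) :=
        tendsto_const_nhds.div_atTop tendsto_id
      simpa using (this.mul_const D).const_mul 2
    refine squeeze_zero_norm' ?_ hto
    filter_upwards [eventually_gt_atTop 0] with s hs
    have b1 := h.norm_dq_le' hq hq'.continuous hb (x := α) (y := α + s) (by intro h'; linarith)
    have b2 := h.norm_dq_le' hq hq'.continuous hb (x := α) (y := α - s) (by intro h'; linarith)
    rw [show |α - (α + s)| = s by simp [abs_of_pos hs]] at b1
    rw [show |α - (α - s)| = s by simp [abs_of_pos hs]] at b2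
    refine (norm_sub_le _ _).trans ?_
    rw [norm_mul, norm_mul, two_mul]
    exact add_le_add (mul_le_mul b1 (hub _) (norm_nonneg _) (by positivity))
      (mul_le_mul b2 (hub _) (norm_nonneg _) (by positivity))

/-- A Cauchy integral at two points: the difference is a Cauchy integral of the divided
difference. -/
theorem Curve.cauchyInt_sub (h : Curve c C z v) (hf : Flat v) {D : ℝ} {u u' : ℝ → ℂ}
    (hu : ∀ x, HasDerivAt u (u' x) x) (hu' : Hold D u') (hb : Hold D u)
    (hi : ∀ α, IntegrableOn (sym (cauchyKer z (fun β => v β * u β) α) α) (Ioi 0)) {α γ : ℝ}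
    (hne : γ ≠ α) :
    cauchyInt z (fun β => v β * u β) γ - cauchyInt z (fun β => v β * u β) α =
      (z γ - z α) * cauchyInt z (fun β => v β * dq v u' α β) γ := by
  have hc := h.pos
  have hC := h.const_nonneg
  have hD := hu'.nonneg
  have hvu : Hold (2 * C * D) (fun β => v β * u β) := h.hold.mul hb
  set W : ℝ → ℂ := fun β => v β * dq v u' α β with hW
  have hWh : Hold (2 * C * (2 * D * (1 / c + C / c ^ 2))) W := h.hold.mul (h.hold_dq hu' α)
  have hWc := hWh.continuous
  obtain ⟨E, hE, hE2⟩ := h.exists_sqInt_dq hu hu' hb.bound α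
  have hW2 : SqInt (C * E) W := hE2.mul_hold h.hold
  have hWdec : ∀ β ≠ α, ‖W β‖ ≤ C * (2 * D / c / |α - β|) := by
    intro β hβ
    rw [hW, norm_mul]
    gcongr
    · exact h.hold.bound β
    · exact h.norm_dq_le' hu hu'.continuous hb.bound hβ.symm
  have hzz := h.sub_ne_zero hne
  have hzz' := h.sub_ne_zero hne.symm
  have win : ∀ x R : ℝ, 0 ≤ R → ∫ s in (0 : ℝ)..R, sym W x s = ∫ β in (x - R)..(x + R), W β := by
    intro x R _
    have i : ∀ a b : ℝ, IntervalIntegrable W volume a b := fun a b => hWc.intervalIntegrable a b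
    simp only [sym]
    rw [intervalIntegral.integral_add (by apply Continuous.intervalIntegrable; fun_prop)
      (by apply Continuous.intervalIntegrable; fun_prop),
      intervalIntegral.integral_comp_add_left W, intervalIntegral.integral_comp_sub_left W,
      add_comm, sub_zero, add_zero, intervalIntegral.integral_add_adjacent_intervals (i _ _) (i _ _)]
  have ii : ∀ {w : ℝ → ℂ} {K : ℝ} (x R : ℝ), 0 ≤ R → Hold K w →
      IntervalIntegrable (sym (cauchyKer z w x) x) volume 0 R := fun x R hR hw => by
    rw [intervalIntegrable_iff_integrableOn_Ioc_of_le hR]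
    exact h.integrableOn_sym_cauchyKer hw x R
  have iW : ∀ x R : ℝ, IntervalIntegrable (sym W x) volume 0 R := fun x R => by
    apply Continuous.intervalIntegrable
    unfold sym
    fun_prop
  -- Partial fractions: 1/((zγ − zβ)(zα − zβ)) = (1/(zα − zγ))·(1/(zγ − zβ) − 1/(zα − zβ)). The
  -- integrals are truncated because W need not be integrable, and because the Cauchy integral of v
  -- is known only as a limit of symmetric windows.
  have eγ : ∀ R > 0, ∫ s in (0 : ℝ)..R, sym (cauchyKer z W γ) γ s = 1 / (z α - z γ) *
      (u α * (∫ s in (0 : ℝ)..R, sym (cauchyKer z v γ) γ s) -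
        (∫ s in (0 : ℝ)..R, sym (cauchyKer z (fun β => v β * u β) γ) γ s) -
        ∫ β in (γ - R)..(γ + R), W β) := by
    intro R hR
    rw [← win γ R hR.le, ← intervalIntegral.integral_const_mul,
      ← intervalIntegral.integral_sub ((ii γ R hR.le h.hold).const_mul _) (ii γ R hR.le hvu),
      ← intervalIntegral.integral_sub (((ii γ R hR.le h.hold).const_mul _).sub (ii γ R hR.le hvu))
        (iW γ R), ← intervalIntegral.integral_const_mul]
    refine intervalIntegral.integral_congr_ae (.of_forall fun s hs => ?_)
    rw [uIoc_of_le hR.le] at hs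
    rw [sym_congr hs.1 (h := fun β => 1 / (z α - z γ) * (u α * cauchyKer z v γ β -
      cauchyKer z (fun β => v β * u β) γ β - W β))]
    · simp only [sym]; ring
    · intro β hβ
      have h1 := h.sub_ne_zero hβ.symm
      -- At β = α the terms in u cancel and only the two occurrences of W(α) remain, so the formula
      -- still holds.
      rcases eq_or_ne β α with rfl | hβα
      · simp only [cauchyKer]
        field_simp
        ring
      · have h2 := h.sub_ne_zero hβα.symm
        simp only [cauchyKer, hW]
        rw [h.dq_eq hu hu'.continuous hβα.symm]
        field_simp
        ring
  have eα : ∀ R > 0, ∫ β in (α - R)..(α + R), W β =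
      u α * (∫ s in (0 : ℝ)..R, sym (cauchyKer z v α) α s) -
        (∫ s in (0 : ℝ)..R, sym (cauchyKer z (fun β => v β * u β) α) α s) := by
    intro R hR
    rw [← win α R hR.le, ← intervalIntegral.integral_const_mul,
      ← intervalIntegral.integral_sub ((ii α R hR.le h.hold).const_mul _) (ii α R hR.le hvu)]
    refine intervalIntegral.integral_congr_ae (.of_forall fun s hs => ?_)
    rw [uIoc_of_le hR.le] at hs
    rw [sym_congr hs.1 (h := fun β => u α * cauchyKer z v α β -
      cauchyKer z (fun β => v β * u β) α β)]
    · simp only [sym]; ring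
    · intro β hβ
      have h1 := h.sub_ne_zero hβ.symm
      simp only [cauchyKer, hW]
      rw [h.dq_eq hu hu'.continuous hβ.symm]
      field_simp
  have lim : ∀ x, Tendsto (fun R => ∫ s in (0 : ℝ)..R, sym (cauchyKer z (fun β => v β * u β) x) x s)
      atTop (𝓝 (cauchyInt z (fun β => v β * u β) x)) := fun x =>
    intervalIntegral_tendsto_integral_Ioi 0 (hi x) tendsto_id
  have limW : Tendsto (fun R => ∫ s in (0 : ℝ)..R, sym (cauchyKer z W γ) γ s) atTop
      (𝓝 (cauchyInt z W γ)) :=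
    intervalIntegral_tendsto_integral_Ioi 0
      (h.tame_cauchyKer hWh (by positivity) hW2 γ).integrableOn tendsto_id
  have limα : Tendsto (fun R => ∫ β in (α - R)..(α + R), W β) atTop
      (𝓝 (u α * 0 - cauchyInt z (fun β => v β * u β) α)) := by
    refine Tendsto.congr' ?_ (((h.tendsto_integral_cauchyKer hf α).const_mul (u α)).sub (lim α))
    filter_upwards [eventually_gt_atTop 0] with R hR using (eα R hR).symm
  -- The windows of radius R about γ and about α differ by two intervals of length |γ − α|, on which
  -- W is O(1/R).
  have limd : Tendsto (fun R => (∫ β in (γ - R)..(γ + R), W β) - ∫ β in (α - R)..(α + R), W β)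
      atTop (𝓝 0) := by
    have hto : Tendsto (fun R : ℝ => 2 * (C * (2 * D / c / (R - |γ - α|)) * |γ - α|)) atTop
        (𝓝 0) := by
      have : Tendsto (fun s : ℝ => 2 * D / c / (s - |γ - α|)) atTop (𝓝 0) :=
        tendsto_const_nhds.div_atTop (tendsto_atTop_add_const_right _ _ tendsto_id)
      simpa using ((this.const_mul C).mul_const |γ - α|).const_mul 2
    refine squeeze_zero_norm' ?_ hto
    filter_upwards [eventually_gt_atTop |γ - α|] with R hR
    have i : ∀ a b : ℝ, IntervalIntegrable W volume a b := fun a b => hWc.intervalIntegrable a b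
    have e : (∫ β in (γ - R)..(γ + R), W β) - ∫ β in (α - R)..(α + R), W β =
        (∫ β in (α + R)..(γ + R), W β) - ∫ β in (α - R)..(γ - R), W β := by
      rw [intervalIntegral.integral_interval_sub_interval_comm (i _ _) (i _ _) (i _ _),
        intervalIntegral.integral_symm (γ - R) (α - R),
        intervalIntegral.integral_symm (α + R) (γ + R)]
      ring
    have hpos : 0 < R - |γ - α| := by linarith
    have hγα := abs_le.1 (le_refl |γ - α|)
    have hbd : ∀ β, R - |γ - α| ≤ |α - β| → ‖W β‖ ≤ C * (2 * D / c / (R - |γ - α|)) := by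
      intro β hβ
      refine (hWdec β ?_).trans (by gcongr)
      rintro rfl
      simp at hβ
      linarith
    have b1 : ‖∫ β in (α + R)..(γ + R), W β‖ ≤ C * (2 * D / c / (R - |γ - α|)) * |γ - α| := by
      have := intervalIntegral.norm_integral_le_of_norm_le_const (f := W) (a := α + R) (b := γ + R)
        (C := C * (2 * D / c / (R - |γ - α|))) ?_
      · rwa [show γ + R - (α + R) = γ - α by ring] at this
      intro β hβ
      refine hbd β ?_
      rw [le_abs]; right
      rcases mem_uIoc.1 hβ with h' | h' <;> linarith [h'.1, h'.2]
    have b2 : ‖∫ β in (α - R)..(γ - R), W β‖ ≤ C * (2 * D / c / (R - |γ - α|)) * |γ - α| := by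
      have := intervalIntegral.norm_integral_le_of_norm_le_const (f := W) (a := α - R) (b := γ - R)
        (C := C * (2 * D / c / (R - |γ - α|))) ?_
      · rwa [show γ - R - (α - R) = γ - α by ring] at this
      intro β hβ
      refine hbd β ?_
      rw [le_abs]; left
      rcases mem_uIoc.1 hβ with h' | h' <;> linarith [h'.1, h'.2]
    rw [e]
    refine (norm_sub_le _ _).trans ?_
    linarith
  have limγ : Tendsto (fun R => ∫ β in (γ - R)..(γ + R), W β) atTop
      (𝓝 (u α * 0 - cauchyInt z (fun β => v β * u β) α)) := by
    have := limd.add limα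
    simpa using this
  have final := ((((h.tendsto_integral_cauchyKer hf γ).const_mul (u α)).sub (lim γ)).sub
    limγ).const_mul (1 / (z α - z γ))
  have := tendsto_nhds_unique limW (final.congr' (by
    filter_upwards [eventually_gt_atTop 0] with R hR using (eγ R hR).symm))
  rw [this]
  field_simp
  ring

/-- By `Curve.cauchyInt_sub` the slope is the slope of z times a Cauchy integral of the divided
difference, which is continuous at α. Its value at α comes from integrating by parts against the
constant 1: the integral of u'/Δz − vΔu/Δz² vanishes. -/
theorem Curve.hasDerivAt_cauchyInt (h : Curve c C z v) (hf : Flat v) {D : ℝ} {u u' : ℝ → ℂ}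
    (hu : ∀ x, HasDerivAt u (u' x) x) (hu' : Hold D u') (hu2 : SqInt D u') (hb : Hold D u)
    (hi : ∀ α, IntegrableOn (sym (cauchyKer z (fun β => v β * u β) α) α) (Ioi 0)) (α : ℝ) :
    HasDerivAt (cauchyInt z (fun β => v β * u β)) (v α * cauchyInt z u' α) α ∧
      cauchyInt z (fun β => v β * dq v u' α β) α = cauchyInt z u' α := by
  have hc := h.pos
  have hC := h.const_nonneg
  have hD := hu'.nonneg
  have hWh := h.hold.mul (h.hold_dq hu' α)
  obtain ⟨E, hE, hE2⟩ := h.exists_sqInt_dq hu hu' hb.bound α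
  have hW2 : SqInt (C * E) _ := hE2.mul_hold h.hold
  have hval : cauchyInt z (fun β => v β * dq v u' α β) α = cauchyInt z u' α := by
    have t1 := (h.tame_cauchyKer hu' hD hu2 α).integrableOn
    have t2 := (h.tame_cauchyKer hWh (by positivity) hW2 α).integrableOn
    have hone : ∀ x, HasDerivAt (fun _ : ℝ => (1 : ℂ)) ((fun _ : ℝ => (0 : ℂ)) x) x :=
      fun x => hasDerivAt_const x 1
    -- The single constant D + 1 has to bound the constant function 1 as well.
    have hz0 : Hold (D + 1) (fun _ => (0 : ℂ)) := (Hold.const 0).mono (by simp; linarith)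
    have hz2 : SqInt (D + 1) (fun _ => (0 : ℂ)) := ⟨MemLp.zero', by simp⟩
    have := h.integral_cauchyDerivKer (D := D + 1) hu (hu'.mono (by linarith))
      (hu2.mono (by linarith)) (fun x => (hb.bound x).trans (by linarith)) hone hz0 hz2
      (fun x => by simp; linarith) α
    have e0 : dqInt z u (fun _ => 0) α = 0 := by simp [dqInt, sym, dqKer]
    rw [e0] at this
    rw [← sub_eq_zero, cauchyInt, cauchyInt, ← integral_sub t2 t1, ← neg_eq_zero, ← integral_neg,
      ← this]
    refine setIntegral_congr_fun measurableSet_Ioi fun s hs => ?_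
    rw [sym_congr (g := cauchyDerivKer z v u u' (fun x => 1) α) hs (h := fun β =>
      cauchyKer z u' α β - cauchyKer z (fun β => v β * dq v u' α β) α β)]
    · simp only [sym]; ring
    · intro β hβ
      simp only [cauchyDerivKer, cauchyKer]
      rw [h.dq_eq hu hu'.continuous hβ.symm]
      have := h.sub_ne_zero hβ.symm
      field_simp
  refine ⟨?_, hval⟩
  rw [hasDerivAt_iff_tendsto_slope]
  have l1 := ((hasDerivAt_iff_tendsto_slope.1 (h.hasDerivAt α)).mul
    ((h.continuousAt_cauchyInt hWh (by positivity) hW2 α).tendsto.mono_left nhdsWithin_le_nhds))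
  rw [← hval]
  refine l1.congr' ?_
  filter_upwards [self_mem_nhdsWithin] with γ hγ
  rw [slope_def_module, slope_def_module, h.cauchyInt_sub hf hu hu' hb hi hγ, smul_mul_assoc]

theorem Curve.integrable_dqKer (h : Curve c C z v) {D : ℝ} {u u' w : ℝ → ℂ}
    (hu : ∀ x, HasDerivAt u (u' x) x) (hu' : Hold D u') (hb : ∀ x, ‖u x‖ ≤ D)
    (hw2 : SqInt D w) (α : ℝ) :
    Integrable (fun β => dq v u' α β * w β) ∧ Integrable (dqKer z u w α) ∧
      ∫ β, dqKer z u w α β = ∫ β, dq v u' α β * w β := by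
  obtain ⟨E, hE, hE2⟩ := h.exists_sqInt_dq hu hu' hb α
  have h1 : Integrable (fun β => dq v u' α β * w β) := hE2.memLp.integrable_mul hw2.memLp
  have h2 : (fun β => dq v u' α β * w β) =ᵐ[volume] dqKer z u w α := by
    filter_upwards [compl_mem_ae_iff.2 (show volume ({α} : Set ℝ) = 0 by simp)] with β hβ
    rw [dqKer, h.dq_eq hu hu'.continuous (Ne.symm hβ)]
  exact ⟨h1, h1.congr h2, (integral_congr_ae h2).symm⟩

theorem Curve.dqInt_eq (h : Curve c C z v) {D : ℝ} {u u' w : ℝ → ℂ}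
    (hu : ∀ x, HasDerivAt u (u' x) x) (hu' : Hold D u') (hb : ∀ x, ‖u x‖ ≤ D)
    (hw2 : SqInt D w) (α : ℝ) : dqInt z u w α = ∫ β, dqKer z u w α β :=
  (integral_sym (h.integrable_dqKer hu hu' hb hw2 α).2.1 α).2

/-- Pointwise, the divided differences from γ and from α differ by (zγ − zα)/(zγ − zβ)·(dq(α, γ) −
dq(α, β)), whose two parts are separately Cauchy integrals at γ. Differentiability in α follows
without a derivative of w. -/
theorem Curve.dqInt_sub (h : Curve c C z v) {D : ℝ} {u u' w : ℝ → ℂ}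
    (hu : ∀ x, HasDerivAt u (u' x) x) (hu' : Hold D u') (hb : ∀ x, ‖u x‖ ≤ D)
    (hw : Hold D w) (hw2 : SqInt D w) {α γ : ℝ} (hne : γ ≠ α) :
    dqInt z u w γ - dqInt z u w α = (z γ - z α) *
      (dq v u' α γ * cauchyInt z w γ - cauchyInt z (fun β => dq v u' α β * w β) γ) := by
  have hD := hw.nonneg
  have hC := h.const_nonneg
  have hc := h.pos
  have hq := h.hold_dq hu' α
  have hqw := hq.mul hw
  have hqw2 := hw2.mul_hold hq
  have t1 := (h.tame_cauchyKer hw hD hw2 γ).integrableOn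
  have t2 := (h.tame_cauchyKer hqw (mul_nonneg hq.nonneg hD) hqw2 γ).integrableOn
  have t3 := (h.tame_dqKer hu hu' hb hw hw2 γ).integrableOn
  obtain ⟨t4, t5⟩ := integral_sym (h.integrable_dqKer hu hu' hb hw2 α).1 γ
  rw [h.dqInt_eq hu hu' hb hw2 α, (h.integrable_dqKer hu hu' hb hw2 α).2.2, ← t5, dqInt,
    ← integral_sub t3 t4, cauchyInt, cauchyInt, ← integral_const_mul, ← integral_sub
    (t1.const_mul _) t2, ← integral_const_mul]
  refine setIntegral_congr_fun measurableSet_Ioi fun s hs => ?_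
  have hs0 : 0 < s := hs
  have key : ∀ β ≠ γ, dqKer z u w γ β = dq v u' α β * w β + (z γ - z α) * (dq v u' α γ *
      cauchyKer z w γ β - cauchyKer z (fun β => dq v u' α β * w β) γ β) := by
    intro β hβ
    have h1 := h.sub_ne_zero hβ.symm
    have h3 := h.sub_ne_zero hne.symm
    simp only [dqKer, cauchyKer]
    rw [h.dq_eq hu hu'.continuous hne.symm]
    rcases eq_or_ne β α with rfl | hβα
    · rw [← neg_sub (u β) (u γ), ← neg_sub (z β) (z γ)]
      field_simp
      ring
    · have h2 := h.sub_ne_zero hβα.symm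
      rw [h.dq_eq hu hu'.continuous hβα.symm]
      field_simp
      ring
  simp only [sym]
  rw [key _ (by intro h'; linarith), key _ (by intro h'; linarith)]
  ring

theorem Curve.differentiableAt_dqInt (h : Curve c C z v) {D : ℝ} {u u' w : ℝ → ℂ}
    (hu : ∀ x, HasDerivAt u (u' x) x) (hu' : Hold D u') (hb : ∀ x, ‖u x‖ ≤ D)
    (hw : Hold D w) (hw2 : SqInt D w) (α : ℝ) : DifferentiableAt ℝ (dqInt z u w) α := by
  have hD := hw.nonneg
  have hq := h.hold_dq hu' α
  have hqw := hq.mul hw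
  have hqw2 := hw2.mul_hold hq
  refine HasDerivAt.differentiableAt (f' := v α * (dq v u' α α * cauchyInt z w α -
    cauchyInt z (fun β => dq v u' α β * w β) α)) ?_
  rw [hasDerivAt_iff_tendsto_slope]
  have c1 := h.continuousAt_cauchyInt hw hD hw2 α
  have c2 := h.continuousAt_cauchyInt hqw (mul_nonneg hq.nonneg hD) hqw2 α
  have c3 := ((hq.continuous.continuousAt (x := α)).mul c1).sub c2
  have l1 := ((hasDerivAt_iff_tendsto_slope.1 (h.hasDerivAt α)).mul
    (c3.tendsto.mono_left nhdsWithin_le_nhds))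
  refine l1.congr' ?_
  filter_upwards [self_mem_nhdsWithin] with γ hγ
  rw [slope_def_module, slope_def_module, h.dqInt_sub hu hu' hb hw hw2 hγ, smul_mul_assoc]
  rfl

end Curve

/-! ### Skew symmetry of the Cauchy integral -/

/-- The larger of x and y is at least w/2. A quarter power is moved onto the smaller one: its
exponent 5/4 is integrable at infinity, and the 3/4 left on w is square integrable. -/
theorem one_div_mul_le {x y w : ℝ} (hx : 1 ≤ x) (hy : 1 ≤ y) (hw : 1 ≤ w) (h : w ≤ x + y) :
    1 / (x * y) ≤ 2 * w ^ (-(3 / 4) : ℝ) * (x ^ (-(5 / 4) : ℝ) + y ^ (-(5 / 4) : ℝ)) := by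
  have key : ∀ x y : ℝ, 1 ≤ x → x ≤ y → w ≤ x + y →
      1 / (x * y) ≤ 2 * w ^ (-(3 / 4) : ℝ) * x ^ (-(5 / 4) : ℝ) := by
    intro x y hx hxy h
    have hx0 : 0 < x := by linarith
    have hy0 : 0 < y := by linarith
    have hw0 : 0 < w := by linarith
    have e1 : 1 / (x * y) = x ^ (-(5 / 4) : ℝ) * (x ^ (1 / 4 : ℝ) * y ^ (-(1 : ℝ))) := by
      rw [← mul_assoc, ← Real.rpow_add hx0, Real.rpow_neg_one, one_div, mul_inv]
      norm_num [Real.rpow_neg_one]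
    have e2 : x ^ (1 / 4 : ℝ) * y ^ (-(1 : ℝ)) ≤ y ^ (-(3 / 4) : ℝ) := by
      calc _ ≤ y ^ (1 / 4 : ℝ) * y ^ (-(1 : ℝ)) := by gcongr
        _ = _ := by rw [← Real.rpow_add hy0]; norm_num
    have e3 : y ^ (-(3 / 4) : ℝ) ≤ 2 * w ^ (-(3 / 4) : ℝ) := by
      have h1 : y ^ (-(3 / 4) : ℝ) ≤ (w / 2) ^ (-(3 / 4) : ℝ) :=
        Real.rpow_le_rpow_of_nonpos (by positivity) (by linarith) (by norm_num)
      refine h1.trans ?_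
      rw [Real.div_rpow hw0.le (by norm_num), Real.rpow_neg (by norm_num : (0 : ℝ) ≤ 2), div_inv_eq_mul,
        mul_comm]
      gcongr
      calc (2 : ℝ) ^ (3 / 4 : ℝ) ≤ 2 ^ (1 : ℝ) :=
            Real.rpow_le_rpow_of_exponent_le (by norm_num) (by norm_num)
        _ = 2 := by norm_num
    rw [e1, mul_comm]
    exact mul_le_mul_of_nonneg_right (e2.trans e3) (by positivity)
  rcases le_total x y with hxy | hxy
  · refine (key x y hx hxy h).trans ?_
    have : 0 < y ^ (-(5 / 4) : ℝ) := by positivity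
    gcongr
    linarith
  · rw [mul_comm x y]
    refine (key y x hy hxy (by linarith)).trans ?_
    have : 0 < x ^ (-(5 / 4) : ℝ) := by positivity
    gcongr
    linarith

/-- Majorant of a product of decaying functions. -/
theorem integrable_majorant {A B B' : ℝ → ℝ} (hA : Integrable A) (hB : Integrable B)
    (hB' : Integrable B') :
    Integrable (fun p : ℝ × ℝ => A p.1 * (B (p.1 + p.2) + B' p.2)) ∧
    Integrable (fun p : ℝ × ℝ => A (p.1 + p.2) * (B p.1 + B' p.2)) := by
  have sh : MeasurePreserving (fun p : ℝ × ℝ => (p.1, p.1 + p.2)) (volume.prod volume)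
      (volume.prod volume) := measurePreserving_prod_add volume volume
  have sh2 : MeasurePreserving (fun p : ℝ × ℝ => (p.2, p.2 + p.1)) (volume.prod volume)
      (volume.prod volume) := measurePreserving_prod_add_swap volume volume
  have i1 : Integrable (fun p : ℝ × ℝ => A p.1 * B' p.2) (volume.prod volume) := hA.mul_prod hB'
  have i0 : Integrable (fun p : ℝ × ℝ => A p.1 * B p.2) (volume.prod volume) := hA.mul_prod hB
  have i2 : Integrable (fun p : ℝ × ℝ => B p.1 * A p.2) (volume.prod volume) := hB.mul_prod hA
  have i3 : Integrable (fun p : ℝ × ℝ => B' p.1 * A p.2) (volume.prod volume) := hB'.mul_prod hA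
  have j1 := (sh.integrable_comp i0.1).2 i0
  have j2 := (sh.integrable_comp i2.1).2 i2
  have j3 := (sh2.integrable_comp i3.1).2 i3
  refine ⟨(j1.add i1).congr (.of_forall fun p => ?_), (j2.add j3).congr (.of_forall fun p => ?_)⟩
  · simp only [Pi.add_apply, Function.comp_apply]; ring
  · simp only [Pi.add_apply, Function.comp_apply]; rw [add_comm p.2 p.1]; ring

theorem integrable_comp_neg_snd {f : ℝ × ℝ → ℝ} (hf : Integrable f) :
    Integrable (fun p : ℝ × ℝ => f (p.1, -p.2)) := by
  have : MeasurePreserving (fun p : ℝ × ℝ => (p.1, -p.2)) (volume.prod volume)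
      (volume.prod volume) :=
    (MeasurePreserving.id volume).prod (Measure.measurePreserving_neg volume)
  exact (this.integrable_comp hf.1).2 hf

/-- The local modulus of continuity of `w` is controlled by a square integrable function. -/
structure LocalMod (w : ℝ → ℂ) (N : ℝ → ℝ) : Prop where
  nonneg : ∀ β, 0 ≤ N β
  memLp : MemLp N 2 volume
  le : ∀ β s, |s| ≤ 1 → ‖w (β + s) - w β‖ ≤ |s| ^ (1 / 8 : ℝ) * N β

section Curve
variable {c C : ℝ} {z v : ℝ → ℂ}

/-- The symmetric sum splits into a difference of w and a difference of reciprocal averages, each at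
most of order s^(1/8), over s. A uniform Hölder constant for w would not be enough: pairing with a
square integrable function of β requires a constant that is itself square integrable in β. -/
theorem Curve.near_cauchyKer (h : Curve c C z v) {w : ℝ → ℂ} {N : ℝ → ℝ} (hN : LocalMod w N)
    {β s : ℝ} (hs : 0 < s) (hs1 : s ≤ 1) :
    ‖sym (cauchyKer z w β) β s‖ ≤
      s ^ (-(7 / 8) : ℝ) * ((4 * (1 / c + C / c ^ 2)) * (N β + ‖w β‖)) := by
  have hc := h.pos
  have hC := h.const_nonneg
  have hN0 := hN.nonneg β
  set K := 1 / c + C / c ^ 2 with hK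
  have hi : Hold K (fun y => (avg v β y)⁻¹) := (h.hold.avg β).inv hc (h.le_norm_avg β)
  have hK0 := hi.nonneg
  have hsc : (s : ℂ) ≠ 0 := by exact_mod_cast hs.ne'
  have hp1 : avg v β (β + s) ≠ 0 := norm_pos_iff.1 (hc.trans_le (h.le_norm_avg _ _))
  have hp2 : avg v β (β - s) ≠ 0 := norm_pos_iff.1 (hc.trans_le (h.le_norm_avg _ _))
  have e1 : sym (cauchyKer z w β) β s = ((w (β - s) - w (β + s)) * (avg v β (β - s))⁻¹ +
      w (β + s) * ((avg v β (β - s))⁻¹ - (avg v β (β + s))⁻¹)) / (s : ℂ) := by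
    simp only [sym, cauchyKer, h.sub_eq]
    push_cast
    rw [show (β : ℂ) - (β + s) = -s by ring, show (β : ℂ) - (β - s) = s by ring]
    field_simp
    ring
  have m1 := hN.le β s (by rwa [abs_of_pos hs])
  have m2 := hN.le β (-s) (by rwa [abs_neg, abs_of_pos hs])
  rw [abs_neg, ← sub_eq_add_neg] at m2
  rw [abs_of_pos hs] at m1 m2
  have hr : 0 < s ^ (1 / 8 : ℝ) := by positivity
  have hr1 : s ^ (1 / 8 : ℝ) ≤ 1 := Real.rpow_le_one hs.le hs1 (by norm_num)
  have hsq : √s ≤ s ^ (1 / 8 : ℝ) := by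
    rw [Real.sqrt_eq_rpow]
    exact Real.rpow_le_rpow_of_exponent_ge hs hs1 (by norm_num)
  have d1 : ‖w (β - s) - w (β + s)‖ ≤ 2 * (s ^ (1 / 8 : ℝ) * N β) := by
    rw [← sub_sub_sub_cancel_right _ _ (w β)]
    refine (norm_sub_le _ _).trans ?_
    linarith
  have d2 : ‖w (β + s)‖ ≤ N β + ‖w β‖ := by
    have := norm_add_le (w (β + s) - w β) (w β)
    rw [sub_add_cancel] at this
    nlinarith
  have d3 : ‖(avg v β (β - s))⁻¹ - (avg v β (β + s))⁻¹‖ ≤ K * (2 * s ^ (1 / 8 : ℝ)) := by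
    refine (hi.holder (β - s) (β + s)).trans ?_
    gcongr
    rw [show |β - s - (β + s)| = 2 * s by
      rw [show β - s - (β + s) = -(2 * s) by ring, abs_neg, abs_of_pos (by positivity)],
      Real.sqrt_mul (by norm_num)]
    have : √(2 : ℝ) ≤ 2 := by rw [Real.sqrt_le_iff]; norm_num
    gcongr
  have hfin : ‖sym (cauchyKer z w β) β s‖ ≤
      s ^ (1 / 8 : ℝ) * ((4 * K) * (N β + ‖w β‖)) / s := by
    rw [e1, norm_div, Complex.norm_real, Real.norm_eq_abs, abs_of_pos hs]
    gcongr
    refine (norm_add_le _ _).trans ?_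
    rw [norm_mul, norm_mul]
    have p1 := mul_le_mul d1 (hi.bound (β - s)) (norm_nonneg _) (by positivity)
    have p2 := mul_le_mul d2 d3 (norm_nonneg _) (by positivity)
    have hw := norm_nonneg (w β)
    have : 0 ≤ s ^ (1 / 8 : ℝ) * K * ‖w β‖ := by positivity
    nlinarith
  refine hfin.trans (le_of_eq ?_)
  have : s ^ (-(7 / 8) : ℝ) = s ^ (1 / 8 : ℝ) / s := by
    rw [show (-(7 / 8) : ℝ) = 1 / 8 - 1 by norm_num, Real.rpow_sub hs, Real.rpow_one]
  rw [this]
  ring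

/-- The two-variable kernel of the pairing `∫ g · cauchyInt z w`. -/
def pairKer (z g w : ℝ → ℂ) : ℝ × ℝ → ℂ := fun p => g p.1 * sym (cauchyKer z w p.1) p.1 p.2

theorem Curve.measurable_pairKer (h : Curve c C z v) {g w : ℝ → ℂ} (hg : Continuous g)
    (hw : Continuous w) : AEStronglyMeasurable (pairKer z g w)
      ((volume.prod volume).restrict (univ ×ˢ Ioi 0)) := by
  have hz := h.continuous
  refine ContinuousOn.aestronglyMeasurable ?_ (MeasurableSet.univ.prod measurableSet_Ioi)
  unfold pairKer
  simp only [sym, cauchyKer]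
  refine ContinuousOn.mul (by fun_prop) (ContinuousOn.add
    (ContinuousOn.div (by fun_prop) (by fun_prop) ?_)
    (ContinuousOn.div (by fun_prop) (by fun_prop) ?_))
  · intro p hp
    have : 0 < p.2 := hp.2
    exact h.sub_ne_zero (by intro h'; linarith)
  · intro p hp
    have : 0 < p.2 := hp.2
    exact h.sub_ne_zero (by intro h'; linarith)

/-- For s ≤ 1 the bound is s^(-7/8) times a product of two L² functions of β; for s > 1 the majorant
M serves one side of the singularity and its reflection the other. -/
theorem Curve.integrableOn_pairKer (h : Curve c C z v) {g w : ℝ → ℂ} {N : ℝ → ℝ}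
    (hg : Continuous g) (hg2 : MemLp g 2 volume) (hw : Continuous w) (hw2 : MemLp w 2 volume)
    (hN : LocalMod w N) {M : ℝ × ℝ → ℝ} (hM : Integrable M)
    (hfar : ∀ p : ℝ × ℝ, 1 ≤ |p.2| → ‖g p.1‖ * ‖w (p.1 + p.2)‖ / |p.2| ≤ M p) :
    Integrable (pairKer z g w) (volume.prod (volume.restrict (Ioi 0))) := by
  have hc := h.pos
  have hm := h.measurable_pairKer hg hw
  have hmeas : (volume : Measure ℝ).prod (volume.restrict (Ioi (0 : ℝ))) =
      (volume.prod volume).restrict (univ ×ˢ Ioi 0) := by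
    rw [← Measure.prod_restrict, Measure.restrict_univ]
  rw [hmeas]
  have hsplit : (univ : Set ℝ) ×ˢ Ioi (0 : ℝ) = univ ×ˢ Ioc 0 1 ∪ univ ×ˢ Ioi 1 := by
    rw [← prod_union, Ioc_union_Ioi_eq_Ioi zero_le_one]
  change IntegrableOn _ _ _
  rw [hsplit]
  refine IntegrableOn.union ?_ ?_
  · have h1 : Integrable (fun β => ‖g β‖ * ((4 * (1 / c + C / c ^ 2)) * (N β + ‖w β‖))) :=
      hg2.norm.integrable_mul ((hN.memLp.add hw2.norm).const_mul _)
    have h2 : IntegrableOn (fun s : ℝ => s ^ (-(7 / 8) : ℝ)) (Ioc 0 1) := by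
      have : IntervalIntegrable (fun s : ℝ => s ^ (-(7 / 8) : ℝ)) volume 0 1 :=
        intervalIntegral.intervalIntegrable_rpow' (by norm_num)
      rwa [intervalIntegrable_iff_integrableOn_Ioc_of_le zero_le_one] at this
    have h3 := h1.mul_prod h2
    have e : (volume : Measure ℝ).prod (volume.restrict (Ioc (0 : ℝ) 1)) =
      (volume.prod volume).restrict (univ ×ˢ Ioc 0 1) := by
      rw [← Measure.prod_restrict, Measure.restrict_univ]
    rw [e] at h3
    refine h3.mono' (hm.mono_set (prod_mono_right Ioc_subset_Ioi_self)) ?_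
    refine (ae_restrict_iff' (MeasurableSet.univ.prod measurableSet_Ioc)).2
      (.of_forall fun p hp => ?_)
    rw [pairKer, norm_mul]
    have := h.near_cauchyKer hN hp.2.1 hp.2.2 (β := p.1)
    calc _ ≤ ‖g p.1‖ * (p.2 ^ (-(7 / 8) : ℝ) * ((4 * (1 / c + C / c ^ 2)) *
          (N p.1 + ‖w p.1‖))) := by gcongr
      _ = _ := by ring
  · have h1 : Integrable (fun p : ℝ × ℝ => 1 / c * (M p + M (p.1, -p.2))) :=
      (hM.add (integrable_comp_neg_snd hM)).const_mul _
    refine (h1.integrableOn (s := univ ×ˢ Ioi 1)).mono'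
      (hm.mono_set (prod_mono_right (Ioi_subset_Ioi zero_le_one))) ?_
    refine (ae_restrict_iff' (MeasurableSet.univ.prod measurableSet_Ioi)).2
      (.of_forall fun p hp => ?_)
    have hp1 : 1 < p.2 := hp.2
    have hp0 : 0 < p.2 := by linarith
    have f1 := hfar p (by rw [abs_of_pos hp0]; exact hp1.le)
    have f2 := hfar (p.1, -p.2) (by simp only [abs_neg]; rw [abs_of_pos hp0]; exact hp1.le)
    simp only [abs_neg, ← sub_eq_add_neg] at f2
    have b1 : ‖cauchyKer z w p.1 (p.1 + p.2)‖ ≤ ‖w (p.1 + p.2)‖ / c / |p.1 - (p.1 + p.2)| :=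
      h.norm_div_sub_le (by intro h'; linarith) le_rfl
    have b2 : ‖cauchyKer z w p.1 (p.1 - p.2)‖ ≤ ‖w (p.1 - p.2)‖ / c / |p.1 - (p.1 - p.2)| :=
      h.norm_div_sub_le (by intro h'; linarith) le_rfl
    rw [show |p.1 - (p.1 + p.2)| = |p.2| by simp] at b1
    rw [show |p.1 - (p.1 - p.2)| = |p.2| by simp] at b2
    rw [pairKer, norm_mul, sym]
    calc _ ≤ ‖g p.1‖ * (‖w (p.1 + p.2)‖ / c / |p.2| + ‖w (p.1 - p.2)‖ / c / |p.2|) := by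
          gcongr; exact (norm_add_le _ _).trans (add_le_add b1 b2)
      _ = 1 / c * (‖g p.1‖ * ‖w (p.1 + p.2)‖ / |p.2| + ‖g p.1‖ * ‖w (p.1 - p.2)‖ / |p.2|) := by
          ring
      _ ≤ _ := by gcongr

/-- The kernel 1/(z(α) − z(β)) is antisymmetric. After Fubini, at fixed s, translating the backward
half by s exhibits each half of one pairing as minus the opposite half of the other. -/
theorem Curve.integral_mul_cauchyInt (h : Curve c C z v) {g w : ℝ → ℂ}
    (hg : Continuous g) (hg2 : MemLp g 2 volume) (hw : Continuous w) (hw2 : MemLp w 2 volume)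
    (h1 : Integrable (pairKer z g w) (volume.prod (volume.restrict (Ioi 0))))
    (h2 : Integrable (pairKer z w g) (volume.prod (volume.restrict (Ioi 0)))) :
    ∫ β, g β * cauchyInt z w β = -∫ β, w β * cauchyInt z g β := by
  have hz := h.continuous
  have sw : ∀ g w : ℝ → ℂ, Integrable (pairKer z g w) (volume.prod (volume.restrict (Ioi 0))) →
      ∫ β, g β * cauchyInt z w β = ∫ s in Ioi 0, ∫ β, pairKer z g w (β, s) := by
    intro g w hi
    rw [← integral_prod_symm _ hi, integral_prod _ hi]
    refine integral_congr_ae (.of_forall fun β => ?_)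
    simp only [pairKer, cauchyInt]
    rw [integral_const_mul]
  rw [sw g w h1, sw w g h2, ← integral_neg]
  refine setIntegral_congr_fun measurableSet_Ioi fun s hs => ?_
  have hs : 0 < s := hs
  have ii : ∀ g w : ℝ → ℂ, Continuous g → Continuous w → MemLp g 2 volume → MemLp w 2 volume →
      ∀ r : ℝ, r ≠ 0 → Integrable (fun β => g β * (w (β + r) / (z β - z (β + r)))) := by
    intro g w hg hw hg2 hw2 r hr
    have e1 : MeasurePreserving (fun s : ℝ => s + r) := measurePreserving_add_right volume r
    have i1 : Integrable (fun β => ‖g β‖ * ‖w (β + r)‖) :=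
      hg2.norm.integrable_mul (hw2.norm.comp_measurePreserving e1)
    have hne : ∀ β, z β - z (β + r) ≠ 0 := fun β => h.sub_ne_zero (by
      intro h'; exact hr (by linarith))
    refine (i1.mul_const (1 / c / |r|)).mono' (Continuous.aestronglyMeasurable
      (by fun_prop (disch := exact hne _))) (.of_forall fun β => ?_)
    rw [norm_mul, mul_assoc]
    gcongr
    refine (h.norm_div_sub_le (by intro h'; exact hr (by linarith)) le_rfl).trans (le_of_eq ?_)
    rw [show |β - (β + r)| = |r| by simp]
    ring
  have expand : ∀ g w : ℝ → ℂ, Continuous g → Continuous w → MemLp g 2 volume → MemLp w 2 volume →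
      ∫ β, pairKer z g w (β, s) = (∫ β, g β * (w (β + s) / (z β - z (β + s)))) +
        ∫ β, g (β + s) * (w β / (z (β + s) - z β)) := by
    intro g w hg hw hg2 hw2
    have i1 := ii g w hg hw hg2 hw2 s hs.ne'
    have i2 := ii g w hg hw hg2 hw2 (-s) (neg_ne_zero.2 hs.ne')
    have e2 := integral_add_right_eq_self (μ := volume)
      (fun β => g β * (w (β + -s) / (z β - z (β + -s)))) s
    simp only [add_neg_cancel_right] at e2
    rw [e2, ← integral_add i1 i2]
    refine integral_congr_ae (.of_forall fun β => ?_)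
    simp only [pairKer, sym, cauchyKer, sub_eq_add_neg]
    ring
  rw [expand g w hg hw hg2 hw2, expand w g hw hg hw2 hg2, neg_add, ← integral_neg, ← integral_neg,
    add_comm]
  congr 1
  · refine integral_congr_ae (.of_forall fun β => ?_)
    have := h.sub_ne_zero (x := β) (y := β + s) (by intro h'; linarith)
    simp only
    rw [← neg_sub (z β) (z (β + s))]
    field_simp
  · refine integral_congr_ae (.of_forall fun β => ?_)
    have := h.sub_ne_zero (x := β) (y := β + s) (by intro h'; linarith)
    simp only
    rw [← neg_sub (z β) (z (β + s))]
    field_simp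

end Curve

/-! ### Boundary values of holomorphic functions -/

/-- Interpolation with weights 1/4 and 3/4. It yields the modulus exponent 1/8 and the decay
exponent 3/4, the latter above 1/2 and so square integrable. -/
theorem le_rpow_mul_of_le {x K r y : ℝ} (hx : 0 ≤ x) (hK : 0 ≤ K) (hr : 0 ≤ r) (hy : 0 < y)
    (h1 : x ≤ K * √r) (h2 : x ≤ K / y) : x ≤ r ^ (1 / 8 : ℝ) * (K * y ^ (-(3 / 4) : ℝ)) := by
  have e1 : x = x ^ (1 / 4 : ℝ) * x ^ (3 / 4 : ℝ) := by
    rw [← Real.rpow_add_of_nonneg hx (by norm_num) (by norm_num)]; norm_num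
  have e2 : K = K ^ (1 / 4 : ℝ) * K ^ (3 / 4 : ℝ) := by
    rw [← Real.rpow_add_of_nonneg hK (by norm_num) (by norm_num)]; norm_num
  calc x = x ^ (1 / 4 : ℝ) * x ^ (3 / 4 : ℝ) := e1
    _ ≤ (K * √r) ^ (1 / 4 : ℝ) * (K / y) ^ (3 / 4 : ℝ) := by gcongr
    _ = (K ^ (1 / 4 : ℝ) * K ^ (3 / 4 : ℝ)) * (r ^ (1 / 8 : ℝ) * y ^ (-(3 / 4) : ℝ)) := by
        rw [Real.mul_rpow hK (Real.sqrt_nonneg _), Real.div_rpow hK hy.le, Real.sqrt_eq_rpow,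
          ← Real.rpow_mul hr, Real.rpow_neg hy.le]
        norm_num
        ring
    _ = _ := by rw [← e2]; ring

theorem memLp_two_bracket (α : ℝ) :
    MemLp (fun β : ℝ => (1 + |α - β|) ^ (-(3 / 4) : ℝ)) 2 volume := by
  have hc : Continuous (fun β : ℝ => (1 + |α - β|) ^ (-(3 / 4) : ℝ)) :=
    Continuous.rpow_const (by fun_prop) fun β => Or.inl (by positivity)
  rw [memLp_two_iff_integrable_sq hc.aestronglyMeasurable]
  have := (integrable_one_add_norm (E := ℝ) (μ := volume) (r := 3 / 2) (by norm_num)).comp_sub_left α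
  refine this.congr (.of_forall fun β => ?_)
  simp only [Real.norm_eq_abs]
  rw [← Real.rpow_natCast, ← Real.rpow_mul (by positivity)]
  norm_num

theorem integrable_bracket (α : ℝ) :
    Integrable (fun β : ℝ => (1 + |α - β|) ^ (-(5 / 4) : ℝ)) := by
  simpa using (integrable_one_add_norm (E := ℝ) (μ := volume) (r := 5 / 4)
    (by norm_num)).comp_sub_left α

section Curve
variable {c C : ℝ} {z v : ℝ → ℂ}

/-- If `f` is the boundary value of a holomorphic function, then the integral of `f'` against the
divided difference of `f` vanishes. -/
theorem Curve.dqInt_self_eq_zero (h : Curve c C z v) (hf : Flat v) {D : ℝ} {f f' : ℝ → ℂ}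
    (hu : ∀ x, HasDerivAt f (f' x) x) (hu' : Hold D f') (hu2 : SqInt D f') (hb : Hold D f)
    (hi : ∀ α, IntegrableOn (sym (cauchyKer z (fun β => v β * f β) α) α) (Ioi 0))
    {N : ℝ → ℝ} (hN : LocalMod f' N)
    (hH : ∀ α, cauchyInt z (fun β => v β * f β) α = Real.pi * Complex.I * f α) (α : ℝ) :
    dqInt z f f' α = 0 := by
  have hc := h.pos
  have hC := h.const_nonneg
  have hD := hu'.nonneg
  set G : ℝ → ℂ := fun β => v β * dq v f' α β with hG
  have hGh : Hold (2 * C * (2 * D * (1 / c + C / c ^ 2))) G := h.hold.mul (h.hold_dq hu' α)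
  set KG := 2 * C * (2 * D * (1 / c + C / c ^ 2))
  have hKG := hGh.nonneg
  have hGc := hGh.continuous
  obtain ⟨E, hE, hE2⟩ := h.exists_sqInt_dq hu hu' hb.bound α
  have hG2 : SqInt (C * E) G := hE2.mul_hold h.hold
  set A := C * (4 * D / c) with hA
  have hA0 : 0 ≤ A := by positivity
  have hdec : ∀ β, ‖G β‖ ≤ A / (1 + |α - β|) := by
    intro β
    have g1 : ‖G β‖ ≤ C * (D / c) := by
      rw [hG, norm_mul]
      exact mul_le_mul (h.hold.bound β) (h.norm_dq_le hu' _ _) (norm_nonneg _) hC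
    rw [le_div_iff₀ (by positivity), mul_add, mul_one]
    have g2 : ‖G β‖ * |α - β| ≤ C * (2 * D / c) := by
      rcases eq_or_ne β α with rfl | hne
      · simp; positivity
      · have hpos : 0 < |α - β| := abs_pos.2 (_root_.sub_ne_zero.2 hne.symm)
        rw [← le_div_iff₀ hpos, mul_div_assoc, hG, norm_mul]
        exact mul_le_mul (h.hold.bound β) (h.norm_dq_le' hu hu'.continuous hb.bound hne.symm)
          (norm_nonneg _) hC
    have : 0 ≤ C * (D / c) := by positivity
    calc _ ≤ C * (D / c) + C * (2 * D / c) := add_le_add g1 g2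
      _ = 3 * (C * (D / c)) := by ring
      _ ≤ 4 * (C * (D / c)) := by linarith
      _ = A := by rw [hA]; ring
  set K := KG + 3 * A with hK
  have hK0 : 0 ≤ K := by positivity
  -- The modulus of G comes from interpolating its Hölder bound with its decay 1/(1 + |α − β|).
  have hGN : LocalMod G (fun β => K * (1 + |α - β|) ^ (-(3 / 4) : ℝ)) := by
    refine ⟨fun β => by positivity, (memLp_two_bracket α).const_mul K, fun β s hs => ?_⟩
    refine le_rpow_mul_of_le (norm_nonneg _) hK0 (abs_nonneg _) (by positivity) ?_ ?_
    · have := hGh.holder (β + s) β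
      rw [add_sub_cancel_left] at this
      refine this.trans ?_
      gcongr
      linarith
    · refine (norm_sub_le _ _).trans ((add_le_add (hdec _) (hdec _)).trans ?_)
      have t : |α - β| ≤ |α - (β + s)| + |s| := by
        have := abs_add_le (α - (β + s)) s
        rwa [show α - (β + s) + s = α - β by ring] at this
      have : A / (1 + |α - (β + s)|) ≤ 2 * A / (1 + |α - β|) := by
        rw [div_le_div_iff₀ (by positivity) (by positivity)]
        have t2 : 1 + |α - β| ≤ 2 * (1 + |α - (β + s)|) := by
          have := abs_nonneg (α - (β + s))
          linarith
        have := mul_le_mul_of_nonneg_left t2 hA0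
        linarith
      calc _ ≤ 2 * A / (1 + |α - β|) + A / (1 + |α - β|) := by gcongr
        _ = 3 * A / (1 + |α - β|) := by ring
        _ ≤ _ := by gcongr; linarith
  have hwt : Integrable (fun y => ‖f' y‖ * (1 + |α - y|) ^ (-(3 / 4) : ℝ)) :=
    hu2.memLp.norm.integrable_mul (memLp_two_bracket α)
  have hB0 : Integrable (fun β : ℝ => (1 + |β|) ^ (-(5 / 4) : ℝ)) := by
    simpa using (integrable_one_add_norm (E := ℝ) (μ := volume) (r := 5 / 4) (by norm_num))
  obtain ⟨M2, M1⟩ := integrable_majorant hwt (integrable_bracket α) hB0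
  have two : ∀ s : ℝ, 1 ≤ |s| → 1 / |s| ≤ 2 * (1 / (1 + |s|)) := by
    intro s hs
    rw [mul_one_div, div_le_div_iff₀ (by linarith) (by positivity)]
    linarith
  -- Far from the diagonal G supplies one power of decay and the kernel another; `one_div_mul_le`
  -- moves weight −3/4 onto f', making it integrable, and leaves an integrable factor in the other
  -- variable.
  have P1 := h.integrableOn_pairKer hGc hG2.memLp hu'.continuous hu2.memLp hN
    (M1.const_mul (4 * A)) (by
      intro p hp
      have tri : 1 + |α - (p.1 + p.2)| ≤ (1 + |α - p.1|) + (1 + |p.2|) := by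
        have := abs_sub (α - p.1) p.2
        rw [show α - p.1 - p.2 = α - (p.1 + p.2) by ring] at this
        linarith
      have key := one_div_mul_le (x := 1 + |α - p.1|) (y := 1 + |p.2|) (by simp) (by simp)
        (by simp) tri
      calc ‖G p.1‖ * ‖f' (p.1 + p.2)‖ / |p.2| = ‖G p.1‖ * ‖f' (p.1 + p.2)‖ * (1 / |p.2|) := by ring
        _ ≤ A / (1 + |α - p.1|) * ‖f' (p.1 + p.2)‖ * (2 * (1 / (1 + |p.2|))) := by
            gcongr
            · exact hdec _
            · exact two _ hp
        _ = 2 * A * ‖f' (p.1 + p.2)‖ * (1 / ((1 + |α - p.1|) * (1 + |p.2|))) := by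
            field_simp
        _ ≤ _ := mul_le_mul_of_nonneg_left key (by positivity)
        _ = _ := by ring)
  have P2 := h.integrableOn_pairKer hu'.continuous hu2.memLp hGc hG2.memLp hGN
    (M2.const_mul (4 * A)) (by
      intro p hp
      have tri : 1 + |α - p.1| ≤ (1 + |α - (p.1 + p.2)|) + (1 + |p.2|) := by
        have := abs_add_le (α - (p.1 + p.2)) p.2
        rw [show α - (p.1 + p.2) + p.2 = α - p.1 by ring] at this
        linarith
      have key := one_div_mul_le (x := 1 + |α - (p.1 + p.2)|) (y := 1 + |p.2|) (by simp) (by simp)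
        (by simp) tri
      calc ‖f' p.1‖ * ‖G (p.1 + p.2)‖ / |p.2| = ‖f' p.1‖ * ‖G (p.1 + p.2)‖ * (1 / |p.2|) := by ring
        _ ≤ ‖f' p.1‖ * (A / (1 + |α - (p.1 + p.2)|)) * (2 * (1 / (1 + |p.2|))) := by
            gcongr
            · exact hdec _
            · exact two _ hp
        _ = 2 * A * ‖f' p.1‖ * (1 / ((1 + |α - (p.1 + p.2)|) * (1 + |p.2|))) := by
            field_simp
        _ ≤ _ := mul_le_mul_of_nonneg_left key (by positivity)
        _ = _ := by ring)
  have skew := h.integral_mul_cauchyInt hGc hG2.memLp hu'.continuous hu2.memLp P1 P2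
  have pi0 : (Real.pi : ℂ) * Complex.I ≠ 0 := by simp [Real.pi_ne_zero]
  -- Differentiating the boundary value relation for f gives v·C(f') = πi f'.
  have T1 : ∀ β, G β * cauchyInt z f' β = Real.pi * Complex.I * (dq v f' α β * f' β) := by
    intro β
    have d1 := (h.hasDerivAt_cauchyInt hf hu hu' hu2 hb hi β).1
    have d2 : HasDerivAt (cauchyInt z (fun β => v β * f β)) (Real.pi * Complex.I * f' β) β := by
      rw [show cauchyInt z (fun β => v β * f β) = fun β => Real.pi * Complex.I * f β from
        funext hH]
      exact (hu β).const_mul _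
    have e := d1.unique d2
    rw [hG]
    linear_combination (dq v f' α β) * e
  -- The divided difference of a boundary value is again a boundary value: away from α, C(G) = πi
  -- times the divided difference.
  have T2 : ∀ γ, γ ≠ α → f' γ * cauchyInt z G γ = Real.pi * Complex.I * (dq v f' α γ * f' γ) := by
    intro γ hγ
    have e := h.cauchyInt_sub hf hu hu' hb hi hγ
    rw [hH, hH] at e
    have hz := h.sub_ne_zero hγ
    have : cauchyInt z G γ = Real.pi * Complex.I * dq v f' α γ := by
      rw [dq_comm h hu hu'.continuous, h.dq_eq hu hu'.continuous hγ, ← mul_div_assoc,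
        eq_div_iff hz, mul_comm (cauchyInt z G γ)]
      linear_combination -e
    rw [this]
    ring
  have T2' : ∫ γ, f' γ * cauchyInt z G γ = ∫ γ, Real.pi * Complex.I * (dq v f' α γ * f' γ) := by
    refine integral_congr_ae ?_
    filter_upwards [compl_mem_ae_iff.2 (show volume ({α} : Set ℝ) = 0 by simp)] with γ hγ
    exact T2 γ hγ
  simp_rw [T1] at skew
  rw [T2', integral_const_mul] at skew
  rw [h.dqInt_eq hu hu' hb.bound hu2, (h.integrable_dqKer hu hu' hb.bound hu2 α).2.2]
  -- The two sides of the skew pairing have the same integrand, so the integral equals its own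
  -- negative.
  have : (Real.pi * Complex.I) * (2 * ∫ β, dq v f' α β * f' β) = 0 := by linear_combination skew
  simpa [pi0] using this

end Curve

/-! ### Functions with a square integrable weak derivative -/

/-- The space `L²(ℝ; ℂ)`. -/
abbrev LTwo := Lp ℂ 2 (volume : Measure ℝ)

theorem deriv_smoothTransition_eq_zero {τ : ℝ} (h : τ ≤ 0 ∨ 1 ≤ τ) :
    deriv Real.smoothTransition τ = 0 := by
  rcases h with h | h
  · refine IsLocalMin.deriv_eq_zero (.of_forall fun x => ?_)
    rw [Real.smoothTransition.zero_of_nonpos h]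
    exact Real.smoothTransition.nonneg x
  · refine IsLocalMax.deriv_eq_zero (.of_forall fun x => ?_)
    rw [Real.smoothTransition.one_of_one_le h]
    exact Real.smoothTransition.le_one x

theorem continuous_deriv_smoothTransition : Continuous (deriv Real.smoothTransition) :=
  (Real.smoothTransition.contDiff (n := 1)).continuous_deriv le_rfl

theorem hasDerivAt_smoothTransition (l y t : ℝ) :
    HasDerivAt (fun t => Real.smoothTransition (l * (t - y)))
      (l * deriv Real.smoothTransition (l * (t - y))) t := by
  have h1 : HasDerivAt Real.smoothTransition (deriv Real.smoothTransition (l * (t - y)))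
      (l * (t - y)) :=
    ((Real.smoothTransition.contDiff (n := 1)).differentiable one_ne_zero _).hasDerivAt
  have h2 : HasDerivAt (fun t : ℝ => l * (t - y)) l t := by
    simpa using ((hasDerivAt_id t).sub_const y).const_mul l
  rw [mul_comm]
  exact h1.comp t h2

theorem integral_deriv_smoothTransition {u : ℝ → ℂ} {l : ℝ} (hl : 0 < l) (y : ℝ) :
    ∫ t, ((l * deriv Real.smoothTransition (l * (t - y)) : ℝ) : ℂ) * u t =
      ∫ τ in (0 : ℝ)..1, ((deriv Real.smoothTransition τ : ℝ) : ℂ) * u (y + τ * l⁻¹) := by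
  set g : ℝ → ℂ := fun τ => ((l * deriv Real.smoothTransition τ : ℝ) : ℂ) * u (y + τ * l⁻¹) with hg
  have e1 : ∀ t, ((l * deriv Real.smoothTransition (l * (t - y)) : ℝ) : ℂ) * u t =
      g (l * (t - y)) := by
    intro t
    simp only [hg]
    congr 2
    field_simp
    ring
  simp_rw [e1]
  rw [integral_sub_right_eq_self (fun t => g (l * t)) y, Measure.integral_comp_mul_left,
    intervalIntegral.integral_eq_integral_of_support_subset, ← integral_smul]
  · refine integral_congr_ae (.of_forall fun τ => ?_)
    simp only [hg, abs_of_pos (inv_pos.2 hl), Complex.real_smul]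
    push_cast
    have : (l : ℂ) ≠ 0 := by exact_mod_cast hl.ne'
    field_simp
  · intro τ hτ
    by_contra hcon
    rw [mem_Ioc, not_and_or, not_lt, not_le] at hcon
    apply hτ
    simp only
    rw [deriv_smoothTransition_eq_zero (hcon.imp id le_of_lt)]
    simp

/-- The derivative of the transition function vanishes off (0, 1) and has integral 1, so its dilates
are an approximate identity at y. -/
theorem tendsto_integral_deriv_smoothTransition {u : ℝ → ℂ} (hu : Continuous u) (y : ℝ) :
    Tendsto (fun n : ℕ => ∫ t, ((((n : ℝ) + 1) *
      deriv Real.smoothTransition (((n : ℝ) + 1) * (t - y)) : ℝ) : ℂ) * u t) atTop (𝓝 (u y)) := by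
  have hσ := continuous_deriv_smoothTransition
  have hc : Continuous fun r : ℝ => ∫ τ in (0 : ℝ)..1,
      ((deriv Real.smoothTransition τ : ℝ) : ℂ) * u (y + τ * r) :=
    intervalIntegral.continuous_parametric_intervalIntegral_of_continuous'
      (by simp only [Function.uncurry_def]; fun_prop) 0 1
  have h0 : ∫ τ in (0 : ℝ)..1, ((deriv Real.smoothTransition τ : ℝ) : ℂ) * u (y + τ * 0) = u y := by
    simp only [mul_zero, add_zero]
    rw [intervalIntegral.integral_mul_const, intervalIntegral.integral_ofReal,
      intervalIntegral.integral_deriv_eq_sub (fun τ _ =>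
        (Real.smoothTransition.contDiff (n := 1)).differentiable one_ne_zero _)
        (hσ.intervalIntegrable _ _)]
    simp
  have hlim : Tendsto (fun n : ℕ => ((n : ℝ) + 1)⁻¹) atTop (𝓝 0) := by
    simpa using tendsto_one_div_add_atTop_nhds_zero_nat (𝕜 := ℝ)
  have := (hc.tendsto 0).comp hlim
  rw [h0] at this
  refine this.congr fun n => ?_
  rw [integral_deriv_smoothTransition (by positivity), Function.comp_apply]

theorem norm_integral_le_sqrt (V : LTwo) (y x : ℝ) :
    ∫ t in uIoc y x, ‖V t‖ ≤ √|x - y| * ‖V‖ := by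
  have hm := (Lp.memLp V).restrict (uIoc y x)
  have h1 := eLpNorm_le_eLpNorm_mul_rpow_measure_univ (p := 1) (q := 2) (by norm_num) hm.1
  rw [Measure.restrict_apply_univ, uIoc, Real.volume_Ioc, max_sub_min_eq_abs] at h1
  have h2 : ∫ t in uIoc y x, ‖V t‖ = (eLpNorm V 1 (volume.restrict (uIoc y x))).toReal := by
    rw [integral_norm_eq_lintegral_enorm hm.1, eLpNorm_one_eq_lintegral_enorm]
  rw [h2]
  refine (ENNReal.toReal_mono ?_ (h1.trans (mul_le_mul_left
    (eLpNorm_mono_measure V Measure.restrict_le_self) _))).trans (le_of_eq ?_)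
  · refine ENNReal.mul_ne_top (Lp.memLp V).2.ne (ENNReal.rpow_ne_top_of_nonneg (by norm_num)
      ENNReal.ofReal_ne_top)
  · rw [ENNReal.toReal_mul, mul_comm, ← Lp.norm_def]
    congr 1
    rw [← ENNReal.toReal_rpow, ENNReal.toReal_ofReal (abs_nonneg _), Real.sqrt_eq_rpow]
    norm_num

theorem LTwo.locallyIntegrable (V : LTwo) : LocallyIntegrable V volume :=
  (Lp.memLp V).locallyIntegrable (by norm_num)

/-- `u` is the continuous representative of `U`, whose weak derivative is `V`. -/
structure H1At (u : ℝ → ℂ) (U V : LTwo) : Prop where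
  cont : Continuous u
  ae : u =ᵐ[volume] U
  weak : IsWeakDeriv U V

/-- The weak derivative is tested on plateaus that rise just to the right of y and fall just to the
right of x. Their derivatives concentrate at the two points, where the continuous representative is
evaluated, and the plateaus tend to the indicator of (y, x]. -/
theorem H1At.sub_eq {u : ℝ → ℂ} {U V : LTwo} (h : H1At u U V) {y x : ℝ} (hyx : y ≤ x) :
    u x - u y = ∫ t in y..x, V t := by
  set φ : ℕ → ℝ → ℝ := fun n t => Real.smoothTransition (((n : ℝ) + 1) * (t - y)) -
    Real.smoothTransition (((n : ℝ) + 1) * (t - x)) with hφ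
  have hpos : ∀ n : ℕ, (1 : ℝ) ≤ (n : ℝ) + 1 := fun n => by simp
  have hsm : ∀ n, ContDiff ℝ ∞ (φ n) := fun n =>
    (Real.smoothTransition.contDiff.comp (by fun_prop)).sub
      (Real.smoothTransition.contDiff.comp (by fun_prop))
  have hzero : ∀ n t, t ∉ Icc y (x + 1) → φ n t = 0 := by
    intro n t ht
    rw [mem_Icc, not_and_or, not_le, not_le] at ht
    have := hpos n
    rcases ht with ht | ht
    · simp only [hφ]
      rw [Real.smoothTransition.zero_of_nonpos (by nlinarith),
        Real.smoothTransition.zero_of_nonpos (by nlinarith), sub_zero]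
    · simp only [hφ]
      rw [Real.smoothTransition.one_of_one_le (by nlinarith),
        Real.smoothTransition.one_of_one_le (by nlinarith), sub_self]
  have hcs : ∀ n, HasCompactSupport (φ n) := fun n =>
    HasCompactSupport.intro isCompact_Icc (hzero n)
  have hder : ∀ n t, deriv (φ n) t =
      ((n : ℝ) + 1) * deriv Real.smoothTransition (((n : ℝ) + 1) * (t - y)) -
      ((n : ℝ) + 1) * deriv Real.smoothTransition (((n : ℝ) + 1) * (t - x)) := fun n t =>
    ((hasDerivAt_smoothTransition _ y t).sub (hasDerivAt_smoothTransition _ x t)).deriv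
  have hint : ∀ (n : ℕ) (y : ℝ), Integrable fun t => ((((n : ℝ) + 1) *
      deriv Real.smoothTransition (((n : ℝ) + 1) * (t - y)) : ℝ) : ℂ) * u t := by
    intro n y
    have hσ := continuous_deriv_smoothTransition
    have hu := h.cont
    refine Continuous.integrable_of_hasCompactSupport (by fun_prop)
      (HasCompactSupport.intro (isCompact_Icc (a := y) (b := y + 1)) fun t ht => ?_)
    rw [mem_Icc, not_and_or, not_le, not_le] at ht
    have := hpos n
    rw [deriv_smoothTransition_eq_zero]
    · simp
    · rcases ht with ht | ht
      · left; nlinarith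
      · right; nlinarith
  have lhs : Tendsto (fun n => ∫ t, ((deriv (φ n) t : ℝ) : ℂ) * U t) atTop (𝓝 (u y - u x)) := by
    refine ((tendsto_integral_deriv_smoothTransition h.cont y).sub
      (tendsto_integral_deriv_smoothTransition h.cont x)).congr fun n => ?_
    rw [← integral_sub (hint n y) (hint n x)]
    refine integral_congr_ae ?_
    filter_upwards [h.ae] with t ht
    rw [hder, ← ht]
    push_cast
    ring
  have rhs : Tendsto (fun n => ∫ t, (φ n t : ℂ) * V t) atTop (𝓝 (∫ t in y..x, V t)) := by
    rw [intervalIntegral.integral_of_le hyx, ← integral_indicator measurableSet_Ioc]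
    refine tendsto_integral_of_dominated_convergence ((Icc y (x + 1)).indicator fun t => ‖V t‖)
      (fun n => ?_) ?_ (fun n => .of_forall fun t => ?_) (.of_forall fun t => ?_)
    · have : Continuous (φ n) := (hsm n).continuous
      exact (Complex.continuous_ofReal.comp this).aestronglyMeasurable.mul (Lp.aestronglyMeasurable V)
    · rw [integrable_indicator_iff measurableSet_Icc]
      exact ((LTwo.locallyIntegrable V).integrableOn_isCompact isCompact_Icc).norm
    · by_cases ht : t ∈ Icc y (x + 1)
      · rw [indicator_of_mem ht, norm_mul, Complex.norm_real, Real.norm_eq_abs]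
        refine mul_le_of_le_one_left (norm_nonneg _) (abs_le.2 ⟨?_, ?_⟩)
        · simp only [hφ]
          linarith [Real.smoothTransition.nonneg (((n : ℝ) + 1) * (t - y)),
            Real.smoothTransition.le_one (((n : ℝ) + 1) * (t - x))]
        · simp only [hφ]
          linarith [Real.smoothTransition.nonneg (((n : ℝ) + 1) * (t - x)),
            Real.smoothTransition.le_one (((n : ℝ) + 1) * (t - y))]
      · rw [indicator_of_notMem ht, hzero n t ht]; simp
    · have key : ∀ᶠ n : ℕ in atTop, φ n t = (Ioc y x).indicator (fun _ => (1 : ℝ)) t := by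
        have large : ∀ d : ℝ, 0 < d → ∀ᶠ n : ℕ in atTop, 1 ≤ ((n : ℝ) + 1) * d := by
          intro d hd
          obtain ⟨k, hk⟩ := exists_nat_gt (1 / d)
          filter_upwards [eventually_ge_atTop k] with n hn
          have : (k : ℝ) ≤ n := by exact_mod_cast hn
          rw [div_lt_iff₀ hd] at hk
          nlinarith
        rcases le_or_gt t y with h1 | h1
        · refine .of_forall fun n => ?_
          have := hpos n
          simp only [hφ]
          rw [Real.smoothTransition.zero_of_nonpos (by nlinarith),
            Real.smoothTransition.zero_of_nonpos (by nlinarith), indicator_of_notMem (by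
              simp only [mem_Ioc]; rintro ⟨h', -⟩; linarith), sub_zero]
        rcases le_or_gt t x with h2 | h2
        · filter_upwards [large (t - y) (by linarith)] with n hn
          have := hpos n
          simp only [hφ]
          rw [Real.smoothTransition.one_of_one_le hn,
            Real.smoothTransition.zero_of_nonpos (by nlinarith), indicator_of_mem
              (show t ∈ Ioc y x from ⟨h1, h2⟩), sub_zero]
        · filter_upwards [large (t - x) (by linarith)] with n hn
          have := hpos n
          simp only [hφ]
          rw [Real.smoothTransition.one_of_one_le hn,
            Real.smoothTransition.one_of_one_le (by nlinarith), indicator_of_notMem (by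
              simp only [mem_Ioc]; rintro ⟨-, h'⟩; linarith), sub_self]
      refine tendsto_const_nhds.congr' ?_
      filter_upwards [key] with n hn
      rw [hn]
      by_cases ht : t ∈ Ioc y x
      · simp [ht]
      · simp [ht]
  have := tendsto_nhds_unique lhs ((rhs.neg).congr fun n => (h.weak (φ n) (hsm n) (hcs n)).symm)
  linear_combination -this

theorem H1At.norm_sub_le_integral {u : ℝ → ℂ} {U V : LTwo} (h : H1At u U V) (x y : ℝ) :
    ‖u x - u y‖ ≤ ∫ t in uIoc y x, ‖V t‖ := by
  rcases le_total y x with hyx | hyx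
  · rw [h.sub_eq hyx]
    exact intervalIntegral.norm_integral_le_integral_norm_uIoc
  · rw [norm_sub_rev, h.sub_eq hyx, uIoc_comm]
    exact intervalIntegral.norm_integral_le_integral_norm_uIoc

theorem H1At.norm_sub_le {u : ℝ → ℂ} {U V : LTwo} (h : H1At u U V) (x y : ℝ) :
    ‖u x - u y‖ ≤ √|x - y| * ‖V‖ :=
  (h.norm_sub_le_integral x y).trans (norm_integral_le_sqrt V y x)

/-- Over the unit interval starting at x, u varies by at most ‖V‖; averaging there compares u(x)
with the L² norm. -/
theorem H1At.norm_le {u : ℝ → ℂ} {U V : LTwo} (h : H1At u U V) (x : ℝ) : ‖u x‖ ≤ ‖U‖ + ‖V‖ := by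
  have hle : ∀ y ∈ Icc x (x + 1), ‖u x‖ ≤ ‖u y‖ + ‖V‖ := by
    intro y hy
    have h1 := h.norm_sub_le x y
    have h2 : √|x - y| ≤ 1 := by
      rw [Real.sqrt_le_one, abs_le]
      constructor <;> linarith [hy.1, hy.2]
    have h3 := norm_le_norm_add_norm_sub' (u x) (u y)
    have := norm_nonneg V
    nlinarith
  have hu := h.cont
  have h1 := intervalIntegral.integral_mono_on (a := x) (b := x + 1) (μ := volume)
    (f := fun _ => ‖u x‖) (g := fun y => ‖u y‖ + ‖V‖) (by linarith)
    (Continuous.intervalIntegrable (by fun_prop) _ _)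
    (Continuous.intervalIntegrable (by fun_prop) _ _) hle
  rw [intervalIntegral.integral_add (Continuous.intervalIntegrable (by fun_prop) _ _)
    (Continuous.intervalIntegrable (by fun_prop) _ _)] at h1
  simp only [intervalIntegral.integral_const, add_sub_cancel_left, one_smul] at h1
  have h2 := norm_integral_le_sqrt U x (x + 1)
  rw [uIoc_of_le (by linarith), add_sub_cancel_left, abs_one, Real.sqrt_one, one_mul] at h2
  have h3 : ∫ y in x..(x + 1), ‖u y‖ = ∫ y in Ioc x (x + 1), ‖U y‖ := by
    rw [intervalIntegral.integral_of_le (by linarith)]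
    exact integral_congr_ae (ae_restrict_of_ae (h.ae.mono fun t ht => by simp only [ht]))
  linarith

theorem H1At.hold {u : ℝ → ℂ} {U V : LTwo} (h : H1At u U V) : Hold (‖U‖ + ‖V‖) u where
  bound := h.norm_le
  holder x y := by
    refine (h.norm_sub_le x y).trans ?_
    rw [mul_comm]
    gcongr
    linarith [norm_nonneg U]

theorem H1At.sqInt {u : ℝ → ℂ} {U V : LTwo} (h : H1At u U V) : SqInt ‖U‖ u where
  memLp := (memLp_congr_ae h.ae).2 (Lp.memLp U)
  norm_le := by
    rw [eLpNorm_congr_ae h.ae, Lp.norm_def, ENNReal.ofReal_toReal (Lp.memLp U).2.ne]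

/-- N(β)² is the integral of |V|² over [β − 1, β + 1], a convolution of integrable functions, so N
is square integrable. Cauchy–Schwarz gives |s|^(1/2), which is at most |s|^(1/8) for |s| ≤ 1. -/
theorem H1At.exists_localMod {u : ℝ → ℂ} {U V : LTwo} (h : H1At u U V) :
    ∃ N, LocalMod u N := by
  have hV2 : Integrable fun t => ‖V t‖ ^ 2 := (memLp_two_iff_integrable_sq_norm
    (Lp.aestronglyMeasurable V)).1 (Lp.memLp V)
  have hind : Integrable ((Icc (-1 : ℝ) 1).indicator fun _ => (1 : ℝ)) := by
    rw [integrable_indicator_iff measurableSet_Icc]; simp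
  have hzero : Integrable fun _ : ℝ => (0 : ℝ) := integrable_zero _ _ _
  have hprod := (integrable_majorant hV2 hzero hind).2
  simp only [zero_add] at hprod
  have hint : Integrable fun β => ∫ r, ‖V (β + r)‖ ^ 2 * (Icc (-1 : ℝ) 1).indicator
      (fun _ => (1 : ℝ)) r := Integrable.integral_prod_left hprod
  have hform : ∀ β, ∫ r, ‖V (β + r)‖ ^ 2 * (Icc (-1 : ℝ) 1).indicator (fun _ => (1 : ℝ)) r =
      ∫ t in Icc (β - 1) (β + 1), ‖V t‖ ^ 2 := by
    intro β
    rw [← integral_indicator measurableSet_Icc, ← integral_add_left_eq_self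
      ((Icc (β - 1) (β + 1)).indicator fun t => ‖V t‖ ^ 2) β]
    refine integral_congr_ae (.of_forall fun r => ?_)
    simp only [indicator, mem_Icc]
    have : (β - 1 ≤ β + r ∧ β + r ≤ β + 1) ↔ (-1 ≤ r ∧ r ≤ 1) := by
      constructor <;> rintro ⟨h1, h2⟩ <;> constructor <;> linarith
    split_ifs with h1 h2 h2
    · simp
    · exact absurd (this.2 h1) h2
    · exact absurd (this.1 h2) h1
    · simp
  simp_rw [hform] at hint
  have hnn : ∀ β, 0 ≤ ∫ t in Icc (β - 1) (β + 1), ‖V t‖ ^ 2 := fun β =>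
    integral_nonneg fun t => by positivity
  refine ⟨fun β => √(∫ t in Icc (β - 1) (β + 1), ‖V t‖ ^ 2), fun β => Real.sqrt_nonneg _, ?_, ?_⟩
  · rw [memLp_two_iff_integrable_sq (Real.continuous_sqrt.comp_aestronglyMeasurable hint.1)]
    exact hint.congr (.of_forall fun β => (Real.sq_sqrt (hnn β)).symm)
  · intro β s hs
    have h1 := h.norm_sub_le_integral (β + s) β
    have hsub : uIoc β (β + s) ⊆ Icc (β - 1) (β + 1) := by
      intro t ht
      have := abs_le.1 hs
      rcases mem_uIoc.1 ht with h' | h' <;> constructor <;> linarith [h'.1, h'.2]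
    have hcs : ∫ t in uIoc β (β + s), ‖V t‖ ≤
        √|s| * √(∫ t in Icc (β - 1) (β + 1), ‖V t‖ ^ 2) := by
      set μ := volume.restrict (uIoc β (β + s))
      have hVμ : MemLp (fun t => ‖V t‖) 2 μ := ((Lp.memLp V).restrict _).norm
      have hfin : IsFiniteMeasure μ := ⟨by
        rw [Measure.restrict_apply_univ, uIoc, Real.volume_Ioc]; exact ENNReal.ofReal_lt_top⟩
      have hcs := integral_mul_le_Lp_mul_Lq_of_nonneg (μ := μ) Real.HolderConjugate.two_two
        (f := fun _ => (1 : ℝ)) (g := fun t => ‖V t‖) (.of_forall fun _ => zero_le_one)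
        (.of_forall fun _ => norm_nonneg _) (memLp_const 1) (by simpa using hVμ)
      simp only [one_mul, Real.one_rpow, integral_const, smul_eq_mul, mul_one] at hcs
      refine hcs.trans ?_
      rw [← Real.sqrt_eq_rpow, ← Real.sqrt_eq_rpow]
      refine mul_le_mul (Real.sqrt_le_sqrt (le_of_eq ?_)) (Real.sqrt_le_sqrt ?_)
        (Real.sqrt_nonneg _) (Real.sqrt_nonneg _)
      · rw [Measure.real, Measure.restrict_apply_univ, uIoc, Real.volume_Ioc, max_sub_min_eq_abs,
          ENNReal.toReal_ofReal (abs_nonneg _), add_sub_cancel_left]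
      · simp only [Real.rpow_two]
        exact setIntegral_mono_set hV2.integrableOn (.of_forall fun _ => by positivity)
          hsub.eventuallyLE
    refine h1.trans (hcs.trans ?_)
    gcongr
    rcases (abs_nonneg s).eq_or_lt with h0 | h0
    · rw [← h0]; simp
    · rw [Real.sqrt_eq_rpow]
      exact Real.rpow_le_rpow_of_exponent_ge h0 hs (by norm_num)

/-! ### Weak derivatives under linear combinations, L² limits and time differentiation -/

theorem exists_pairing {φ : ℝ → ℝ} (hφ : Continuous φ) (hc : HasCompactSupport φ) :
    ∃ L : LTwo →L[ℂ] ℂ, ∀ U : LTwo, L U = ∫ x, (φ x : ℂ) * U x := by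
  have hm : MemLp (fun x => (φ x : ℂ)) 2 volume :=
    (Complex.continuous_ofReal.comp hφ).memLp_of_hasCompactSupport
      (hc.comp_left Complex.ofReal_zero)
  refine ⟨innerSL ℂ hm.toLp, fun U => ?_⟩
  rw [innerSL_apply_apply, L2.inner_def]
  refine integral_congr_ae ?_
  filter_upwards [hm.coeFn_toLp] with x hx
  rw [hx, RCLike.inner_apply, Complex.conj_ofReal, mul_comm]

theorem exists_pairings {φ : ℝ → ℝ} (hφ : ContDiff ℝ ∞ φ) (hc : HasCompactSupport φ) :
    ∃ L L' : LTwo →L[ℂ] ℂ, (∀ U : LTwo, L U = ∫ x, (φ x : ℂ) * U x) ∧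
      ∀ U : LTwo, L' U = ∫ x, ((deriv φ x : ℝ) : ℂ) * U x := by
  obtain ⟨L, hL⟩ := exists_pairing hφ.continuous hc
  obtain ⟨L', hL'⟩ := exists_pairing (hφ.continuous_deriv (by simp)) hc.deriv
  exact ⟨L, L', hL, hL'⟩

theorem IsWeakDeriv.sub {U V U' V' : LTwo} (h : IsWeakDeriv U V) (h' : IsWeakDeriv U' V') :
    IsWeakDeriv (U - U') (V - V') := by
  intro φ hφ hc
  obtain ⟨L, L', hL, hL'⟩ := exists_pairings hφ hc
  have h1 := h φ hφ hc
  have h2 := h' φ hφ hc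
  rw [← hL, ← hL'] at h1 h2 ⊢
  rw [map_sub, map_sub, h1, h2]
  ring

theorem IsWeakDeriv.const_smul {U V : LTwo} (h : IsWeakDeriv U V) (c : ℝ) :
    IsWeakDeriv (c • U) (c • V) := by
  intro φ hφ hc
  obtain ⟨L, L', hL, hL'⟩ := exists_pairings hφ hc
  have h1 := h φ hφ hc
  rw [← hL, ← hL'] at h1 ⊢
  rw [L.map_smul_of_tower, L'.map_smul_of_tower, h1, smul_neg]

theorem IsWeakDeriv.of_tendsto {ι : Type*} {l : Filter ι} [l.NeBot] {U V : ι → LTwo}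
    {U₀ V₀ : LTwo} (h : ∀ᶠ i in l, IsWeakDeriv (U i) (V i)) (hU : Tendsto U l (𝓝 U₀))
    (hV : Tendsto V l (𝓝 V₀)) : IsWeakDeriv U₀ V₀ := by
  intro φ hφ hc
  obtain ⟨L, L', hL, hL'⟩ := exists_pairings hφ hc
  rw [← hL, ← hL']
  refine tendsto_nhds_unique ((L'.continuous.tendsto U₀).comp hU)
    ((((L.continuous.tendsto V₀).comp hV).neg).congr' ?_)
  filter_upwards [h] with i hi
  have h1 := hi φ hφ hc
  rw [← hL, ← hL'] at h1
  exact h1.symm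

theorem H1At.sub {u u' : ℝ → ℂ} {U V U' V' : LTwo} (h : H1At u U V) (h' : H1At u' U' V') :
    H1At (fun x => u x - u' x) (U - U') (V - V') where
  cont := h.cont.sub h'.cont
  ae := by
    filter_upwards [h.ae, h'.ae, Lp.coeFn_sub U U'] with x h1 h2 h3
    rw [h3, Pi.sub_apply, h1, h2]
  weak := h.weak.sub h'.weak

theorem H1At.const_smul {u : ℝ → ℂ} {U V : LTwo} (h : H1At u U V) (c : ℝ) :
    H1At (fun x => c • u x) (c • U) (c • V) where
  cont := h.cont.const_smul c
  ae := by
    filter_upwards [h.ae, Lp.coeFn_smul c U] with x h1 h3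
    rw [h3, Pi.smul_apply, h1]
  weak := h.weak.const_smul c

/-- By `H1At.norm_le` applied to differences, L² convergence of functions and weak derivatives makes
the continuous representatives converge uniformly. An almost everywhere convergent subsequence
identifies the limit with U₀. -/
theorem H1At.exists_of_tendsto {ι : Type*} {l : Filter ι} [l.NeBot] [l.IsCountablyGenerated]
    {u : ι → ℝ → ℂ} {U V : ι → LTwo} {U₀ V₀ : LTwo} (h : ∀ᶠ i in l, H1At (u i) (U i) (V i))
    (hU : Tendsto U l (𝓝 U₀)) (hV : Tendsto V l (𝓝 V₀)) :
    ∃ d, H1At d U₀ V₀ ∧ ∀ x, Tendsto (fun i => u i x) l (𝓝 (d x)) := by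
  obtain ⟨i₀, hi₀⟩ := exists_seq_tendsto l
  obtain ⟨N, hN⟩ := eventually_atTop.1 (hi₀.eventually h)
  set i : ℕ → ι := fun n => i₀ (n + N)
  have hi : Tendsto i atTop l := hi₀.comp (tendsto_add_atTop_nat N)
  have hH : ∀ n, H1At (u (i n)) (U (i n)) (V (i n)) := fun n => hN _ (by omega)
  have hUn := hU.comp hi
  have hVn := hV.comp hi
  have hdiff : ∀ m n x, dist (u (i m) x) (u (i n) x) ≤
      dist ((U ∘ i) m) ((U ∘ i) n) + dist ((V ∘ i) m) ((V ∘ i) n) := by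
    intro m n x
    rw [dist_eq_norm, dist_eq_norm, dist_eq_norm]
    exact ((hH m).sub (hH n)).norm_le x
  have hcau : ∀ x, CauchySeq fun n => u (i n) x := by
    intro x
    rw [Metric.cauchySeq_iff]
    intro ε hε
    obtain ⟨N₁, h1⟩ := Metric.cauchySeq_iff.1 hUn.cauchySeq (ε / 2) (half_pos hε)
    obtain ⟨N₂, h2⟩ := Metric.cauchySeq_iff.1 hVn.cauchySeq (ε / 2) (half_pos hε)
    refine ⟨max N₁ N₂, fun m hm n hn => (hdiff m n x).trans_lt ?_⟩
    have := h1 m (le_trans (le_max_left _ _) hm) n (le_trans (le_max_left _ _) hn)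
    have := h2 m (le_trans (le_max_right _ _) hm) n (le_trans (le_max_right _ _) hn)
    linarith
  choose d hd using fun x => cauchySeq_tendsto_of_complete (hcau x)
  have hbd : ∀ᶠ j in l, ∀ x, ‖u j x - d x‖ ≤ ‖U j - U₀‖ + ‖V j - V₀‖ := by
    filter_upwards [h] with j hj x
    exact le_of_tendsto_of_tendsto ((tendsto_const_nhds.sub (hd x)).norm)
      ((tendsto_const_nhds.sub hUn).norm.add (tendsto_const_nhds.sub hVn).norm)
      (.of_forall fun n => (hj.sub (hH n)).norm_le x)
  have hz : Tendsto (fun j => ‖U j - U₀‖ + ‖V j - V₀‖) l (𝓝 0) := by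
    simpa using (tendsto_iff_norm_sub_tendsto_zero.1 hU).add (tendsto_iff_norm_sub_tendsto_zero.1 hV)
  have hunif : TendstoUniformly u d l := by
    rw [Metric.tendstoUniformly_iff]
    intro ε hε
    filter_upwards [hbd, hz.eventually (gt_mem_nhds hε)] with j h1 h2 x
    rw [dist_comm, dist_eq_norm]
    exact (h1 x).trans_lt h2
  refine ⟨d, ⟨hunif.continuous (h.mono fun j hj => hj.cont).frequently, ?_,
    IsWeakDeriv.of_tendsto (h.mono fun j hj => hj.weak) hU hV⟩, fun x => hunif.tendsto_at x⟩
  obtain ⟨ns, hmono, hns⟩ := (tendstoInMeasure_of_tendsto_Lp hUn).exists_seq_tendsto_ae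
  filter_upwards [hns, ae_all_iff.2 fun n => (hH n).ae] with x h1 h2
  refine tendsto_nhds_unique (((hd x).comp hmono.tendsto_atTop)) (h1.congr fun n => ?_)
  exact (h2 _).symm

/-- The function `u` belongs to `C(J; H¹(ℝ))` and is continuous in the space variable. -/
def IsC0H1 (J : Set ℝ) (u : ℝ → ℝ → ℂ) : Prop :=
  ∃ U V : ℝ → LTwo, ContinuousOn U J ∧ ContinuousOn V J ∧
    ∀ t ∈ J, H1At (fun x => u x t) (U t) (V t)

theorem IsC1H1.isC0H1 {J : Set ℝ} {u : ℝ → ℝ → ℂ} (h : IsC1H1 J u)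
    (hc : ∀ t ∈ J, Continuous fun x => u x t) : IsC0H1 J u := by
  obtain ⟨U, V, hU, hV, hUV⟩ := h
  exact ⟨U, V, hU.continuousOn, hV.continuousOn, fun t ht => ⟨hc t ht, (hUV t ht).1, (hUV t ht).2⟩⟩

/-- Difference quotients in time converge in L² together with their weak derivatives, hence at every
point; the L²-valued derivative is thus represented by the classical partial derivative. -/
theorem IsC1H1.exists_deriv {J : Set ℝ} (hJ : IsOpen J) {u : ℝ → ℝ → ℂ} (h : IsC1H1 J u)
    (hc : ∀ t ∈ J, Continuous fun x => u x t) :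
    IsC0H1 J (dTime u) ∧ ∀ t ∈ J, ∀ x, HasDerivAt (u x) (dTime u x t) t := by
  obtain ⟨U, V, hU, hV, hUV⟩ := h
  have hH : ∀ t ∈ J, H1At (fun x => u x t) (U t) (V t) :=
    fun t ht => ⟨hc t ht, (hUV t ht).1, (hUV t ht).2⟩
  have key : ∀ t ∈ J, ∃ d, H1At d (deriv U t) (deriv V t) ∧ ∀ x, HasDerivAt (u x) (d x) t := by
    intro t ht
    have hJt := hJ.mem_nhds ht
    have hUd := ((hU.contDiffAt hJt).differentiableAt one_ne_zero).hasDerivAt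
    have hVd := ((hV.contDiffAt hJt).differentiableAt one_ne_zero).hasDerivAt
    obtain ⟨d, hd, hd'⟩ := H1At.exists_of_tendsto (l := 𝓝[≠] t)
      (u := fun s x => (s - t)⁻¹ • (u x s - u x t)) (U := slope U t) (V := slope V t) (by
        filter_upwards [nhdsWithin_le_nhds hJt] with s hs
        rw [slope_def_module, slope_def_module]
        exact ((hH s hs).sub (hH t ht)).const_smul _)
      (hasDerivAt_iff_tendsto_slope.1 hUd) (hasDerivAt_iff_tendsto_slope.1 hVd)
    refine ⟨d, hd, fun x => hasDerivAt_iff_tendsto_slope.2 ?_⟩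
    exact (hd' x).congr fun s => by rw [slope_def_module]
  have hdT : ∀ t ∈ J, H1At (fun x => dTime u x t) (deriv U t) (deriv V t) ∧
      ∀ x, HasDerivAt (u x) (dTime u x t) t := by
    intro t ht
    obtain ⟨d, h1, h2⟩ := key t ht
    have : (fun x => dTime u x t) = d := funext fun x => (h2 x).deriv
    refine ⟨by rw [this]; exact h1, fun x => ?_⟩
    rw [show dTime u x t = d x from congrFun this x]
    exact h2 x
  refine ⟨⟨deriv U, deriv V, ?_, ?_, fun t ht => (hdT t ht).1⟩, fun t ht => (hdT t ht).2⟩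
  · exact hU.continuousOn_deriv_of_isOpen hJ le_rfl
  · exact hV.continuousOn_deriv_of_isOpen hJ le_rfl

theorem IsC0H1.continuous {J : Set ℝ} {u : ℝ → ℝ → ℂ} (h : IsC0H1 J u) {t : ℝ} (ht : t ∈ J) :
    Continuous fun x => u x t := by
  obtain ⟨U, V, -, -, hUV⟩ := h
  exact (hUV t ht).cont

theorem IsC0H1.exists_localMod {J : Set ℝ} {u : ℝ → ℝ → ℂ} (h : IsC0H1 J u) {t : ℝ}
    (ht : t ∈ J) : ∃ N, LocalMod (fun x => u x t) N := by
  obtain ⟨U, V, -, -, hUV⟩ := h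
  exact (hUV t ht).exists_localMod

theorem IsC0H1.exists_hold {J : Set ℝ} (hJ : IsOpen J) {u : ℝ → ℝ → ℂ} (h : IsC0H1 J u) {t : ℝ}
    (ht : t ∈ J) : ∃ D, ∀ᶠ s in 𝓝 t, Hold D (fun x => u x s) ∧ SqInt D (fun x => u x s) := by
  obtain ⟨U, V, hU, hV, hUV⟩ := h
  have hJt := hJ.mem_nhds ht
  have hc : ContinuousAt (fun s => ‖U s‖ + ‖V s‖) t :=
    (hU.continuousAt hJt).norm.add (hV.continuousAt hJt).norm
  refine ⟨‖U t‖ + ‖V t‖ + 1, ?_⟩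
  filter_upwards [hJt, hc.eventually (gt_mem_nhds (lt_add_one _))] with s hs h2
  exact ⟨(hUV s hs).hold.mono h2.le, (hUV s hs).sqInt.mono (by linarith [norm_nonneg (V s)])⟩

theorem IsC0H1.eventually_norm_sub_lt {J : Set ℝ} (hJ : IsOpen J) {u : ℝ → ℝ → ℂ}
    (h : IsC0H1 J u) {t : ℝ} (ht : t ∈ J) {ε : ℝ} (hε : 0 < ε) :
    ∀ᶠ s in 𝓝 t, ∀ x, ‖u x s - u x t‖ < ε := by
  obtain ⟨U, V, hU, hV, hUV⟩ := h
  have hJt := hJ.mem_nhds ht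
  have hc : ContinuousAt (fun s => ‖U s - U t‖ + ‖V s - V t‖) t :=
    ((hU.continuousAt hJt).sub continuousAt_const).norm.add
      ((hV.continuousAt hJt).sub continuousAt_const).norm
  filter_upwards [hJt, hc.eventually (gt_mem_nhds (by simpa using hε))] with s hs h2 x
  exact (((hUV s hs).sub (hUV t ht)).norm_le x).trans_lt h2

theorem IsC0H1.continuousAt {J : Set ℝ} (hJ : IsOpen J) {u : ℝ → ℝ → ℂ}
    (h : IsC0H1 J u) {t : ℝ} (ht : t ∈ J) (x : ℝ) :
    ContinuousAt (fun p : ℝ × ℝ => u p.1 p.2) (x, t) := by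
  rw [Metric.continuousAt_iff']
  intro ε hε
  have h1 := h.eventually_norm_sub_lt hJ ht (half_pos hε)
  have h2 := Metric.continuousAt_iff'.1 ((h.continuous ht).continuousAt (x := x)) (ε / 2)
    (half_pos hε)
  rw [nhds_prod_eq]
  filter_upwards [h2.prod_mk h1] with p hp
  have e1 := hp.1
  have e2 := hp.2 p.1
  rw [← dist_eq_norm] at e2
  exact (dist_triangle _ (u p.1 t) _).trans_lt (by linarith)

/-! ### Flatness at infinity and the chord-arc property -/

/-- If ‖w x‖ ≥ ε, the Hölder bound keeps ‖w‖ ≥ ε/2 on the interval of radius δ about x, which uses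
up an amount 2δ(ε/2)² of the integral of ‖w‖². Far out that much is not available. -/
theorem Hold.exists_norm_lt {D : ℝ} {w : ℝ → ℂ} (hw : Hold D w) (h2 : MemLp w 2 volume) {ε : ℝ}
    (hε : 0 < ε) : ∃ M, ∀ x, M < |x| → ‖w x‖ < ε := by
  have hD := hw.nonneg
  set δ : ℝ := (ε / (2 * (D + 1))) ^ 2 with hδ
  have hδ0 : 0 < δ := by positivity
  have hi : Integrable fun t => ‖w t‖ ^ 2 := (memLp_two_iff_integrable_sq_norm h2.1).1 h2
  have hlim : Tendsto (fun x => ∫ t, (Icc (x - δ) (x + δ)).indicator (fun t => ‖w t‖ ^ 2) t)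
      (comap (fun x : ℝ => |x|) atTop) (𝓝 (∫ t : ℝ, (0 : ℝ))) := by
    refine tendsto_integral_filter_of_dominated_convergence (fun t => ‖w t‖ ^ 2)
      (.of_forall fun x => (hi.indicator measurableSet_Icc).1)
      (.of_forall fun x => .of_forall fun t => ?_) hi (.of_forall fun t => ?_)
    · refine (norm_indicator_le_norm_self _ _).trans (le_of_eq ?_)
      rw [Real.norm_of_nonneg (by positivity)]
    · refine tendsto_const_nhds.congr' ?_
      filter_upwards [preimage_mem_comap (Ioi_mem_atTop (|t| + δ))] with x hx
      rw [mem_preimage, mem_Ioi] at hx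
      rw [indicator_of_notMem]
      rintro ⟨h1, h2⟩
      have : |x| ≤ |t| + δ := by
        have := abs_sub_abs_le_abs_sub x t
        have : |x - t| ≤ δ := abs_le.2 ⟨by linarith, by linarith⟩
        linarith
      linarith
  rw [integral_zero] at hlim
  have hev := hlim.eventually (gt_mem_nhds (show 0 < 2 * δ * (ε / 2) ^ 2 by positivity))
  rw [eventually_comap] at hev
  obtain ⟨M, hM⟩ := eventually_atTop.1 hev
  refine ⟨M, fun x hx => ?_⟩
  have h1 := hM |x| hx.le x rfl
  by_contra! hcon
  refine h1.not_ge ?_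
  rw [integral_indicator measurableSet_Icc]
  have hle : ∀ t ∈ Icc (x - δ) (x + δ), (ε / 2) ^ 2 ≤ ‖w t‖ ^ 2 := by
    intro t ht
    have h3 := hw.holder x t
    have h4 : √|x - t| ≤ ε / (2 * (D + 1)) := by
      rw [Real.sqrt_le_left (by positivity)]
      exact abs_le.2 ⟨by linarith [ht.2], by linarith [ht.1]⟩
    have h5 : D * √|x - t| ≤ ε / 2 := by
      refine (mul_le_mul_of_nonneg_left h4 hD).trans ?_
      rw [mul_div_assoc', div_le_div_iff₀ (by positivity) (by norm_num)]
      nlinarith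
    have h6 := norm_sub_norm_le (w x) (w t)
    gcongr
    linarith
  have := setIntegral_mono_on (μ := volume) (f := fun _ => (ε / 2) ^ 2) (g := fun t => ‖w t‖ ^ 2)
    (by simp) hi.integrableOn measurableSet_Icc hle
  rw [setIntegral_const, smul_eq_mul, Measure.real, Real.volume_Icc, ENNReal.toReal_ofReal (by linarith)] at this
  linarith

theorem norm_avg_le_div_sqrt {w : ℝ → ℂ} (hc : Continuous w) (h2 : MemLp w 2 volume) :
    ∃ E, 0 ≤ E ∧ ∀ x y, x ≠ y → ‖avg w x y‖ ≤ E / √|x - y| := by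
  set W : LTwo := h2.toLp w
  refine ⟨‖W‖, norm_nonneg _, fun x y hxy => ?_⟩
  have h0 : 0 < |x - y| := abs_pos.2 (sub_ne_zero.2 hxy)
  have hd : ∀ x, HasDerivAt (fun x => ∫ t in (0 : ℝ)..x, w t) (w x) x := fun x =>
    intervalIntegral.integral_hasDerivAt_right (hc.intervalIntegrable _ _)
      (hc.stronglyMeasurableAtFilter _ _) hc.continuousAt
  rw [avg_eq_div hd hc hxy, intervalIntegral.integral_interval_sub_left
    (hc.intervalIntegrable _ _) (hc.intervalIntegrable _ _), norm_div, ← Complex.ofReal_sub,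
    Complex.norm_real, Real.norm_eq_abs]
  have h1 := intervalIntegral.norm_integral_le_integral_norm_uIoc (f := w) (a := y) (b := x)
    (μ := volume)
  have h3 : ∫ t in uIoc y x, ‖w t‖ = ∫ t in uIoc y x, ‖W t‖ :=
    integral_congr_ae (ae_restrict_of_ae (h2.coeFn_toLp.mono fun t ht => by simp only [W, ht]))
  have h4 := norm_integral_le_sqrt W y x
  have h5 : 0 < √|x - y| := Real.sqrt_pos.2 h0
  have h6 := Real.mul_self_sqrt h0.le
  rw [div_le_div_iff₀ h0 h5]
  refine (mul_le_mul_of_nonneg_right ((h1.trans h3.le).trans h4) h5.le).trans (le_of_eq ?_)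
  rw [mul_right_comm, h6, mul_comm]

theorem avg_sub {v w : ℝ → ℂ} (hv : Continuous v) (hw : Continuous w) (x y : ℝ) :
    avg v x y - avg w x y = avg (fun t => v t - w t) x y := by
  simp only [avg]
  rw [← intervalIntegral.integral_sub] <;> exact Continuous.intervalIntegrable (by fun_prop) _ _

theorem norm_avg_le_of_forall {w : ℝ → ℂ} {x y ε : ℝ}
    (h : ∀ θ ∈ Icc (0 : ℝ) 1, ‖w (x + θ * (y - x))‖ ≤ ε) : ‖avg w x y‖ ≤ ε := by
  have := intervalIntegral.norm_integral_le_of_norm_le_const (a := 0) (b := 1) (C := ε)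
    (f := fun θ : ℝ => w (x + θ * (y - x))) (fun θ hθ => h θ (by
      rw [uIoc_of_le zero_le_one] at hθ; exact ⟨hθ.1.le, hθ.2⟩))
  simpa [avg] using this

/-- Over a segment of length at least L the average of v − 1 is small by Cauchy–Schwarz. A shorter
segment with an endpoint beyond M + L lies wholly beyond M, where v − 1 itself is small. -/
theorem flat_of_sub_one {v : ℝ → ℂ} {D : ℝ} (hv : Hold D fun x => v x - 1)
    (h2 : MemLp (fun x => v x - 1) 2 volume) : Flat v := by
  intro ε hε
  have hvc : Continuous v := by simpa using hv.continuous.add_const 1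
  obtain ⟨E, hE, havg⟩ := norm_avg_le_div_sqrt hv.continuous h2
  obtain ⟨M, hM⟩ := hv.exists_norm_lt h2 (half_pos hε)
  set L : ℝ := ((E + 1) / (ε / 2)) ^ 2 with hL
  have hL0 : 0 < L := by positivity
  refine ⟨M + L, fun x y hxy => ?_⟩
  have hone : avg (fun _ => (1 : ℂ)) x y = 1 := by simp [avg]
  have e1 := avg_sub hvc continuous_const x y (w := fun _ => 1)
  rw [hone] at e1
  rw [e1]
  refine lt_of_le_of_lt ?_ (half_lt_self hε)
  rcases le_or_gt L |x - y| with h | h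
  · have hne : x ≠ y := by
      rintro rfl
      rw [sub_self, abs_zero] at h
      linarith
    refine (havg x y hne).trans ?_
    have h3 : (E + 1) / (ε / 2) ≤ √|x - y| := Real.le_sqrt_of_sq_le h
    have h4 : 0 < √|x - y| := Real.sqrt_pos.2 (hL0.trans_le h)
    rw [div_le_iff₀ (half_pos hε)] at h3
    rw [div_le_iff₀ h4]
    linarith
  · refine norm_avg_le_of_forall fun θ hθ => (hM _ ?_).le
    have h5 : |θ * (y - x)| ≤ |x - y| := by
      rw [abs_mul, abs_of_nonneg hθ.1, abs_sub_comm y x]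
      exact mul_le_of_le_one_left (abs_nonneg _) hθ.2
    have h6 : |(1 - θ) * (x - y)| ≤ |x - y| := by
      rw [abs_mul, abs_of_nonneg (by linarith [hθ.2] : (0 : ℝ) ≤ 1 - θ)]
      exact mul_le_of_le_one_left (abs_nonneg _) (by linarith [hθ.1])
    rcases hxy with h' | h'
    · have := abs_sub_abs_le_abs_sub x (-(θ * (y - x)))
      rw [abs_neg, sub_neg_eq_add] at this
      linarith
    · have := abs_sub_abs_le_abs_sub y (-((1 - θ) * (x - y)))
      rw [abs_neg, sub_neg_eq_add, show y + (1 - θ) * (x - y) = x + θ * (y - x) by ring] at this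
      linarith

/-- Flatness gives the lower bound 1/2 outside a square; on the compact square the continuous
average has no zero, by injectivity off the diagonal and regularity on it. -/
theorem exists_le_norm_avg {z v : ℝ → ℂ} (hz : ∀ x, HasDerivAt z (v x) x) (hv : Continuous v)
    (hf : Flat v) (hinj : Function.Injective z) (hne : ∀ x, v x ≠ 0) :
    ∃ c, 0 < c ∧ ∀ x y, c ≤ ‖avg v x y‖ := by
  obtain ⟨M, hM⟩ := hf (1 / 2) (by norm_num)
  have hav : ∀ x y, avg v x y ≠ 0 := by
    intro x y
    rcases eq_or_ne x y with rfl | hxy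
    · rw [avg_self]; exact hne x
    · intro h0
      have := sub_eq_avg hz hv x y
      rw [h0, mul_zero, sub_eq_zero] at this
      exact hxy (hinj this)
  have hK : IsCompact (Icc (-|M|) |M| ×ˢ Icc (-|M|) |M|) := isCompact_Icc.prod isCompact_Icc
  obtain ⟨p, -, hp⟩ := hK.exists_isMinOn ⟨(0, 0), by simp⟩
    ((continuous_avg hv).norm.continuousOn (s := Icc (-|M|) |M| ×ˢ Icc (-|M|) |M|))
  refine ⟨min (1 / 2) ‖avg v p.1 p.2‖, lt_min (by norm_num) (norm_pos_iff.2 (hav _ _)), ?_⟩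
  intro x y
  by_cases h : M < |x| ∨ M < |y|
  · refine (min_le_left _ _).trans ?_
    have h1 := hM x y h
    have h2 := norm_sub_norm_le 1 (avg v x y)
    rw [norm_one, norm_sub_rev] at h2
    linarith
  · push Not at h
    refine (min_le_right _ _).trans ?_
    exact hp (a := (x, y)) ⟨abs_le.1 (h.1.trans (le_abs_self M)), abs_le.1 (h.2.trans (le_abs_self M))⟩

/-! ### Real and imaginary parts -/

theorem Hold.im {D : ℝ} {w : ℝ → ℂ} (h : Hold D w) : Hold D fun x => ((w x).im : ℂ) where
  bound x := by
    rw [Complex.norm_real]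
    exact (Complex.abs_im_le_norm _).trans (h.bound x)
  holder x y := by
    rw [← Complex.ofReal_sub, ← Complex.sub_im, Complex.norm_real]
    exact (Complex.abs_im_le_norm _).trans (h.holder x y)

theorem SqInt.im {D : ℝ} {w : ℝ → ℂ} (h : SqInt D w) : SqInt D fun x => ((w x).im : ℂ) := by
  have := h.of_norm_le (A := 1) (g := fun x => ((w x).im : ℂ)) ((Complex.continuous_ofReal.comp
    Complex.continuous_im).comp_aestronglyMeasurable h.memLp.1) (fun x => by
      rw [one_mul, Complex.norm_real]; exact Complex.abs_im_le_norm _) zero_le_one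
  rwa [one_mul] at this

theorem hasDerivAt_im {u : ℝ → ℂ} {u' : ℂ} {x : ℝ} (h : HasDerivAt u u' x) :
    HasDerivAt (fun y => ((u y).im : ℂ)) ((u'.im : ℝ) : ℂ) x := by
  have h1 : HasDerivAt (fun y => (u y).im) u'.im x :=
    (Complex.imCLM.hasFDerivAt.comp_hasDerivAt x h)
  exact h1.ofReal_comp

theorem hasDerivAt_conj {u : ℝ → ℂ} {u' : ℂ} {x : ℝ} (h : HasDerivAt u u' x) :
    HasDerivAt (fun y => starRingEnd ℂ (u y)) (starRingEnd ℂ u') x :=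
  (Complex.conjCLE.toContinuousLinearMap.hasFDerivAt.comp_hasDerivAt x h)

/-! ### Partial derivatives -/

section Partial
variable {F : Type*} [NormedAddCommGroup F] [NormedSpace ℝ F] {f : ℝ → ℝ → F}

theorem hasDerivAt_space_of_hasFDerivAt {f' : ℝ × ℝ →L[ℝ] F} {x t : ℝ}
    (h : HasFDerivAt (fun p : ℝ × ℝ => f p.1 p.2) f' (x, t)) :
    HasDerivAt (fun x => f x t) (f' (1, 0)) x :=
  HasFDerivAt.comp_hasDerivAt (f := fun x : ℝ => (x, t)) x h
    ((hasDerivAt_id x).prodMk (hasDerivAt_const x t))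

theorem hasDerivAt_time_of_hasFDerivAt {f' : ℝ × ℝ →L[ℝ] F} {x t : ℝ}
    (h : HasFDerivAt (fun p : ℝ × ℝ => f p.1 p.2) f' (x, t)) :
    HasDerivAt (f x) (f' (0, 1)) t :=
  HasFDerivAt.comp_hasDerivAt (f := fun t : ℝ => (x, t)) t h
    ((hasDerivAt_const t x).prodMk (hasDerivAt_id t))

end Partial

theorem eventually_snd_mem {T x t : ℝ} (ht : t ∈ Ioo 0 T) :
    ∀ᶠ p : ℝ × ℝ in 𝓝 (x, t), p.2 ∈ Ioo 0 T :=
  continuous_snd.continuousAt.eventually (Ioo_mem_nhds ht.1 ht.2)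

section Smooth
variable {F : Type*} [NormedAddCommGroup F] [NormedSpace ℝ F] {f : ℝ → ℝ → F} {T : ℝ}

theorem contDiffAt_of_strip
    (hf : ContDiffOn ℝ 1 (fun p : ℝ × ℝ => f p.1 p.2) (univ ×ˢ Ioo 0 T)) {x t : ℝ}
    (ht : t ∈ Ioo 0 T) : ContDiffAt ℝ 1 (fun p : ℝ × ℝ => f p.1 p.2) (x, t) :=
  hf.contDiffAt ((isOpen_univ.prod isOpen_Ioo).mem_nhds ⟨mem_univ _, ht⟩)

theorem dSpace_eq_of_strip
    (hf : ContDiffOn ℝ 1 (fun p : ℝ × ℝ => f p.1 p.2) (univ ×ˢ Ioo 0 T)) {x t : ℝ}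
    (ht : t ∈ Ioo 0 T) : dSpace f x t = fderiv ℝ (fun p : ℝ × ℝ => f p.1 p.2) (x, t) (1, 0) :=
  (hasDerivAt_space_of_hasFDerivAt
    ((contDiffAt_of_strip hf ht).differentiableAt one_ne_zero).hasFDerivAt).deriv

theorem dTime_eq_of_strip
    (hf : ContDiffOn ℝ 1 (fun p : ℝ × ℝ => f p.1 p.2) (univ ×ˢ Ioo 0 T)) {x t : ℝ}
    (ht : t ∈ Ioo 0 T) : dTime f x t = fderiv ℝ (fun p : ℝ × ℝ => f p.1 p.2) (x, t) (0, 1) :=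
  (hasDerivAt_time_of_hasFDerivAt
    ((contDiffAt_of_strip hf ht).differentiableAt one_ne_zero).hasFDerivAt).deriv

theorem hasDerivAt_dSpace_of_strip
    (hf : ContDiffOn ℝ 1 (fun p : ℝ × ℝ => f p.1 p.2) (univ ×ˢ Ioo 0 T)) {x t : ℝ}
    (ht : t ∈ Ioo 0 T) : HasDerivAt (fun x => f x t) (dSpace f x t) x := by
  rw [dSpace_eq_of_strip hf ht]
  exact hasDerivAt_space_of_hasFDerivAt
    ((contDiffAt_of_strip hf ht).differentiableAt one_ne_zero).hasFDerivAt

theorem hasDerivAt_dTime_of_strip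
    (hf : ContDiffOn ℝ 1 (fun p : ℝ × ℝ => f p.1 p.2) (univ ×ˢ Ioo 0 T)) {x t : ℝ}
    (ht : t ∈ Ioo 0 T) : HasDerivAt (f x) (dTime f x t) t := by
  rw [dTime_eq_of_strip hf ht]
  exact hasDerivAt_time_of_hasFDerivAt
    ((contDiffAt_of_strip hf ht).differentiableAt one_ne_zero).hasFDerivAt

theorem continuousAt_fderiv_of_strip
    (hf : ContDiffOn ℝ 1 (fun p : ℝ × ℝ => f p.1 p.2) (univ ×ˢ Ioo 0 T)) {x t : ℝ}
    (ht : t ∈ Ioo 0 T) : ContinuousAt (fderiv ℝ (fun p : ℝ × ℝ => f p.1 p.2)) (x, t) :=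
  (contDiffAt_of_strip hf ht).continuousAt_fderiv one_ne_zero

theorem continuousAt_dSpace_of_strip
    (hf : ContDiffOn ℝ 1 (fun p : ℝ × ℝ => f p.1 p.2) (univ ×ˢ Ioo 0 T)) {x t : ℝ}
    (ht : t ∈ Ioo 0 T) : ContinuousAt (fun p : ℝ × ℝ => dSpace f p.1 p.2) (x, t) := by
  refine ((continuousAt_fderiv_of_strip hf ht).clm_apply
    (continuousAt_const (y := ((1 : ℝ), (0 : ℝ))))).congr ?_
  filter_upwards [eventually_snd_mem ht] with p hp
  exact (dSpace_eq_of_strip hf hp).symm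

theorem continuousAt_dTime_of_strip
    (hf : ContDiffOn ℝ 1 (fun p : ℝ × ℝ => f p.1 p.2) (univ ×ˢ Ioo 0 T)) {x t : ℝ}
    (ht : t ∈ Ioo 0 T) : ContinuousAt (fun p : ℝ × ℝ => dTime f p.1 p.2) (x, t) := by
  refine ((continuousAt_fderiv_of_strip hf ht).clm_apply
    (continuousAt_const (y := ((0 : ℝ), (1 : ℝ))))).congr ?_
  filter_upwards [eventually_snd_mem ht] with p hp
  exact (dTime_eq_of_strip hf hp).symm

end Smooth

theorem continuous_space_of_continuousAt {F : Type*} [TopologicalSpace F] {f : ℝ → ℝ → F} {t : ℝ}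
    (h : ∀ x, ContinuousAt (fun p : ℝ × ℝ => f p.1 p.2) (x, t)) : Continuous fun x => f x t :=
  continuous_iff_continuousAt.2 fun x =>
    ContinuousAt.comp (f := fun x : ℝ => (x, t)) (h x) (by fun_prop)

/-- A function with a partial derivative at a point in the first variable, and with a continuous
partial derivative near the point in the second variable, is differentiable at the point. -/
theorem differentiableAt_of_partial {f f' : ℝ → ℝ → ℂ} {x t : ℝ} {d : ℂ}
    (h1 : HasDerivAt (fun y => f y t) d x)
    (h2 : ∀ᶠ p : ℝ × ℝ in 𝓝 (x, t), HasDerivAt (f p.1) (f' p.1 p.2) p.2)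
    (hc : ContinuousAt (fun p : ℝ × ℝ => f' p.1 p.2) (x, t)) :
    DifferentiableAt ℝ (fun p : ℝ × ℝ => f p.1 p.2) (x, t) := by
  set L : ℝ × ℝ →L[ℝ] ℂ := (ContinuousLinearMap.fst ℝ ℝ ℝ).smulRight d +
    (ContinuousLinearMap.snd ℝ ℝ ℝ).smulRight (f' x t) with hL
  refine HasFDerivAt.differentiableAt (f' := L) ?_
  rw [hasFDerivAt_iff_isLittleO]
  have e1 : (fun p : ℝ × ℝ => f p.1 t - f x t - (p.1 - x) • d) =o[𝓝 (x, t)]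
      fun p => p - (x, t) := by
    have := (hasDerivAt_iff_isLittleO.1 h1).comp_tendsto
      (continuous_fst.tendsto ((x, t) : ℝ × ℝ))
    refine this.trans_isBigO (Asymptotics.IsBigO.of_bound 1 (.of_forall fun p => ?_))
    rw [one_mul]
    exact norm_fst_le (p - (x, t))
  have e2 : (fun p : ℝ × ℝ => f p.1 p.2 - f p.1 t - (p.2 - t) • f' x t) =o[𝓝 (x, t)]
      fun p => p - (x, t) := by
    rw [Asymptotics.isLittleO_iff]
    intro ε hε
    have h3 : ∀ᶠ p : ℝ × ℝ in 𝓝 (x, t), ‖f' p.1 p.2 - f' x t‖ ≤ ε := by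
      filter_upwards [Metric.continuousAt_iff'.1 hc ε hε] with p hp
      rw [dist_eq_norm] at hp
      exact hp.le
    obtain ⟨δ, hδ, hball⟩ := Metric.eventually_nhds_iff_ball.1 (h2.and h3)
    filter_upwards [Metric.ball_mem_nhds ((x, t) : ℝ × ℝ) hδ] with p hp
    rw [← ball_prod_same] at hp
    have hin : ∀ s ∈ Metric.ball t δ, (p.1, s) ∈ Metric.ball ((x, t) : ℝ × ℝ) δ := fun s hs => by
      rw [← ball_prod_same]; exact ⟨hp.1, hs⟩
    have hd : ∀ s ∈ Metric.ball t δ, HasDerivWithinAt (fun s => f p.1 s - s • f' x t)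
        (f' p.1 s - f' x t) (Metric.ball t δ) s := fun s hs => by
      have := ((hball _ (hin s hs)).1.sub ((hasDerivAt_id s).smul_const (f' x t)))
      rw [one_smul] at this
      exact this.hasDerivWithinAt
    have := (convex_ball t δ).norm_image_sub_le_of_norm_hasDerivWithin_le (C := ε) hd
      (fun s hs => (hball _ (hin s hs)).2) (Metric.mem_ball_self hδ) hp.2
    refine le_trans (le_of_eq ?_) (this.trans ?_)
    · congr 1
      rw [sub_smul]; abel
    · gcongr
      exact norm_snd_le (p - (x, t))
  refine (e1.add e2).congr_left fun p => ?_
  simp only [hL, add_apply, ContinuousLinearMap.smulRight_apply,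
    ContinuousLinearMap.coe_fst', ContinuousLinearMap.coe_snd', Prod.fst_sub, Prod.snd_sub]
  abel

/-! ### Functions in `Lᵖ` -/

/-- Hölder's inequality: 1/(1 + |x|) lies in the conjugate space exactly when the conjugate exponent
exceeds 1, that is, when p is finite. -/
theorem integrable_mul_inv_of_memLp {y : ℝ → ℂ} {p : ℝ≥0∞} (hp1 : 1 < p) (hp : p < ⊤)
    (hy : MemLp y p volume) (α : ℝ) :
    Integrable fun β => ‖y β‖ * (1 + |α - β|)⁻¹ := by
  have hr : 1 < p.toReal := by
    rw [← ENNReal.toReal_one]; exact (ENNReal.toReal_lt_toReal (by simp) hp.ne).2 hp1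
  have hc := Real.HolderConjugate.conjExponent hr
  set q := Real.conjExponent p.toReal
  have hq : 1 < q := hc.symm.lt
  have := hc.ennrealOfReal
  rw [ENNReal.ofReal_toReal hp.ne] at this
  have hb : MemLp (fun β : ℝ => (1 + |α - β|)⁻¹) (ENNReal.ofReal q) volume := by
    have hpos : ∀ β : ℝ, 0 < 1 + |α - β| := fun β => by positivity
    have hcont : Continuous fun β : ℝ => (1 + |α - β|)⁻¹ :=
      Continuous.inv₀ (by fun_prop) fun β => (hpos β).ne'
    rw [← integrable_norm_rpow_iff hcont.aestronglyMeasurable (by simpa using by linarith)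
      ENNReal.ofReal_ne_top, ENNReal.toReal_ofReal (by linarith)]
    have h1 := (integrable_one_add_norm (E := ℝ) (μ := volume) (r := q) (by simpa using hq)).comp_sub_left α
    refine h1.congr (.of_forall fun β => ?_)
    simp only [Real.norm_eq_abs]
    rw [abs_of_pos (inv_pos.2 (hpos β)), Real.rpow_neg (hpos β).le, Real.inv_rpow (hpos β).le]
  exact hy.norm.integrable_mul hb

/-- A bounded slope keeps y within D of y(x) on a unit interval, whose measure 1 lets the Lᵖ norm
control the average. -/
theorem exists_norm_le_of_memLp {y y' : ℝ → ℂ} {D : ℝ} {p : ℝ≥0∞} (hp1 : 1 ≤ p)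
    (hy : MemLp y p volume) (hd : ∀ x, HasDerivAt y (y' x) x) (hD : ∀ x, ‖y' x‖ ≤ D) :
    ∃ E, ∀ x, ‖y x‖ ≤ E := by
  have hc : Continuous y := continuous_iff_continuousAt.2 fun x => (hd x).continuousAt
  have hD0 := (norm_nonneg _).trans (hD 0)
  refine ⟨(eLpNorm y p volume).toReal + D, fun x => ?_⟩
  have hle : ∀ u ∈ Icc x (x + 1), ‖y x‖ ≤ ‖y u‖ + D := by
    intro u hu
    have h1 := convex_univ.norm_image_sub_le_of_norm_hasDerivWithin_le (f := y)
      (fun x _ => (hd x).hasDerivWithinAt) (fun x _ => hD x) (mem_univ u) (mem_univ x)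
    have h2 : ‖x - u‖ ≤ 1 := by
      rw [Real.norm_eq_abs, abs_le]; constructor <;> linarith [hu.1, hu.2]
    have h3 := norm_le_norm_add_norm_sub' (y x) (y u)
    nlinarith
  have h1 := intervalIntegral.integral_mono_on (a := x) (b := x + 1) (μ := volume)
    (f := fun _ => ‖y x‖) (g := fun u => ‖y u‖ + D) (by linarith)
    (Continuous.intervalIntegrable (by fun_prop) _ _)
    (Continuous.intervalIntegrable (by fun_prop) _ _) hle
  rw [intervalIntegral.integral_add (Continuous.intervalIntegrable (by fun_prop) _ _)
    (Continuous.intervalIntegrable (by fun_prop) _ _)] at h1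
  simp only [intervalIntegral.integral_const, add_sub_cancel_left, one_smul] at h1
  rw [intervalIntegral.integral_of_le (by linarith)] at h1
  have hprob : IsProbabilityMeasure (volume.restrict (Ioc x (x + 1))) := ⟨by
    rw [Measure.restrict_apply_univ, Real.volume_Ioc]; simp⟩
  have h2 : ∫ u in Ioc x (x + 1), ‖y u‖ ≤ (eLpNorm y p volume).toReal := by
    rw [integral_norm_eq_lintegral_enorm hc.aestronglyMeasurable, ← eLpNorm_one_eq_lintegral_enorm]
    exact ENNReal.toReal_mono hy.2.ne ((eLpNorm_le_eLpNorm_of_exponent_le hp1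
      hc.aestronglyMeasurable).trans (eLpNorm_mono_measure y Measure.restrict_le_self))
  linarith

theorem Hold.of_hasDerivAt {y y' : ℝ → ℂ} {D : ℝ} (hd : ∀ x, HasDerivAt y (y' x) x)
    (hb : ∀ x, ‖y x‖ ≤ D) (hb' : ∀ x, ‖y' x‖ ≤ D) : Hold (2 * D) y where
  bound x := (hb x).trans (by linarith [(norm_nonneg _).trans (hb x)])
  holder x u := by
    have hD0 := (norm_nonneg _).trans (hb 0)
    have h1 := convex_univ.norm_image_sub_le_of_norm_hasDerivWithin_le (f := y)
      (fun x _ => (hd x).hasDerivWithinAt) (fun x _ => hb' x) (mem_univ u) (mem_univ x)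
    rw [Real.norm_eq_abs] at h1
    have h2 := (norm_sub_le (y x) (y u)).trans (add_le_add (hb x) (hb u))
    have h3 := Real.mul_self_sqrt (abs_nonneg (x - u))
    have h4 := Real.sqrt_nonneg |x - u|
    rcases le_total 1 √|x - u| with h | h
    · nlinarith
    · have : |x - u| ≤ √|x - u| := by nlinarith
      nlinarith

/-! ### Regularity of solutions -/

section Solution
variable {T : ℝ} {z : ℝ → ℝ → ℂ} {a : ℝ → ℝ → ℝ}

theorem IsSolution.hasDerivAt_space (h : IsSolution T z a) {t : ℝ} (ht : t ∈ Ioo 0 T) (x : ℝ) :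
    HasDerivAt (fun x => z x t) (dSpace z x t) x := hasDerivAt_dSpace_of_strip h.contDiffOn ht

theorem IsSolution.hasDerivAt_time (h : IsSolution T z a) {t : ℝ} (ht : t ∈ Ioo 0 T) (x : ℝ) :
    HasDerivAt (z x) (dTime z x t) t := hasDerivAt_dTime_of_strip h.contDiffOn ht

theorem IsSolution.continuousAt (h : IsSolution T z a) {t : ℝ} (ht : t ∈ Ioo 0 T) (x : ℝ) :
    ContinuousAt (fun p : ℝ × ℝ => z p.1 p.2) (x, t) := (contDiffAt_of_strip h.contDiffOn ht).continuousAt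

theorem IsSolution.isC0H1_velocity (h : IsSolution T z a) : IsC0H1 (Ioo 0 T) (dTime z) :=
  h.velocity.isC0H1 fun _ ht =>
    continuous_space_of_continuousAt fun _ => continuousAt_dTime_of_strip h.contDiffOn ht

theorem IsSolution.exists_deriv_velocity (h : IsSolution T z a) :
    IsC0H1 (Ioo 0 T) (dTime (dTime z)) ∧
      ∀ t ∈ Ioo 0 T, ∀ x, HasDerivAt (dTime z x) (dTime (dTime z) x t) t :=
  h.velocity.exists_deriv isOpen_Ioo fun _ ht =>
    continuous_space_of_continuousAt fun _ => continuousAt_dTime_of_strip h.contDiffOn ht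

theorem IsSolution.continuous_dSpace (h : IsSolution T z a) {t : ℝ} (ht : t ∈ Ioo 0 T) :
    Continuous fun x => dSpace z x t :=
  continuous_space_of_continuousAt fun _ => continuousAt_dSpace_of_strip h.contDiffOn ht

theorem IsSolution.isC0H1_slope (h : IsSolution T z a) :
    IsC0H1 (Ioo 0 T) (fun α t => dSpace z α t - 1) :=
  h.slope.isC0H1 fun _ ht => (h.continuous_dSpace ht).sub continuous_const

theorem IsSolution.exists_deriv_slope (h : IsSolution T z a) :
    IsC0H1 (Ioo 0 T) (dTime (dSpace z)) ∧
      ∀ t ∈ Ioo 0 T, ∀ x, HasDerivAt (dSpace z x) (dTime (dSpace z) x t) t := by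
  have e : dTime (fun α t => dSpace z α t - 1) = dTime (dSpace z) := by
    funext x t
    exact deriv_sub_const (f := dSpace z x) 1
  have := h.slope.exists_deriv isOpen_Ioo fun _ ht =>
    (h.continuous_dSpace ht).sub continuous_const
  rw [e] at this
  refine ⟨this.1, fun t ht x => ?_⟩
  simpa using (this.2 t ht x).add_const 1

/-- As z is only C¹, symmetry of second derivatives is not at hand. The formula z(x) − z(0) = ∫₀ˣ
z_α is differentiated in time under the integral, and the resulting continuous integrand is the
space derivative of z_t. -/
theorem IsSolution.hasDerivAt_velocity_space (h : IsSolution T z a) {t : ℝ} (ht : t ∈ Ioo 0 T)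
    (x : ℝ) : HasDerivAt (fun x => dTime z x t) (dTime (dSpace z) x t) x := by
  obtain ⟨hW, hd⟩ := h.exists_deriv_slope
  have hWc := hW.continuous ht
  obtain ⟨D, hD⟩ := hW.exists_hold isOpen_Ioo ht
  have hs : {s | s ∈ Ioo 0 T ∧ Hold D fun x => dTime (dSpace z) x s} ∈ 𝓝 t := by
    filter_upwards [Ioo_mem_nhds ht.1 ht.2, hD] with s h1 h2 using ⟨h1, h2.1⟩
  have key : ∀ x, dTime z x t - dTime z 0 t = ∫ β in (0 : ℝ)..x, dTime (dSpace z) β t := by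
    intro x
    have h1 := (intervalIntegral.hasDerivAt_integral_of_dominated_loc_of_deriv_le (μ := volume)
      (a := 0) (b := x) (F := fun s β => dSpace z β s) (F' := fun s β => dTime (dSpace z) β s)
      (bound := fun _ => D) hs
      (by
        filter_upwards [Ioo_mem_nhds ht.1 ht.2] with s hs
        exact (h.continuous_dSpace hs).aestronglyMeasurable)
      ((h.continuous_dSpace ht).intervalIntegrable _ _) hWc.aestronglyMeasurable
      (.of_forall fun β _ s hs => hs.2.bound β) (by simp)
      (.of_forall fun β _ s hs => hd s hs.1 β)).2
    have h2 := (h.hasDerivAt_time ht x).sub (h.hasDerivAt_time ht 0)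
    refine h2.unique (h1.congr_of_eventuallyEq ?_)
    filter_upwards [Ioo_mem_nhds ht.1 ht.2] with s hs
    exact (intervalIntegral.integral_eq_sub_of_hasDerivAt (fun β _ => h.hasDerivAt_space hs β)
      ((h.continuous_dSpace hs).intervalIntegrable _ _)).symm
  have h3 := intervalIntegral.integral_hasDerivAt_right (hWc.intervalIntegrable 0 x)
    (hWc.stronglyMeasurableAtFilter _ _) hWc.continuousAt
  have h4 : (fun x => dTime z x t) = fun x =>
      (∫ β in (0 : ℝ)..x, dTime (dSpace z) β t) + dTime z 0 t := by
    funext x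
    rw [← key]; ring
  rw [h4]
  exact h3.add_const _

theorem IsSolution.flat (h : IsSolution T z a) {t : ℝ} (ht : t ∈ Ioo 0 T) :
    Flat fun x => dSpace z x t := by
  obtain ⟨D, hD⟩ := h.isC0H1_slope.exists_hold isOpen_Ioo ht
  exact flat_of_sub_one hD.self_of_nhds.1 hD.self_of_nhds.2.memLp

/-- Half of the constant at time t works at nearby times, since z_α, and with it every average,
changes by less than c/2 uniformly in space. -/
theorem IsSolution.exists_curve (h : IsSolution T z a) {t : ℝ} (ht : t ∈ Ioo 0 T) :
    ∃ c C, ∀ᶠ s in 𝓝 t, Curve c C (fun x => z x s) (fun x => dSpace z x s) := by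
  obtain ⟨c, hc, hcl⟩ := exists_le_norm_avg (h.hasDerivAt_space ht) (h.continuous_dSpace ht)
    (h.flat ht) (h.injective t ht) (h.regular t ht)
  obtain ⟨D, hD⟩ := h.isC0H1_slope.exists_hold isOpen_Ioo ht
  refine ⟨c / 2, D + ‖(1 : ℂ)‖, ?_⟩
  filter_upwards [hD, h.isC0H1_slope.eventually_norm_sub_lt isOpen_Ioo ht (half_pos hc),
    Ioo_mem_nhds ht.1 ht.2] with s h1 h2 hs
  have hH : Hold (D + ‖(1 : ℂ)‖) fun x => dSpace z x s := by
    simpa using h1.1.add (Hold.const 1)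
  refine ⟨half_pos hc, h.hasDerivAt_space hs, hH, fun x y => ?_⟩
  have h3 : ‖avg (fun t' => dSpace z t' t) x y - avg (fun t' => dSpace z t' s) x y‖ ≤ c / 2 := by
    rw [avg_sub (h.continuous_dSpace ht) (h.continuous_dSpace hs)]
    refine norm_avg_le_of_forall fun θ _ => ?_
    have := (h2 (x + θ * (y - x))).le
    rwa [norm_sub_rev, sub_sub_sub_cancel_right] at this
  have h4 := hcl x y
  have h5 := norm_le_norm_add_norm_sub' (avg (fun t' => dSpace z t' t) x y)
    (avg (fun t' => dSpace z t' s) x y)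
  rw [sub_eq_avg (h.hasDerivAt_space hs) (h.continuous_dSpace hs), norm_mul, ← Complex.ofReal_sub,
    Complex.norm_real, Real.norm_eq_abs, mul_comm]
  gcongr
  linarith

/-- Bounds, at the time `t`, for the interface and its derivatives. -/
structure Bounds (c C D : ℝ) (z : ℝ → ℝ → ℂ) (t : ℝ) : Prop where
  curve : Curve c C (fun x => z x t) (fun x => dSpace z x t)
  flat : Flat fun x => dSpace z x t
  hasDerivAt_time : ∀ x, HasDerivAt (z x) (dTime z x t) t
  vel : Hold D fun x => dTime z x t
  sqInt_vel : SqInt D fun x => dTime z x t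
  hasDerivAt_vel : ∀ x, HasDerivAt (fun x => dTime z x t) (dTime (dSpace z) x t) x
  hasDerivAt_vel_time : ∀ x, HasDerivAt (dTime z x) (dTime (dTime z) x t) t
  hasDerivAt_slope_time : ∀ x, HasDerivAt (dSpace z x) (dTime (dSpace z) x t) t
  velSpace : Hold D fun x => dTime (dSpace z) x t
  sqInt_velSpace : SqInt D fun x => dTime (dSpace z) x t
  acc : Hold D fun x => dTime (dTime z) x t
  sqInt_acc : SqInt D fun x => dTime (dTime z) x t
  height : Hold D fun x => ((z x t).im : ℂ)
  slope : Hold D fun x => ((dSpace z x t).im : ℂ)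
  sqInt_slope : SqInt D fun x => ((dSpace z x t).im : ℂ)

theorem Bounds.hasDerivAt_height {c C D t : ℝ} (h : Bounds c C D z t) (x : ℝ) :
    HasDerivAt (fun x => ((z x t).im : ℂ)) ((dSpace z x t).im : ℂ) x :=
  hasDerivAt_im (h.curve.hasDerivAt x)

/-- The exponent p may depend on the time and its norms carry no uniformity, so the height is
bounded at the single time t and the bound is propagated by the bounded velocity. -/
theorem IsSolution.exists_height (h : IsSolution T z a) {t : ℝ} (ht : t ∈ Ioo 0 T) :
    ∃ E, ∀ᶠ s in 𝓝 t, ∀ x, ‖((z x s).im : ℂ)‖ ≤ E := by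
  obtain ⟨c, C, hC⟩ := h.exists_curve ht
  obtain ⟨p, hp1, hp, hy⟩ := h.height t ht
  obtain ⟨E, hE⟩ := exists_norm_le_of_memLp hp1.le (y := fun x => ((z x t).im : ℂ))
    hy.ofReal (fun x => hasDerivAt_im (h.hasDerivAt_space ht x)) hC.self_of_nhds.hold.im.bound
  obtain ⟨D, hD⟩ := h.isC0H1_velocity.exists_hold isOpen_Ioo ht
  obtain ⟨δ, hδ, hball⟩ := Metric.eventually_nhds_iff_ball.1 (hD.and (Ioo_mem_nhds ht.1 ht.2))
  refine ⟨E + D * δ, ?_⟩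
  filter_upwards [Metric.ball_mem_nhds t hδ] with s hs x
  have h1 := (convex_ball t δ).norm_image_sub_le_of_norm_hasDerivWithin_le (f := z x) (C := D)
    (fun τ hτ => (h.hasDerivAt_time (hball τ hτ).2 x).hasDerivWithinAt)
    (fun τ hτ => (hball τ hτ).1.1.bound x) (Metric.mem_ball_self hδ) hs
  have h2 : ‖((z x s).im : ℂ) - ((z x t).im : ℂ)‖ ≤ ‖z x s - z x t‖ := by
    rw [← Complex.ofReal_sub, ← Complex.sub_im, Complex.norm_real]
    exact Complex.abs_im_le_norm _
  have h3 : ‖s - t‖ ≤ δ := by rw [← dist_eq_norm]; exact (Metric.mem_ball.1 hs).le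
  have h4 := norm_le_norm_add_norm_sub' ((z x s).im : ℂ) ((z x t).im : ℂ)
  have h5 := hD.self_of_nhds.1.nonneg
  have h6 := hE x
  nlinarith

theorem IsSolution.exists_bounds (h : IsSolution T z a) {t : ℝ} (ht : t ∈ Ioo 0 T) :
    ∃ c C D, ∀ᶠ s in 𝓝 t, Bounds c C D z s := by
  obtain ⟨c, C, hC⟩ := h.exists_curve ht
  obtain ⟨E, hE⟩ := h.exists_height ht
  obtain ⟨D₁, h1⟩ := h.isC0H1_velocity.exists_hold isOpen_Ioo ht
  obtain ⟨D₂, h2⟩ := h.exists_deriv_velocity.1.exists_hold isOpen_Ioo ht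
  obtain ⟨D₃, h3⟩ := h.exists_deriv_slope.1.exists_hold isOpen_Ioo ht
  obtain ⟨D₄, h4⟩ := h.isC0H1_slope.exists_hold isOpen_Ioo ht
  have p1 := h1.self_of_nhds.1.nonneg
  have p2 := h2.self_of_nhds.1.nonneg
  have p3 := h3.self_of_nhds.1.nonneg
  have p4 := h4.self_of_nhds.1.nonneg
  have pE := (norm_nonneg _).trans (hE.self_of_nhds 0)
  have pC := hC.self_of_nhds.const_nonneg
  refine ⟨c, C, D₁ + D₂ + D₃ + D₄ + 2 * (E + C), ?_⟩
  filter_upwards [hC, hE, h1, h2, h3, h4, Ioo_mem_nhds ht.1 ht.2] with s hC hE h1 h2 h3 h4 hs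
  have hd : ∀ x, HasDerivAt (fun x => ((z x s).im : ℂ)) ((dSpace z x s).im : ℂ) x :=
    fun x => hasDerivAt_im (hC.hasDerivAt x)
  refine ⟨hC, h.flat hs, h.hasDerivAt_time hs, h1.1.mono (by linarith), h1.2.mono (by linarith),
    h.hasDerivAt_velocity_space hs, h.exists_deriv_velocity.2 s hs, h.exists_deriv_slope.2 s hs,
    h3.1.mono (by linarith), h3.2.mono (by linarith), h2.1.mono (by linarith),
    h2.2.mono (by linarith), ?_, hC.hold.im.mono (by linarith), ?_⟩
  · exact (Hold.of_hasDerivAt (D := E + C) hd (fun x => (hE x).trans (by linarith))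
      (fun x => (hC.hold.im.bound x).trans (by linarith))).mono (by linarith)
  · have := h4.2.im
    simp only [Complex.sub_im, Complex.one_im, sub_zero] at this
    exact this.mono (by linarith)

/-! ### The Hilbert transform along the interface -/

theorem hilbertIntegrand_eq (t : ℝ) (f : ℝ → ℂ) (α : ℝ) :
    hilbertIntegrand (fun β => z β t) f α = fun β => 1 / (Real.pi * Complex.I) *
      cauchyKer (fun β => z β t) (fun β => dSpace z β t * f β) α β := by
  funext β
  simp only [hilbertIntegrand, cauchyKer, dSpace]
  ring

/-- Near α the Hölder bound and symmetrisation suffice; away from α, integrability against 1/(1 + |α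
− β|) does. Square integrability of f is not needed, which lets the height in. -/
theorem Curve.hasHilbert {c C t : ℝ} (h : Curve c C (fun x => z x t) (fun x => dSpace z x t))
    {D : ℝ} {f : ℝ → ℂ} (hf : Hold D f) {α : ℝ}
    (hi : Integrable fun β => ‖f β‖ * (1 + |α - β|)⁻¹) :
    IntegrableOn (sym (cauchyKer (fun β => z β t) (fun β => dSpace z β t * f β) α) α) (Ioi 0) ∧
    HasHilbert (fun β => z β t) f α (1 / (Real.pi * Complex.I) *
      cauchyInt (fun β => z β t) (fun β => dSpace z β t * f β) α) := by
  have hvf := h.hold.mul hf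
  have hc := h.pos
  have hfar : ∀ ε > 0, IntegrableOn
      (cauchyKer (fun β => z β t) (fun β => dSpace z β t * f β) α) {β | ε < |α - β|} := by
    intro ε hε
    have hm : MeasurableSet {β : ℝ | ε < |α - β|} :=
      (isOpen_lt continuous_const (by fun_prop)).measurableSet
    refine Integrable.mono' ((hi.const_mul (C / c * (1 / ε + 1))).integrableOn)
      (((h.continuousOn_cauchyKer hvf.continuous α).mono fun β hβ => ?_).aestronglyMeasurable hm)
      ((ae_restrict_iff' hm).2 (.of_forall fun β hβ => ?_))
    · rintro rfl
      simp only [mem_ofPred_eq, sub_self, abs_zero] at hβ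
      linarith
    · have hb : 0 < |α - β| := hε.trans hβ
      have hne : α ≠ β := by rintro rfl; simp at hb
      have h1 := h.norm_div_sub_le (a := dSpace z β t * f β) (D := C * ‖f β‖) hne
        (by rw [norm_mul]; gcongr; exact h.hold.bound β)
      refine h1.trans ?_
      have h2 : 1 / |α - β| ≤ (1 / ε + 1) * (1 + |α - β|)⁻¹ := by
        rw [← div_eq_mul_inv, div_le_div_iff₀ hb (by positivity), one_mul]
        have : 1 ≤ 1 / ε * |α - β| := by
          rw [one_div, ← div_eq_inv_mul, one_le_div hε]; exact hβ.le
        linarith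
      have hC := h.const_nonneg
      calc C * ‖f β‖ / c / |α - β| = C / c * ‖f β‖ * (1 / |α - β|) := by ring
        _ ≤ C / c * ‖f β‖ * ((1 / ε + 1) * (1 + |α - β|)⁻¹) := by gcongr
        _ = _ := by ring
  have hs : IntegrableOn (sym (cauchyKer (fun β => z β t) (fun β => dSpace z β t * f β) α) α)
      (Ioi 0) := by
    rw [← Ioc_union_Ioi_eq_Ioi (zero_le_one' ℝ)]
    exact (h.integrableOn_sym_cauchyKer hvf α 1).union
      (integrableOn_sym_of_integrableOn (hfar 1 one_pos) zero_le_one).1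
  refine ⟨hs, ?_⟩
  rw [HasHilbert, hilbertIntegrand_eq]
  have := hasPV_of_integrableOn_sym (fun ε hε => hfar ε hε) hs
  refine ⟨fun ε hε => (this.1 ε hε).const_mul _, ?_⟩
  simp_rw [integral_const_mul]
  exact this.2.const_mul _

theorem SqInt.integrable_mul_inv {D : ℝ} {f : ℝ → ℂ} (hf : SqInt D f) (α : ℝ) :
    Integrable fun β => ‖f β‖ * (1 + |α - β|)⁻¹ :=
  integrable_mul_inv_of_memLp (by norm_num) (by norm_num) hf.memLp α

theorem IsSolution.integrable_height_mul_inv (h : IsSolution T z a) {t : ℝ} (ht : t ∈ Ioo 0 T)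
    (α : ℝ) : Integrable fun β => ‖((z β t).im : ℂ)‖ * (1 + |α - β|)⁻¹ := by
  obtain ⟨p, hp1, hp, hy⟩ := h.height t ht
  exact integrable_mul_inv_of_memLp hp1 hp hy.ofReal α

/-- The Hilbert transform of `z - z̄` exists, and `Π` is expressed with the Cauchy integral. -/
theorem IsSolution.bigPi_eq (h : IsSolution T z a) {t : ℝ} (ht : t ∈ Ioo 0 T) (α : ℝ) :
    HasHilbert (fun β => z β t) (fun β => zSubConj z β t) α (2 / Real.pi *
      cauchyInt (fun β => z β t) (fun β => dSpace z β t * ((z β t).im : ℂ)) α) ∧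
    bigPi z α t = 2 * Complex.I * ((z α t).im : ℂ) - 2 / Real.pi *
      cauchyInt (fun β => z β t) (fun β => dSpace z β t * ((z β t).im : ℂ)) α := by
  obtain ⟨c, C, D, hB⟩ := h.exists_bounds ht
  have hB := hB.self_of_nhds
  have e : ∀ β, zSubConj z β t = 2 * Complex.I * ((z β t).im : ℂ) := fun β => by
    rw [zSubConj, Complex.sub_conj]; push_cast; ring
  have h1 := (hB.curve.hasHilbert hB.height (h.integrable_height_mul_inv ht α)).2
  have h2 : HasHilbert (fun β => z β t) (fun β => zSubConj z β t) α (2 / Real.pi *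
      cauchyInt (fun β => z β t) (fun β => dSpace z β t * ((z β t).im : ℂ)) α) := by
    have e2 : hilbertIntegrand (fun β => z β t) (fun β => zSubConj z β t) α = fun β =>
        2 * Complex.I * hilbertIntegrand (fun β => z β t) (fun β => ((z β t).im : ℂ)) α β := by
      funext β
      simp only [hilbertIntegrand, e]
      ring
    rw [HasHilbert, e2]
    refine ⟨fun ε hε => (h1.1 ε hε).const_mul _, ?_⟩
    simp_rw [integral_const_mul]
    convert h1.2.const_mul (2 * Complex.I) using 2
    have := Complex.I_ne_zero
    have : (Real.pi : ℂ) ≠ 0 := by exact_mod_cast Real.pi_ne_zero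
    field_simp
  exact ⟨h2, by rw [bigPi, h2.hilbert_eq, e]⟩

end Solution

/-! ### Continuity of the singular integrals in space and time -/

/-- Joint continuity at the points of the time slice `t`. -/
def JointCont (f : ℝ → ℝ → ℂ) (t : ℝ) : Prop :=
  ∀ x, ContinuousAt (fun p : ℝ × ℝ => f p.1 p.2) (x, t)

theorem JointCont.shift {f : ℝ → ℝ → ℂ} {t : ℝ} (h : JointCont f t) (s α : ℝ) :
    ContinuousAt (fun p : ℝ × ℝ => f (p.1 + s) p.2) (α, t) :=
  ContinuousAt.comp (f := fun p : ℝ × ℝ => (p.1 + s, p.2)) (x := (α, t))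
    (g := fun p : ℝ × ℝ => f p.1 p.2) (h (α + s)) (by fun_prop)

theorem JointCont.im {f : ℝ → ℝ → ℂ} {t : ℝ} (h : JointCont f t) :
    JointCont (fun x s => ((f x s).im : ℂ)) t := fun x =>
  (Complex.continuous_ofReal.comp Complex.continuous_im).continuousAt.comp (h x)

theorem JointCont.mul {f g : ℝ → ℝ → ℂ} {t : ℝ} (h : JointCont f t) (h' : JointCont g t) :
    JointCont (fun x s => f x s * g x s) t := fun x => (h x).mul (h' x)

section Solution
variable {T : ℝ} {z : ℝ → ℝ → ℂ} {a : ℝ → ℝ → ℝ} {c C D t : ℝ}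

theorem continuousAt_sym {K : ℝ → ℝ → ℝ → ℂ} {α s : ℝ}
    (h : ∀ r : ℝ, r ≠ 0 → ContinuousAt (fun p : ℝ × ℝ => K p.2 p.1 (p.1 + r)) (α, t))
    (hs : 0 < s) : ContinuousAt (fun p : ℝ × ℝ => sym (K p.2 p.1) p.1 s) (α, t) := by
  have := (h s hs.ne').add (h (-s) (neg_ne_zero.2 hs.ne'))
  simp only [← sub_eq_add_neg] at this
  exact this

theorem Curve.continuousAt_sub (h : Curve c C (fun x => z x t) (fun x => dSpace z x t))
    (hz : JointCont z t) (α : ℝ) {r : ℝ} (hr : r ≠ 0) :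
    ContinuousAt (fun p : ℝ × ℝ => z p.1 p.2 - z (p.1 + r) p.2) (α, t) ∧
      z α t - z (α + r) t ≠ 0 :=
  ⟨(hz α).sub (hz.shift r α), h.sub_ne_zero (by simpa using hr)⟩

theorem eventually_snd {P : ℝ → Prop} (h : ∀ᶠ s in 𝓝 t, P s) (α : ℝ) :
    ∀ᶠ p : ℝ × ℝ in 𝓝 (α, t), P p.2 :=
  (continuous_snd.tendsto (α, t)).eventually h

/-- The tameness constants depend only on bounds that are independent of the base point and uniform
for nearby times. -/
theorem continuousAt_cauchyInt (hB : ∀ᶠ s in 𝓝 t, Bounds c C D z s) (hz : JointCont z t)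
    {g : ℝ → ℝ → ℂ} {E E' : ℝ} (hg : JointCont g t)
    (hgB : ∀ᶠ s in 𝓝 t, Hold E (fun x => g x s) ∧ SqInt E' fun x => g x s) (hE' : 0 ≤ E') :
    JointCont (fun α t => cauchyInt (fun β => z β t) (fun β => g β t) α) t := by
  intro α
  refine TameAt.continuousAt
    (K := fun (p : ℝ × ℝ) s => sym (cauchyKer (fun β => z β p.2) (fun β => g β p.2) p.1) p.1 s)
    ⟨2 * (2 * E * (1 / c + C / c ^ 2)) + 2 * (1 / c) * (E' + 1), ?_⟩ fun s hs => ?_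
  · filter_upwards [eventually_snd (hB.and hgB) α] with p hp
    exact hp.1.curve.tame_cauchyKer hp.2.1 hE' hp.2.2 p.1
  · refine continuousAt_sym (K := fun t α => cauchyKer (fun β => z β t) (fun β => g β t) α)
      (fun r hr => ?_) hs
    obtain ⟨h1, h2⟩ := hB.self_of_nhds.curve.continuousAt_sub hz α hr
    exact (hg.shift r α).div h1 h2

theorem continuousAt_dqInt (hB : ∀ᶠ s in 𝓝 t, Bounds c C D z s) (hz : JointCont z t)
    (hw : JointCont (dTime z) t) {g : ℝ → ℝ → ℂ} (hg : JointCont g t)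
    (hgB : ∀ᶠ s in 𝓝 t, Hold D (fun x => g x s) ∧ SqInt D fun x => g x s) :
    JointCont (fun α t => dqInt (fun β => z β t) (fun β => dTime z β t) (fun β => g β t) α) t := by
  intro α
  refine TameAt.continuousAt
    (K := fun (p : ℝ × ℝ) s => sym (dqKer (fun β => z β p.2) (fun β => dTime z β p.2)
      (fun β => g β p.2) p.1) p.1 s)
    ⟨2 * (2 * D / c * D) + 2 * (2 * D / c) * (D + 1), ?_⟩ fun s hs => ?_
  · filter_upwards [eventually_snd (hB.and hgB) α] with p hp
    exact hp.1.curve.tame_dqKer hp.1.hasDerivAt_vel hp.1.velSpace hp.1.vel.bound hp.2.1 hp.2.2 p.1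
  · refine continuousAt_sym (K := fun t α => dqKer (fun β => z β t) (fun β => dTime z β t)
      (fun β => g β t) α) (fun r hr => ?_) hs
    obtain ⟨h1, h2⟩ := hB.self_of_nhds.curve.continuousAt_sub hz α hr
    exact (((hw α).sub (hw.shift r α)).div h1 h2).mul (hg.shift r α)

/-- The singular integral in the time derivative of `dqInt`. -/
def dqDerivInt (z q r w : ℝ → ℂ) (α : ℝ) : ℂ := ∫ s in Ioi 0, sym (dqDerivKer z q r w α) α s

theorem continuousAt_dqDerivInt (hB : ∀ᶠ s in 𝓝 t, Bounds c C D z s) (hz : JointCont z t)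
    (hw : JointCont (dTime z) t) (hr : JointCont (dTime (dTime z)) t)
    {g : ℝ → ℝ → ℂ} (hg : JointCont g t)
    (hgB : ∀ᶠ s in 𝓝 t, Hold D (fun x => g x s) ∧ SqInt D fun x => g x s) :
    JointCont (fun α t => dqDerivInt (fun β => z β t) (fun β => dTime z β t)
      (fun β => dTime (dTime z) β t) (fun β => g β t) α) t := by
  intro α
  refine TameAt.continuousAt
    (K := fun (p : ℝ × ℝ) s => sym (dqDerivKer (fun β => z β p.2) (fun β => dTime z β p.2)
      (fun β => dTime (dTime z) β p.2) (fun β => g β p.2) p.1) p.1 s)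
    ⟨2 * ((D / c + 2 * D / c * (D / c)) * D) + 2 * (2 * D / c + 2 * D / c * (D / c)) * (D + 1), ?_⟩
    fun s hs => ?_
  · filter_upwards [eventually_snd (hB.and hgB) α] with p hp
    exact hp.1.curve.tame_dqDerivKer hp.1.hasDerivAt_vel hp.1.velSpace hp.1.vel.bound hp.1.acc
      hp.2.1 hp.2.2 p.1
  · refine continuousAt_sym (K := fun t α => dqDerivKer (fun β => z β t) (fun β => dTime z β t)
      (fun β => dTime (dTime z) β t) (fun β => g β t) α) (fun s hs => ?_) hs
    obtain ⟨h1, h2⟩ := hB.self_of_nhds.curve.continuousAt_sub hz α hs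
    exact ((((hr α).sub (hr.shift s α)).div h1 h2).sub
      ((((hw α).sub (hw.shift s α)).div h1 h2).pow 2)).mul (hg.shift s α)

/-! ### Time derivatives of the singular integrals -/

/-- Bounds, at the time `t`, for a function `u` with partial derivatives `ut` and `ux`. -/
structure FieldBounds (D : ℝ) (u ut ux : ℝ → ℝ → ℂ) (t : ℝ) : Prop where
  hasDerivAt_time : ∀ x, HasDerivAt (u x) (ut x t) t
  hasDerivAt_space : ∀ x, HasDerivAt (fun x => u x t) (ux x t) x
  hold : Hold D fun x => u x t
  hold_time : Hold D fun x => ut x t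
  sqInt_time : SqInt D fun x => ut x t
  hold_space : Hold D fun x => ux x t
  sqInt_space : SqInt D fun x => ux x t

theorem Bounds.field_velocity (h : Bounds c C D z t) :
    FieldBounds D (dTime z) (dTime (dTime z)) (dTime (dSpace z)) t :=
  ⟨h.hasDerivAt_vel_time, h.hasDerivAt_vel, h.vel, h.acc, h.sqInt_acc, h.velSpace, h.sqInt_velSpace⟩

theorem FieldBounds.conj {u ut ux : ℝ → ℝ → ℂ} (h : FieldBounds D u ut ux t) :
    FieldBounds D (fun x t => starRingEnd ℂ (u x t)) (fun x t => starRingEnd ℂ (ut x t))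
      (fun x t => starRingEnd ℂ (ux x t)) t :=
  ⟨fun x => hasDerivAt_conj (h.hasDerivAt_time x), fun x => hasDerivAt_conj (h.hasDerivAt_space x),
    h.hold.conj, h.hold_time.conj, h.sqInt_time.conj, h.hold_space.conj, h.sqInt_space.conj⟩

theorem Bounds.field_height (h : Bounds c C D z t) :
    FieldBounds D (fun x t => ((z x t).im : ℂ)) (fun x t => ((dTime z x t).im : ℂ))
      (fun x t => ((dSpace z x t).im : ℂ)) t :=
  ⟨fun x => hasDerivAt_im (h.hasDerivAt_time x), h.hasDerivAt_height, h.height, h.vel.im,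
    h.sqInt_vel.im, h.slope, h.sqInt_slope⟩

theorem hasDerivAt_sym {K : ℝ → ℝ → ℂ} {K' : ℝ → ℂ} {α s τ : ℝ}
    (h : ∀ β ≠ α, HasDerivAt (fun τ => K τ β) (K' β) τ) (hs : 0 < s) :
    HasDerivAt (fun τ => sym (K τ) α s) (sym K' α s) τ :=
  (h (α + s) (by simpa using hs.ne')).add (h (α - s) (by simpa using hs.ne'))

/-- The derivative falls either on u or on the kernel z_β/Δz; in the second case integration by
parts moves the β-derivative onto u. Since `FieldBounds` does not make u itself square integrable,
convergence of the undifferentiated integral is a separate hypothesis. -/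
theorem hasDerivAt_cauchyInt_time (hB : ∀ᶠ s in 𝓝 t, Bounds c C D z s) {u ut ux : ℝ → ℝ → ℂ}
    (hu : ∀ᶠ s in 𝓝 t, FieldBounds D u ut ux s) (α : ℝ)
    (hi : ∀ᶠ s in 𝓝 t, IntegrableOn
      (sym (cauchyKer (fun β => z β s) (fun β => dSpace z β s * u β s) α) α) (Ioi 0)) :
    HasDerivAt (fun t => cauchyInt (fun β => z β t) (fun β => dSpace z β t * u β t) α)
      (cauchyInt (fun β => z β t) (fun β => dSpace z β t * ut β t) α +
        dqInt (fun β => z β t) (fun β => dTime z β t) (fun β => ux β t) α) t := by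
  have hBt := hB.self_of_nhds
  have hut := hu.self_of_nhds
  have hD := hut.hold.nonneg
  have hC := hBt.curve.const_nonneg
  have ht1 : ∀ s, Bounds c C D z s → FieldBounds D u ut ux s → Tame
      (2 * (2 * (2 * C * D) * (1 / c + C / c ^ 2)) + 2 * (1 / c) * (C * D + 1))
      (sym (cauchyKer (fun β => z β s) (fun β => dSpace z β s * ut β s) α) α) := fun s h1 h2 =>
    h1.curve.tame_cauchyKer (h1.curve.hold.mul h2.hold_time) (by positivity)
      (h2.sqInt_time.mul_hold h1.curve.hold) α
  have ht2 : ∀ s, Bounds c C D z s → FieldBounds D u ut ux s → Tame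
      (2 * ((2 * D * C + 2 * C * D) / c ^ 2 * D) + 2 * (D / c * (1 + C * 2 * D / c)) * (D + 1))
      (sym (cauchyDerivKer (fun β => z β s) (fun β => dSpace z β s) (fun β => dTime z β s)
        (fun β => dTime (dSpace z) β s) (fun β => u β s) α) α) := fun s h1 h2 =>
    h1.curve.tame_cauchyDerivKer h1.hasDerivAt_vel h1.velSpace h1.sqInt_velSpace h1.vel.bound
      h2.hold.continuous h2.hold.bound α
  have key := TameAt.hasDerivAt (t₀ := t)
    (K := fun s => sym (cauchyKer (fun β => z β s) (fun β => dSpace z β s * u β s) α) α)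
    (K' := fun τ s => sym (cauchyKer (fun β => z β τ) (fun β => dSpace z β τ * ut β τ) α) α s +
      sym (cauchyDerivKer (fun β => z β τ) (fun β => dSpace z β τ) (fun β => dTime z β τ)
        (fun β => dTime (dSpace z) β τ) (fun β => u β τ) α) α s)
    ⟨_, (hB.and hu).mono fun s hs => (ht1 s hs.1 hs.2).add (ht2 s hs.1 hs.2)⟩ hi (by
      filter_upwards [hB, hu] with τ h1 h2 s hs
      simp only [← sym_add]
      refine hasDerivAt_sym (K := fun τ => cauchyKer (fun β => z β τ)
        (fun β => dSpace z β τ * u β τ) α) (fun β hβ => ?_) hs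
      have hne := h1.curve.sub_ne_zero (Ne.symm hβ)
      refine (((h1.hasDerivAt_slope_time β).mul (h2.hasDerivAt_time β)).div
        ((h1.hasDerivAt_time α).sub (h1.hasDerivAt_time β)) hne).congr_deriv ?_
      simp only [cauchyKer, cauchyDerivKer, Pi.sub_apply, Pi.mul_apply]
      field_simp
      ring)
  refine key.congr_deriv ?_
  rw [integral_add (ht1 t hBt hut).integrableOn (ht2 t hBt hut).integrableOn,
    hBt.curve.integral_cauchyDerivKer hBt.hasDerivAt_vel hBt.velSpace hBt.sqInt_velSpace
      hBt.vel.bound hut.hasDerivAt_space hut.hold_space hut.sqInt_space hut.hold.bound]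
  rfl

theorem hasDerivAt_dqInt_time (hB : ∀ᶠ s in 𝓝 t, Bounds c C D z s) (α : ℝ) :
    HasDerivAt (fun t => dqInt (fun β => z β t) (fun β => dTime z β t)
        (fun β => ((dSpace z β t).im : ℂ)) α)
      (dqDerivInt (fun β => z β t) (fun β => dTime z β t) (fun β => dTime (dTime z) β t)
        (fun β => ((dSpace z β t).im : ℂ)) α +
      dqInt (fun β => z β t) (fun β => dTime z β t) (fun β => ((dTime (dSpace z) β t).im : ℂ)) α)
      t := by
  have hBt := hB.self_of_nhds
  have ht1 : ∀ s, Bounds c C D z s → Tame _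
      (sym (dqDerivKer (fun β => z β s) (fun β => dTime z β s) (fun β => dTime (dTime z) β s)
        (fun β => ((dSpace z β s).im : ℂ)) α) α) := fun s h1 =>
    h1.curve.tame_dqDerivKer h1.hasDerivAt_vel h1.velSpace h1.vel.bound h1.acc h1.slope
      h1.sqInt_slope α
  have ht2 : ∀ s, Bounds c C D z s → Tame _
      (sym (dqKer (fun β => z β s) (fun β => dTime z β s)
        (fun β => ((dTime (dSpace z) β s).im : ℂ)) α) α) := fun s h1 =>
    h1.curve.tame_dqKer h1.hasDerivAt_vel h1.velSpace h1.vel.bound h1.velSpace.im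
      h1.sqInt_velSpace.im α
  have key := TameAt.hasDerivAt (t₀ := t)
    (K := fun s => sym (dqKer (fun β => z β s) (fun β => dTime z β s)
      (fun β => ((dSpace z β s).im : ℂ)) α) α)
    (K' := fun τ s => sym (dqDerivKer (fun β => z β τ) (fun β => dTime z β τ)
        (fun β => dTime (dTime z) β τ) (fun β => ((dSpace z β τ).im : ℂ)) α) α s +
      sym (dqKer (fun β => z β τ) (fun β => dTime z β τ)
        (fun β => ((dTime (dSpace z) β τ).im : ℂ)) α) α s)
    ⟨_, hB.mono fun s hs => (ht1 s hs).add (ht2 s hs)⟩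
    (hB.mono fun s h1 => (h1.curve.tame_dqKer h1.hasDerivAt_vel h1.velSpace h1.vel.bound h1.slope
      h1.sqInt_slope α).integrableOn) (by
      filter_upwards [hB] with τ h1 s hs
      simp only [← sym_add]
      refine hasDerivAt_sym (K := fun τ => dqKer (fun β => z β τ) (fun β => dTime z β τ)
        (fun β => ((dSpace z β τ).im : ℂ)) α) (fun β hβ => ?_) hs
      have hne := h1.curve.sub_ne_zero (Ne.symm hβ)
      refine ((((h1.hasDerivAt_vel_time α).sub (h1.hasDerivAt_vel_time β)).div
        ((h1.hasDerivAt_time α).sub (h1.hasDerivAt_time β)) hne).mul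
        (hasDerivAt_im (h1.hasDerivAt_slope_time β))).congr_deriv ?_
      simp only [dqKer, dqDerivKer, Pi.sub_apply, Pi.div_apply]
      field_simp)
  refine key.congr_deriv ?_
  rw [integral_add (ht1 t hBt).integrableOn (ht2 t hBt).integrableOn]
  rfl

end Solution

/-! ### Linearity of the singular integrals, and the derivatives of Π -/

theorem LocalMod.conj {w : ℝ → ℂ} {N : ℝ → ℝ} (h : LocalMod w N) :
    LocalMod (fun x => starRingEnd ℂ (w x)) N where
  nonneg := h.nonneg
  memLp := h.memLp
  le β s hs := by rw [← map_sub, RCLike.norm_conj]; exact h.le β s hs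

theorem cauchyInt_add {z w₁ w₂ : ℝ → ℂ} {α : ℝ}
    (h1 : IntegrableOn (sym (cauchyKer z w₁ α) α) (Ioi 0))
    (h2 : IntegrableOn (sym (cauchyKer z w₂ α) α) (Ioi 0)) :
    cauchyInt z (fun β => w₁ β + w₂ β) α = cauchyInt z w₁ α + cauchyInt z w₂ α := by
  rw [cauchyInt, cauchyInt, cauchyInt, ← integral_add h1 h2]
  refine integral_congr_ae (.of_forall fun s => ?_)
  simp only [sym, cauchyKer]
  ring

theorem cauchyInt_const_mul (b : ℂ) (z w : ℝ → ℂ) (α : ℝ) :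
    cauchyInt z (fun β => b * w β) α = b * cauchyInt z w α := by
  rw [cauchyInt, cauchyInt, ← integral_const_mul]
  refine integral_congr_ae (.of_forall fun s => ?_)
  simp only [sym, cauchyKer]
  ring

theorem dqInt_add {z u w₁ w₂ : ℝ → ℂ} {α : ℝ}
    (h1 : IntegrableOn (sym (dqKer z u w₁ α) α) (Ioi 0))
    (h2 : IntegrableOn (sym (dqKer z u w₂ α) α) (Ioi 0)) :
    dqInt z u (fun β => w₁ β + w₂ β) α = dqInt z u w₁ α + dqInt z u w₂ α := by
  rw [dqInt, dqInt, dqInt, ← integral_add h1 h2]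
  refine integral_congr_ae (.of_forall fun s => ?_)
  simp only [sym, dqKer]
  ring

theorem dqInt_const_mul (b : ℂ) (z u w : ℝ → ℂ) (α : ℝ) :
    dqInt z u (fun β => b * w β) α = b * dqInt z u w α := by
  rw [dqInt, dqInt, ← integral_const_mul]
  refine integral_congr_ae (.of_forall fun s => ?_)
  simp only [sym, dqKer]
  ring

theorem eq_conj_add_im (x : ℂ) : x = starRingEnd ℂ x + 2 * Complex.I * (x.im : ℂ) := by
  apply Complex.ext <;> simp
  ring

/-- The time derivative of `Π`. -/
def piTime (z : ℝ → ℝ → ℂ) (α t : ℝ) : ℂ :=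
  dTime z α t -
    1 / (Real.pi * Complex.I) *
      cauchyInt (fun β => z β t) (fun β => dSpace z β t * dTime z β t) α -
    2 / Real.pi *
      dqInt (fun β => z β t) (fun β => dTime z β t) (fun β => ((dSpace z β t).im : ℂ)) α

/-- The second time derivative of `Π`. -/
def piTimeTime (z : ℝ → ℝ → ℂ) (α t : ℝ) : ℂ :=
  dTime (dTime z) α t -
    1 / (Real.pi * Complex.I) *
      (cauchyInt (fun β => z β t) (fun β => dSpace z β t * dTime (dTime z) β t) α +
        dqInt (fun β => z β t) (fun β => dTime z β t) (fun β => dTime (dSpace z) β t) α) -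
    2 / Real.pi *
      (dqDerivInt (fun β => z β t) (fun β => dTime z β t) (fun β => dTime (dTime z) β t)
        (fun β => ((dSpace z β t).im : ℂ)) α +
      dqInt (fun β => z β t) (fun β => dTime z β t) (fun β => ((dTime (dSpace z) β t).im : ℂ)) α)

section Solution
variable {T : ℝ} {z : ℝ → ℝ → ℂ} {a : ℝ → ℝ → ℝ} {t : ℝ}

theorem IsSolution.jointCont (h : IsSolution T z a) (ht : t ∈ Ioo 0 T) : JointCont z t :=
  h.continuousAt ht

theorem IsSolution.jointCont_dSpace (h : IsSolution T z a) (ht : t ∈ Ioo 0 T) :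
    JointCont (dSpace z) t := fun _ => continuousAt_dSpace_of_strip h.contDiffOn ht

theorem IsSolution.jointCont_dTime (h : IsSolution T z a) (ht : t ∈ Ioo 0 T) :
    JointCont (dTime z) t := fun _ => continuousAt_dTime_of_strip h.contDiffOn ht

theorem IsSolution.jointCont_acc (h : IsSolution T z a) (ht : t ∈ Ioo 0 T) :
    JointCont (dTime (dTime z)) t := h.exists_deriv_velocity.1.continuousAt isOpen_Ioo ht

theorem IsSolution.jointCont_velSpace (h : IsSolution T z a) (ht : t ∈ Ioo 0 T) :
    JointCont (dTime (dSpace z)) t := h.exists_deriv_slope.1.continuousAt isOpen_Ioo ht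

theorem Bounds.integrableOn_mul {c C D : ℝ} (h : Bounds c C D z t) {f : ℝ → ℂ} (hf : Hold D f)
    (hf2 : SqInt D f) (α : ℝ) : IntegrableOn
      (sym (cauchyKer (fun β => z β t) (fun β => dSpace z β t * f β) α) α) (Ioi 0) :=
  (h.curve.tame_cauchyKer (h.curve.hold.mul hf)
    (mul_nonneg h.curve.const_nonneg hf.nonneg) (hf2.mul_hold h.curve.hold) α).integrableOn

theorem Bounds.integrableOn_dqKer {c C D : ℝ} (h : Bounds c C D z t) {f : ℝ → ℂ} (hf : Hold D f)
    (hf2 : SqInt D f) (α : ℝ) : IntegrableOn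
      (sym (dqKer (fun β => z β t) (fun β => dTime z β t) f α) α) (Ioi 0) :=
  (h.curve.tame_dqKer h.hasDerivAt_vel h.velSpace h.vel.bound hf hf2 α).integrableOn

theorem IsSolution.cauchyInt_conj_velocity (h : IsSolution T z a) (ht : t ∈ Ioo 0 T) (α : ℝ) :
    cauchyInt (fun β => z β t) (fun β => dSpace z β t * starRingEnd ℂ (dTime z β t)) α =
      Real.pi * Complex.I * starRingEnd ℂ (dTime z α t) := by
  obtain ⟨c, C, D, hB⟩ := h.exists_bounds ht
  have hB := hB.self_of_nhds
  have h1 := (hB.curve.hasHilbert hB.vel.conj (hB.sqInt_vel.conj.integrable_mul_inv α)).2.hilbert_eq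
  rw [(h.holomorphic t ht α).hilbert_eq] at h1
  rw [h1]
  have := Complex.I_ne_zero
  have : (Real.pi : ℂ) ≠ 0 := by exact_mod_cast Real.pi_ne_zero
  field_simp

/-- Direct differentiation produces (I − 𝔥)(2iy_t). Because z̄_t = 𝔥z̄_t and 2iy_t = z_t − z̄_t,
this is (I − 𝔥)z_t, the form used for the second derivative. -/
theorem IsSolution.hasDerivAt_bigPi (h : IsSolution T z a) (ht : t ∈ Ioo 0 T) (α : ℝ) :
    HasDerivAt (bigPi z α) (piTime z α t) t := by
  obtain ⟨c, C, D, hB⟩ := h.exists_bounds ht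
  have hBt := hB.self_of_nhds
  have hJ : ∀ᶠ s in 𝓝 t, s ∈ Ioo 0 T := Ioo_mem_nhds ht.1 ht.2
  have h1 := hasDerivAt_cauchyInt_time hB (hB.mono fun s hs => hs.field_height) α (by
    filter_upwards [hB, hJ] with s h1 h2
    exact (h1.curve.hasHilbert h1.height (h.integrable_height_mul_inv h2 α)).1)
  have h2 := ((hasDerivAt_im (hBt.hasDerivAt_time α)).const_mul (2 * Complex.I)).sub
    (h1.const_mul (2 / Real.pi : ℂ))
  refine (h2.congr_of_eventuallyEq ?_).congr_deriv ?_
  · filter_upwards [hJ] with s hs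
    exact (h.bigPi_eq hs α).2
  · have e1 : cauchyInt (fun β => z β t) (fun β => dSpace z β t * dTime z β t) α =
        Real.pi * Complex.I * starRingEnd ℂ (dTime z α t) + 2 * Complex.I *
          cauchyInt (fun β => z β t) (fun β => dSpace z β t * ((dTime z β t).im : ℂ)) α := by
      rw [← h.cauchyInt_conj_velocity ht, ← cauchyInt_const_mul, ← cauchyInt_add
        (hBt.integrableOn_mul hBt.vel.conj hBt.sqInt_vel.conj α)]
      · congr 1
        funext β
        conv_lhs => rw [eq_conj_add_im (dTime z β t)]
        ring
      · have := hBt.integrableOn_mul hBt.vel.im hBt.sqInt_vel.im α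
        refine (this.const_mul (2 * Complex.I)).congr (.of_forall fun s => ?_)
        simp only [sym, cauchyKer]
        ring
    have := Complex.I_ne_zero
    have : (Real.pi : ℂ) ≠ 0 := by exact_mod_cast Real.pi_ne_zero
    have e2 : ∀ x y : ℂ, 1 / (Real.pi * Complex.I) * (Real.pi * Complex.I * x +
        2 * Complex.I * y) = x + 2 / Real.pi * y := fun x y => by field_simp
    rw [piTime, e1, e2]
    linear_combination -eq_conj_add_im (dTime z α t)

theorem IsSolution.hasDerivAt_piTime (h : IsSolution T z a) (ht : t ∈ Ioo 0 T) (α : ℝ) :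
    HasDerivAt (piTime z α) (piTimeTime z α t) t := by
  obtain ⟨c, C, D, hB⟩ := h.exists_bounds ht
  exact ((hB.self_of_nhds.hasDerivAt_vel_time α).sub ((hasDerivAt_cauchyInt_time hB
    (hB.mono fun s hs => hs.field_velocity) α
    (hB.mono fun s hs => hs.integrableOn_mul hs.vel hs.sqInt_vel α)).const_mul _)).sub
    ((hasDerivAt_dqInt_time hB α).const_mul _)

theorem IsSolution.jointCont_piTime (h : IsSolution T z a) (ht : t ∈ Ioo 0 T) :
    JointCont (piTime z) t := by
  obtain ⟨c, C, D, hB⟩ := h.exists_bounds ht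
  have hBt := hB.self_of_nhds
  have h1 := continuousAt_cauchyInt (E' := C * D) hB (h.jointCont ht)
    ((h.jointCont_dSpace ht).mul (h.jointCont_dTime ht))
    (hB.mono fun s hs => ⟨hs.curve.hold.mul hs.vel, hs.sqInt_vel.mul_hold hs.curve.hold⟩)
    (mul_nonneg hBt.curve.const_nonneg hBt.vel.nonneg)
  have h2 := continuousAt_dqInt hB (h.jointCont ht) (h.jointCont_dTime ht)
    (h.jointCont_dSpace ht).im (hB.mono fun s hs => ⟨hs.slope, hs.sqInt_slope⟩)
  exact fun α => ((h.jointCont_dTime ht α).sub (continuousAt_const.mul (h1 α))).sub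
    (continuousAt_const.mul (h2 α))

theorem IsSolution.jointCont_piTimeTime (h : IsSolution T z a) (ht : t ∈ Ioo 0 T) :
    JointCont (piTimeTime z) t := by
  obtain ⟨c, C, D, hB⟩ := h.exists_bounds ht
  have hBt := hB.self_of_nhds
  have h1 := continuousAt_cauchyInt (E' := C * D) hB (h.jointCont ht)
    ((h.jointCont_dSpace ht).mul (h.jointCont_acc ht))
    (hB.mono fun s hs => ⟨hs.curve.hold.mul hs.acc, hs.sqInt_acc.mul_hold hs.curve.hold⟩)
    (mul_nonneg hBt.curve.const_nonneg hBt.vel.nonneg)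
  have h2 := continuousAt_dqInt hB (h.jointCont ht) (h.jointCont_dTime ht)
    (h.jointCont_velSpace ht) (hB.mono fun s hs => ⟨hs.velSpace, hs.sqInt_velSpace⟩)
  have h3 := continuousAt_dqInt hB (h.jointCont ht) (h.jointCont_dTime ht)
    (h.jointCont_velSpace ht).im (hB.mono fun s hs => ⟨hs.velSpace.im, hs.sqInt_velSpace.im⟩)
  have h4 := continuousAt_dqDerivInt hB (h.jointCont ht) (h.jointCont_dTime ht) (h.jointCont_acc ht)
    (h.jointCont_dSpace ht).im (hB.mono fun s hs => ⟨hs.slope, hs.sqInt_slope⟩)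
  exact fun α => ((h.jointCont_acc ht α).sub (continuousAt_const.mul ((h1 α).add (h2 α)))).sub
    (continuousAt_const.mul ((h4 α).add (h3 α)))

theorem IsSolution.hasDerivAt_bigPi_space (h : IsSolution T z a) (ht : t ∈ Ioo 0 T) (α : ℝ) :
    HasDerivAt (fun x => bigPi z x t) (2 * Complex.I * ((dSpace z α t).im : ℂ) - 2 / Real.pi *
      (dSpace z α t * cauchyInt (fun β => z β t) (fun β => ((dSpace z β t).im : ℂ)) α)) α := by
  obtain ⟨c, C, D, hB⟩ := h.exists_bounds ht
  have hB := hB.self_of_nhds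
  have h1 := (hB.curve.hasDerivAt_cauchyInt hB.flat hB.hasDerivAt_height hB.slope hB.sqInt_slope
    hB.height (fun α => (hB.curve.hasHilbert hB.height (h.integrable_height_mul_inv ht α)).1) α).1
  rw [show (fun x => bigPi z x t) = fun x => 2 * Complex.I * ((z x t).im : ℂ) - 2 / Real.pi *
      cauchyInt (fun β => z β t) (fun β => dSpace z β t * ((z β t).im : ℂ)) x from
    funext fun x => (h.bigPi_eq ht x).2]
  exact ((hB.hasDerivAt_height α).const_mul _).sub (h1.const_mul _)

theorem IsSolution.differentiableAt_piTime_space (h : IsSolution T z a) (ht : t ∈ Ioo 0 T)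
    (α : ℝ) : DifferentiableAt ℝ (fun x => piTime z x t) α := by
  obtain ⟨c, C, D, hB⟩ := h.exists_bounds ht
  have hB := hB.self_of_nhds
  have h1 := (hB.curve.hasDerivAt_cauchyInt hB.flat hB.hasDerivAt_vel hB.velSpace
    hB.sqInt_velSpace hB.vel (fun α => hB.integrableOn_mul hB.vel hB.sqInt_vel α) α).1
  have h2 := hB.curve.differentiableAt_dqInt hB.hasDerivAt_vel hB.velSpace hB.vel.bound hB.slope
    hB.sqInt_slope α
  exact ((hB.hasDerivAt_vel α).differentiableAt.sub (h1.differentiableAt.const_mul _)).sub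
    (h2.const_mul _)

theorem IsSolution.dTime_bigPi (h : IsSolution T z a) (ht : t ∈ Ioo 0 T) (α : ℝ) :
    dTime (bigPi z) α t = piTime z α t := (h.hasDerivAt_bigPi ht α).deriv

theorem IsSolution.differentiableAt_bigPi (h : IsSolution T z a) (ht : t ∈ Ioo 0 T) (α : ℝ) :
    DifferentiableAt ℝ (fun p : ℝ × ℝ => bigPi z p.1 p.2) (α, t) :=
  differentiableAt_of_partial (h.hasDerivAt_bigPi_space ht α)
    ((eventually_snd_mem ht).mono fun p hp => h.hasDerivAt_bigPi hp p.1) (h.jointCont_piTime ht α)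

theorem IsSolution.differentiableAt_dTime_bigPi (h : IsSolution T z a) (ht : t ∈ Ioo 0 T) (α : ℝ) :
    DifferentiableAt ℝ (fun p : ℝ × ℝ => dTime (bigPi z) p.1 p.2) (α, t) := by
  refine (differentiableAt_of_partial (h.differentiableAt_piTime_space ht α).hasDerivAt
    ((eventually_snd_mem ht).mono fun p hp => h.hasDerivAt_piTime hp p.1)
    (h.jointCont_piTimeTime ht α)).congr_of_eventuallyEq ?_
  filter_upwards [eventually_snd_mem ht] with p hp
  exact h.dTime_bigPi hp p.1

theorem IsSolution.dTime_dTime_bigPi (h : IsSolution T z a) (ht : t ∈ Ioo 0 T) (α : ℝ) :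
    dTime (dTime (bigPi z)) α t = piTimeTime z α t := by
  refine ((h.hasDerivAt_piTime ht α).congr_of_eventuallyEq ?_).deriv
  filter_upwards [Ioo_mem_nhds ht.1 ht.2] with s hs
  exact h.dTime_bigPi hs α

end Solution

/-! ### The identity in Lagrangian coordinates -/

section Solution
variable {T : ℝ} {z : ℝ → ℝ → ℂ} {a : ℝ → ℝ → ℝ} {t : ℝ}

theorem IsSolution.dSpace_velocity (h : IsSolution T z a) (ht : t ∈ Ioo 0 T) (α : ℝ) :
    dSpace (dTime z) α t = dTime (dSpace z) α t := (h.hasDerivAt_velocity_space ht α).deriv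

theorem IsSolution.dSpace_height (h : IsSolution T z a) (ht : t ∈ Ioo 0 T) (α : ℝ) :
    dSpace (fun x s => (z x s).im) α t = (dSpace z α t).im :=
  (Complex.imCLM.hasFDerivAt.comp_hasDerivAt α (h.hasDerivAt_space ht α)).deriv

theorem IsSolution.dqInt_conj_velocity (h : IsSolution T z a) (ht : t ∈ Ioo 0 T) (α : ℝ) :
    dqInt (fun β => z β t) (fun β => starRingEnd ℂ (dTime z β t))
      (fun β => starRingEnd ℂ (dTime (dSpace z) β t)) α = 0 := by
  obtain ⟨c, C, D, hB⟩ := h.exists_bounds ht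
  have hB := hB.self_of_nhds
  obtain ⟨N, hN⟩ := h.exists_deriv_slope.1.exists_localMod ht
  exact hB.curve.dqInt_self_eq_zero hB.flat (fun x => hasDerivAt_conj (hB.hasDerivAt_vel x))
    hB.velSpace.conj hB.sqInt_velSpace.conj hB.vel.conj
    (hB.integrableOn_mul hB.vel.conj hB.sqInt_vel.conj) hN.conj (h.cauchyInt_conj_velocity ht) α

/-- The time derivative of the equation `z̄_t = 𝔥 z̄_t`. -/
theorem IsSolution.cauchyInt_conj_acc (h : IsSolution T z a) (ht : t ∈ Ioo 0 T) (α : ℝ) :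
    cauchyInt (fun β => z β t) (fun β => dSpace z β t * starRingEnd ℂ (dTime (dTime z) β t)) α +
      dqInt (fun β => z β t) (fun β => dTime z β t)
        (fun β => starRingEnd ℂ (dTime (dSpace z) β t)) α =
      Real.pi * Complex.I * starRingEnd ℂ (dTime (dTime z) α t) := by
  obtain ⟨c, C, D, hB⟩ := h.exists_bounds ht
  have h1 := hasDerivAt_cauchyInt_time hB (hB.mono fun s hs => hs.field_velocity.conj) α
    (hB.mono fun s hs => hs.integrableOn_mul hs.vel.conj hs.sqInt_vel.conj α)
  refine h1.unique (((hasDerivAt_conj (hB.self_of_nhds.hasDerivAt_vel_time α)).const_mul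
    (Real.pi * Complex.I : ℂ)).congr_of_eventuallyEq ?_)
  filter_upwards [Ioo_mem_nhds ht.1 ht.2] with s hs
  exact h.cauchyInt_conj_velocity hs α

theorem div_sub_div_conj (b Δ : ℂ) :
    b / Δ - b / starRingEnd ℂ Δ = -2 * Complex.I * (b * (Δ.im : ℂ) / ((‖Δ‖ ^ 2 : ℝ) : ℂ)) := by
  rcases eq_or_ne Δ 0 with rfl | hΔ
  · simp
  have h1 : starRingEnd ℂ Δ ≠ 0 := by simpa using hΔ
  have h2 : ((‖Δ‖ ^ 2 : ℝ) : ℂ) = Δ * starRingEnd ℂ Δ := by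
    rw [Complex.mul_conj, Complex.normSq_eq_norm_sq]
  rw [h2]
  field_simp
  linear_combination -b * eq_conj_add_im Δ

/-- Conjugating the kernel built from z̄_t changes 1/Δz into 1/Δz̄, so the difference carries the
factor 1/Δz − 1/Δz̄ = −2i Im Δz/|Δz|². -/
theorem IsSolution.integrand₁_eq (h : IsSolution T z a) (ht : t ∈ Ioo 0 T) (α β : ℝ) :
    dqKer (fun β => z β t) (fun β => dTime z β t) (fun β => dTime (dSpace z) β t) α β -
      starRingEnd ℂ (dqKer (fun β => z β t) (fun β => starRingEnd ℂ (dTime z β t))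
        (fun β => starRingEnd ℂ (dTime (dSpace z) β t)) α β) =
    -2 * Complex.I * integrand₁ z (dTime z) α t β := by
  simp only [dqKer, integrand₁, map_mul, map_div₀, map_sub, Complex.conj_conj,
    h.dSpace_velocity ht]
  rw [← sub_mul, ← map_sub, div_sub_div_conj, Complex.sub_im]
  ring

/-- The subtracted kernel has integral zero, because z̄_t is the boundary value of a holomorphic
function. -/
theorem IsSolution.integral_integrand₁ (h : IsSolution T z a) (ht : t ∈ Ioo 0 T) (α : ℝ) :
    Integrable (integrand₁ z (dTime z) α t) ∧
      dqInt (fun β => z β t) (fun β => dTime z β t) (fun β => dTime (dSpace z) β t) α =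
        -2 * Complex.I * ∫ β, integrand₁ z (dTime z) α t β := by
  obtain ⟨c, C, D, hB⟩ := h.exists_bounds ht
  have hB := hB.self_of_nhds
  have h1 := (hB.curve.integrable_dqKer hB.hasDerivAt_vel hB.velSpace hB.vel.bound
    hB.sqInt_velSpace α).2.1
  have hbc : ∀ x, ‖starRingEnd ℂ (dTime z x t)‖ ≤ D := hB.vel.conj.bound
  have h2 := (hB.curve.integrable_dqKer (fun x => hasDerivAt_conj (hB.hasDerivAt_vel x))
    hB.velSpace.conj hbc hB.sqInt_velSpace.conj α).2.1
  have h3 : ∫ β, dqKer (fun β => z β t) (fun β => starRingEnd ℂ (dTime z β t))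
        (fun β => starRingEnd ℂ (dTime (dSpace z) β t)) α β = 0 := by
    rw [← hB.curve.dqInt_eq (fun x => hasDerivAt_conj (hB.hasDerivAt_vel x))
      hB.velSpace.conj hbc hB.sqInt_velSpace.conj α, h.dqInt_conj_velocity ht]
  have h4 := Complex.conjCLE.toContinuousLinearMap.integrable_comp h2
  have h5 := h1.sub h4
  have h6 : ∀ β, dqKer (fun β => z β t) (fun β => dTime z β t) (fun β => dTime (dSpace z) β t) α β -
      Complex.conjCLE.toContinuousLinearMap (dqKer (fun β => z β t)
        (fun β => starRingEnd ℂ (dTime z β t))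
        (fun β => starRingEnd ℂ (dTime (dSpace z) β t)) α β) =
    -2 * Complex.I * integrand₁ z (dTime z) α t β := h.integrand₁_eq ht α
  have hI := Complex.I_ne_zero
  refine ⟨?_, ?_⟩
  · refine (h5.const_mul (-2 * Complex.I)⁻¹).congr (.of_forall fun β => ?_)
    simp only [Pi.sub_apply, h6]
    field_simp
  · rw [← integral_const_mul, ← integral_congr_ae (.of_forall h6), integral_sub h1 h4,
      ContinuousLinearMap.integral_comp_comm _ h2, h3, map_zero, sub_zero]
    exact hB.curve.dqInt_eq hB.hasDerivAt_vel hB.velSpace hB.vel.bound hB.sqInt_velSpace α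

theorem IsSolution.integrable_integrand₂ (h : IsSolution T z a) (ht : t ∈ Ioo 0 T) (α : ℝ) :
    Integrable (integrand₂ z (dTime z) α t) := by
  obtain ⟨c, C, D, hB⟩ := h.exists_bounds ht
  have hB := hB.self_of_nhds
  have hD := hB.vel.nonneg
  set q := dq (fun x => dSpace z x t) (fun x => dTime (dSpace z) x t) α with hq
  have hqH := hB.curve.hold_dq hB.velSpace α
  set K := 2 * D * (1 / c + C / c ^ 2)
  have hK : 0 ≤ K := hqH.nonneg
  have hw2 := hB.sqInt_slope.mul_hold hqH
  -- One divided difference is absorbed into the weight, which stays square integrable; the other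
  -- supplies the kernel.
  have h1 := (hB.curve.integrable_dqKer (D := D + K * D) hB.hasDerivAt_vel
    (hB.velSpace.mono (le_add_of_nonneg_right (by positivity)))
    (fun x => (hB.vel.bound x).trans (le_add_of_nonneg_right (by positivity)))
    (hw2.mono (le_add_of_nonneg_left hD)) α).2.1
  refine h1.congr (.of_forall fun β => ?_)
  simp only [dqKer, integrand₂, h.dSpace_height ht]
  -- At β = α both expressions are 0 through 0/0 = 0.
  rcases eq_or_ne β α with rfl | hβ
  · simp
  · rw [hB.curve.dq_eq hB.hasDerivAt_vel hB.velSpace.continuous hβ.symm]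
    ring

/-- In the difference z_tt(α) − z_tt(β) the constant i is added to both terms. The value at α leaves
the integral, ready to meet i𝔞Π_α; the value at β is rewritten by the momentum equation. -/
theorem IsSolution.dqDerivInt_eq (h : IsSolution T z a) (ht : t ∈ Ioo 0 T) (α : ℝ) :
    dqDerivInt (fun β => z β t) (fun β => dTime z β t) (fun β => dTime (dTime z) β t)
        (fun β => ((dSpace z β t).im : ℂ)) α =
      (dTime (dTime z) α t + Complex.I) *
        cauchyInt (fun β => z β t) (fun β => ((dSpace z β t).im : ℂ)) α -
      1 / (2 * Complex.I) *
        (cauchyInt (fun β => z β t) (fun β => dSpace z β t * dTime (dTime z) β t) α +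
        cauchyInt (fun β => z β t)
          (fun β => dSpace z β t * starRingEnd ℂ (dTime (dTime z) β t)) α) -
      ∫ β, integrand₂ z (dTime z) α t β := by
  obtain ⟨c, C, D, hB⟩ := h.exists_bounds ht
  have hB := hB.self_of_nhds
  have i1 := (hB.curve.tame_cauchyKer hB.slope hB.vel.nonneg hB.sqInt_slope α).integrableOn
  have i2 := hB.integrableOn_mul hB.acc hB.sqInt_acc α
  have i3 := hB.integrableOn_mul hB.acc.conj hB.sqInt_acc.conj α
  obtain ⟨i4, e4⟩ := integral_sym (h.integrable_integrand₂ ht α) α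
  have i5 := (i1.const_mul (dTime (dTime z) α t + Complex.I)).sub
    ((i2.add i3).const_mul (1 / (2 * Complex.I)))
  rw [← e4, dqDerivInt, cauchyInt, cauchyInt, cauchyInt, ← integral_add i2 i3,
    ← integral_const_mul, ← integral_const_mul]
  have s1 := integral_sub (i1.const_mul (dTime (dTime z) α t + Complex.I))
    ((i2.add i3).const_mul (1 / (2 * Complex.I)))
  have s2 := integral_sub i5 i4
  simp only [Pi.add_apply, Pi.sub_apply] at s1 s2
  rw [← s1, ← s2]
  refine integral_congr_ae (.of_forall fun s => ?_)
  have key : ∀ β, dqDerivKer (fun β => z β t) (fun β => dTime z β t)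
      (fun β => dTime (dTime z) β t) (fun β => ((dSpace z β t).im : ℂ)) α β =
      (dTime (dTime z) α t + Complex.I) *
        cauchyKer (fun β => z β t) (fun β => ((dSpace z β t).im : ℂ)) α β -
      1 / (2 * Complex.I) *
        (cauchyKer (fun β => z β t) (fun β => dSpace z β t * dTime (dTime z) β t) α β +
        cauchyKer (fun β => z β t)
          (fun β => dSpace z β t * starRingEnd ℂ (dTime (dTime z) β t)) α β) -
      integrand₂ z (dTime z) α t β := by
    intro β
    have hm := h.momentum t ht β
    have hmc := congrArg (starRingEnd ℂ) hm
    simp only [map_add, map_mul, Complex.conj_I, Complex.conj_ofReal] at hmc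
    have him := eq_conj_add_im (dSpace z β t)
    have hI := Complex.I_ne_zero
    -- With z_tt + i = i𝔞z_β and 𝔞 real, (z_tt + i)z̄_β = −z_β(z̄_tt − i); hence (z_tt + i)(z_β −
    -- z̄_β) = z_β(z_tt + z̄_tt).
    have e : (dTime (dTime z) β t + Complex.I) * ((dSpace z β t).im : ℂ) =
        1 / (2 * Complex.I) * (dSpace z β t * dTime (dTime z) β t +
          dSpace z β t * starRingEnd ℂ (dTime (dTime z) β t)) := by
      field_simp
      linear_combination -(dTime (dTime z) β t + Complex.I) * him +
        (dSpace z β t - starRingEnd ℂ (dSpace z β t)) * hm - dSpace z β t * (hm + hmc)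
    simp only [dqDerivKer, cauchyKer, integrand₂, h.dSpace_height ht]
    linear_combination -(1 / (z α t - z β t)) * e
  simp only [sym, key]
  ring

theorem IsSolution.identity (h : IsSolution T z a) (ht : t ∈ Ioo 0 T) (α : ℝ) :
    dTime (dTime (bigPi z)) α t - Complex.I * (a α t : ℂ) * dSpace (bigPi z) α t =
      (4 / Real.pi : ℂ) * (∫ β, integrand₁ z (dTime z) α t β) +
        (2 / Real.pi : ℂ) * ∫ β, integrand₂ z (dTime z) α t β := by
  obtain ⟨c, C, D, hB⟩ := h.exists_bounds ht
  have hB := hB.self_of_nhds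
  rw [h.dTime_dTime_bigPi ht, show dSpace (bigPi z) α t = _ from
    (h.hasDerivAt_bigPi_space ht α).deriv, piTimeTime, h.dqDerivInt_eq ht]
  have e1 := (h.integral_integrand₁ ht α).2
  have e2 := h.cauchyInt_conj_acc ht α
  have e3 : dqInt (fun β => z β t) (fun β => dTime z β t) (fun β => dTime (dSpace z) β t) α =
      dqInt (fun β => z β t) (fun β => dTime z β t)
        (fun β => starRingEnd ℂ (dTime (dSpace z) β t)) α + 2 * Complex.I *
      dqInt (fun β => z β t) (fun β => dTime z β t)
        (fun β => ((dTime (dSpace z) β t).im : ℂ)) α := by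
    rw [← dqInt_const_mul, ← dqInt_add
      (hB.integrableOn_dqKer hB.velSpace.conj hB.sqInt_velSpace.conj α)]
    · congr 1
      funext β
      exact eq_conj_add_im _
    · refine ((hB.integrableOn_dqKer hB.velSpace.im hB.sqInt_velSpace.im α).const_mul
        (2 * Complex.I)).congr (.of_forall fun s => ?_)
      simp only [sym, dqKer]
      ring
  have hm := h.momentum t ht α
  have hmc := congrArg (starRingEnd ℂ) hm
  simp only [map_add, map_mul, Complex.conj_I, Complex.conj_ofReal] at hmc
  have him := eq_conj_add_im (dSpace z α t)
  have hI := Complex.I_ne_zero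
  have hI2 := Complex.I_sq
  have hpi : (Real.pi : ℂ) ≠ 0 := by exact_mod_cast Real.pi_ne_zero
  -- Only the linear relations between the integrals matter from here on, so each integral becomes
  -- an opaque scalar.
  generalize dqInt (fun β => z β t) (fun β => dTime z β t) (fun β => dTime (dSpace z) β t) α = d at *
  generalize dqInt (fun β => z β t) (fun β => dTime z β t)
        (fun β => starRingEnd ℂ (dTime (dSpace z) β t)) α = dc at *
  generalize dqInt (fun β => z β t) (fun β => dTime z β t)
        (fun β => ((dTime (dSpace z) β t).im : ℂ)) α = di at *
  generalize cauchyInt (fun β => z β t)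
    (fun β => dSpace z β t * starRingEnd ℂ (dTime (dTime z) β t)) α = cc at *
  generalize cauchyInt (fun β => z β t) (fun β => dSpace z β t * dTime (dTime z) β t) α = ca at *
  generalize cauchyInt (fun β => z β t) (fun β => ((dSpace z β t).im : ℂ)) α = cy at *
  generalize ∫ β, integrand₁ z (dTime z) α t β = J₁ at *
  generalize ∫ β, integrand₂ z (dTime z) α t β = J₂ at *
  generalize starRingEnd ℂ (dTime (dTime z) α t) = rc at *
  generalize dTime (dTime z) α t = r at *
  generalize ((dSpace z α t).im : ℂ) = y at *
  generalize starRingEnd ℂ (dSpace z α t) = vc at *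
  generalize dSpace z α t = v at *
  generalize (a α t : ℂ) = A at *
  have hinv : 1 / (Real.pi * Complex.I) = -Complex.I / Real.pi := by
    field_simp
    linear_combination hI2
  have hinv2 : 1 / (2 * Complex.I) = -Complex.I / 2 := by
    field_simp
    linear_combination hI2
  have e2' := congrArg (fun w => (Real.pi : ℂ)⁻¹ * w) e2
  simp only [mul_assoc, inv_mul_cancel_left₀ hpi] at e2'
  rw [hinv, hinv2]
  -- `hm` matches the C(y_β) terms with i𝔞Π_α, and `e2'` eliminates C(z_β z̄_tt). By `e3` the
  -- divided difference integrals add up to twice ∫ (Δz_t/Δz) z_tβ, which `e1` converts. The local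
  -- part is z_tt + z̄_tt + 2𝔞y_α = 0.
  linear_combination -(2 / Real.pi) * cy * hm - Complex.I * e2' - Complex.I / Real.pi * e3 +
    2 * Complex.I / Real.pi * e1 + hm + hmc + Complex.I * A * him +
    (-(2 / Real.pi) * di - 4 / Real.pi * J₁ - rc) * hI2

end Solution

/-! ### Change of the space variable -/

section Diffeo
variable {T : ℝ} {k : ℝ → ℝ → ℝ} {t : ℝ}

/-- The inverse, in the space variable, of the family `k`. -/
def invDiffeo (k : ℝ → ℝ → ℝ) : ℝ → ℝ → ℝ := compInv k fun x _ => x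

theorem IsDiffeoFamily.apply_inv (h : IsDiffeoFamily T k) (ht : t ∈ Ioo 0 T) (x : ℝ) :
    k (invDiffeo k x t) t = x :=
  Function.rightInverse_invFun (h.bijective t ht).2 x

theorem IsDiffeoFamily.strictMono (h : IsDiffeoFamily T k) (ht : t ∈ Ioo 0 T) :
    StrictMono fun x => k x t :=
  strictMono_of_deriv_pos (h.deriv_pos t ht)

/-- By monotonicity, y lies below the preimage of x at time t exactly when k(y, t) < x, and this
condition is open in (x, t). -/
theorem IsDiffeoFamily.continuousAt_inv (h : IsDiffeoFamily T k) (ht : t ∈ Ioo 0 T) (x : ℝ) :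
    ContinuousAt (fun p : ℝ × ℝ => invDiffeo k p.1 p.2) (x, t) := by
  have hc : ∀ y, ContinuousAt (fun p : ℝ × ℝ => k y p.2) (x, t) := fun y =>
    ContinuousAt.comp (f := fun p : ℝ × ℝ => (y, p.2)) (x := (x, t))
      (g := fun p : ℝ × ℝ => k p.1 p.2) (contDiffAt_of_strip h.contDiffOn ht).continuousAt
      (by fun_prop)
  refine tendsto_order.2 ⟨fun y hy => ?_, fun y hy => ?_⟩
  · have h1 : k y t < x := by simpa [h.apply_inv ht] using h.strictMono ht hy
    filter_upwards [(hc y).eventually_lt continuousAt_fst h1, eventually_snd_mem ht] with p hp hpt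
    rw [← h.apply_inv hpt p.1] at hp
    exact (h.strictMono hpt).lt_iff_lt.1 hp
  · have h1 : x < k y t := by simpa [h.apply_inv ht] using h.strictMono ht hy
    filter_upwards [continuousAt_fst.eventually_lt (hc y) h1, eventually_snd_mem ht] with p hp hpt
    rw [← h.apply_inv hpt p.1] at hp
    exact (h.strictMono hpt).lt_iff_lt.1 hp

/-- The linear map `(h, s) ↦ (m h + b s, s)`. -/
def shearEquiv (m b : ℝ) (hm : m ≠ 0) : (ℝ × ℝ) ≃L[ℝ] ℝ × ℝ :=
  ContinuousLinearEquiv.equivOfInverse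
    ((m • ContinuousLinearMap.fst ℝ ℝ ℝ + b • ContinuousLinearMap.snd ℝ ℝ ℝ).prod
      (ContinuousLinearMap.snd ℝ ℝ ℝ))
    ((m⁻¹ • (ContinuousLinearMap.fst ℝ ℝ ℝ - b • ContinuousLinearMap.snd ℝ ℝ ℝ)).prod
      (ContinuousLinearMap.snd ℝ ℝ ℝ))
    (fun p => by ext <;> simp [hm])
    (fun p => by ext <;> simp [hm])

/-- The map (x, t) ↦ (k(x, t), t) has an invertible shear as derivative; as its inverse is already
continuous, the inverse is differentiable with the inverse shear. -/
theorem IsDiffeoFamily.hasFDerivAt_inv (h : IsDiffeoFamily T k) (ht : t ∈ Ioo 0 T) (x : ℝ) :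
    HasFDerivAt (fun p : ℝ × ℝ => invDiffeo k p.1 p.2)
      ((dSpace k (invDiffeo k x t) t)⁻¹ • (ContinuousLinearMap.fst ℝ ℝ ℝ -
        dTime k (invDiffeo k x t) t • ContinuousLinearMap.snd ℝ ℝ ℝ)) (x, t) := by
  set y := invDiffeo k x t
  have hm : dSpace k y t ≠ 0 := (h.deriv_pos t ht y).ne'
  have hk := ((contDiffAt_of_strip h.contDiffOn ht (x := y)).differentiableAt
    one_ne_zero).hasFDerivAt
  have hΦ : HasFDerivAt (fun p : ℝ × ℝ => (k p.1 p.2, p.2))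
      (shearEquiv (dSpace k y t) (dTime k y t) hm : (ℝ × ℝ) →L[ℝ] ℝ × ℝ) (y, t) := by
    refine (hk.prodMk hasFDerivAt_snd).congr_fderiv ?_
    ext
    · simp [shearEquiv, ContinuousLinearEquiv.equivOfInverse, dSpace_eq_of_strip h.contDiffOn ht]
    · simp [shearEquiv, ContinuousLinearEquiv.equivOfInverse]
    · simp [shearEquiv, ContinuousLinearEquiv.equivOfInverse, dTime_eq_of_strip h.contDiffOn ht]
    · simp [shearEquiv, ContinuousLinearEquiv.equivOfInverse]
  have hinv := HasFDerivAt.of_local_left_inverse (a := (x, t))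
    (g := fun p : ℝ × ℝ => (invDiffeo k p.1 p.2, p.2))
    ((h.continuousAt_inv ht x).prodMk continuousAt_snd) hΦ (by
      filter_upwards [eventually_snd_mem ht] with p hp
      exact Prod.ext (h.apply_inv hp p.1) rfl)
  exact hinv.fst

theorem IsDiffeoFamily.hasDerivAt_inv (h : IsDiffeoFamily T k) (ht : t ∈ Ioo 0 T) (x : ℝ) :
    HasDerivAt (fun x => invDiffeo k x t) (dSpace k (invDiffeo k x t) t)⁻¹ x := by
  simpa using hasDerivAt_space_of_hasFDerivAt (h.hasFDerivAt_inv ht x)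

theorem IsDiffeoFamily.bijective_inv (h : IsDiffeoFamily T k) (ht : t ∈ Ioo 0 T) :
    Function.Bijective fun x => invDiffeo k x t :=
  ⟨fun x y hxy => by
    have := congrArg (fun y => k y t) hxy
    simpa [h.apply_inv ht] using this,
  fun y => ⟨k y t, (h.bijective t ht).1 (h.apply_inv ht (k y t))⟩⟩

/-- The time derivative of k⁻¹ contributes −k_t/k_α times u_α, and b times the space derivative
contributes the opposite, so D_t acts as ∂_t before composition. -/
theorem IsDiffeoFamily.hasFDerivAt_compInv (h : IsDiffeoFamily T k) (ht : t ∈ Ioo 0 T) {x : ℝ}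
    {u : ℝ → ℝ → ℂ}
    (hu : DifferentiableAt ℝ (fun p : ℝ × ℝ => u p.1 p.2) (invDiffeo k x t, t)) :
    DifferentiableAt ℝ (fun p : ℝ × ℝ => compInv k u p.1 p.2) (x, t) ∧
      dSpace (compInv k u) x t =
        dSpace u (invDiffeo k x t) t / ((dSpace k (invDiffeo k x t) t : ℝ) : ℂ) ∧
      matDeriv k (compInv k u) x t = compInv k (dTime u) x t := by
  have hm : ((dSpace k (invDiffeo k x t) t : ℝ) : ℂ) ≠ 0 := by
    exact_mod_cast (h.deriv_pos t ht (invDiffeo k x t)).ne'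
  have h1 : HasFDerivAt (fun p : ℝ × ℝ => compInv k u p.1 p.2) _ (x, t) :=
    HasFDerivAt.comp (f := fun p : ℝ × ℝ => (invDiffeo k p.1 p.2, p.2)) (x, t) hu.hasFDerivAt
      ((h.hasFDerivAt_inv ht x).prodMk hasFDerivAt_snd)
  set U := fderiv ℝ (fun p : ℝ × ℝ => u p.1 p.2) (invDiffeo k x t, t) with hU
  have ux : dSpace u (invDiffeo k x t) t = U (1, 0) :=
    (hasDerivAt_space_of_hasFDerivAt hu.hasFDerivAt).deriv
  have ut : dTime u (invDiffeo k x t) t = U (0, 1) :=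
    (hasDerivAt_time_of_hasFDerivAt hu.hasFDerivAt).deriv
  have hlin : ∀ r s : ℝ, U (r, s) = r * U (1, 0) + s * U (0, 1) := by
    intro r s
    have : ((r, s) : ℝ × ℝ) = r • ((1, 0) : ℝ × ℝ) + s • ((0, 1) : ℝ × ℝ) := by simp
    rw [this, map_add, map_smul, map_smul, Complex.real_smul, Complex.real_smul]
  have cx := (hasDerivAt_space_of_hasFDerivAt h1).deriv
  have ct := (hasDerivAt_time_of_hasFDerivAt h1).deriv
  have cx' : dSpace (compInv k u) x t =
      dSpace u (invDiffeo k x t) t / ((dSpace k (invDiffeo k x t) t : ℝ) : ℂ) := by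
    rw [ux, dSpace, cx]
    rw [show U.comp _ _ = U ((dSpace k (invDiffeo k x t) t)⁻¹ * (1 - dTime k (invDiffeo k x t) t * 0),
      0) from rfl, hlin]
    push_cast
    field_simp
    ring
  refine ⟨h1.differentiableAt, cx', ?_⟩
  rw [matDeriv, cx', dTime, ct, show compInv k (dTime u) x t = dTime u (invDiffeo k x t) t from rfl,
    show compInv k (dTime k) x t = dTime k (invDiffeo k x t) t from rfl, ux, ut]
  rw [show U.comp _ _ = U ((dSpace k (invDiffeo k x t) t)⁻¹ * (0 - dTime k (invDiffeo k x t) t * 1),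
    1) from rfl, hlin]
  push_cast
  field_simp
  ring

theorem matDeriv_congr {u u' : ℝ → ℝ → ℂ} (h : ∀ t ∈ Ioo 0 T, ∀ x, u x t = u' x t)
    (ht : t ∈ Ioo 0 T) (x : ℝ) : matDeriv k u x t = matDeriv k u' x t := by
  have e1 : dTime u x t = dTime u' x t := by
    refine Filter.EventuallyEq.deriv_eq ?_
    filter_upwards [Ioo_mem_nhds ht.1 ht.2] with s hs using h s hs x
  have e2 : dSpace u x t = dSpace u' x t := by
    simp only [dSpace, h t ht]
  rw [matDeriv, matDeriv, e1, e2]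

theorem IsDiffeoFamily.integral_comp_inv (h : IsDiffeoFamily T k) (ht : t ∈ Ioo 0 T)
    {g : ℝ → ℂ} (hg : Integrable g) :
    Integrable (fun β => g (invDiffeo k β t) / ((dSpace k (invDiffeo k β t) t : ℝ) : ℂ)) ∧
      ∫ β, g (invDiffeo k β t) / ((dSpace k (invDiffeo k β t) t : ℝ) : ℂ) = ∫ β, g β := by
  have hd : ∀ x ∈ univ, HasDerivWithinAt (fun x => invDiffeo k x t)
      (dSpace k (invDiffeo k x t) t)⁻¹ univ x := fun x _ => (h.hasDerivAt_inv ht x).hasDerivWithinAt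
  have hinj : InjOn (fun x => invDiffeo k x t) univ := (h.bijective_inv ht).1.injOn
  have himg : (fun x => invDiffeo k x t) '' univ = univ := by
    rw [image_univ]; exact (h.bijective_inv ht).2.range_eq
  have e : ∀ β, |(dSpace k (invDiffeo k β t) t)⁻¹| • g (invDiffeo k β t) =
      g (invDiffeo k β t) / ((dSpace k (invDiffeo k β t) t : ℝ) : ℂ) := by
    intro β
    rw [abs_of_pos (inv_pos.2 (h.deriv_pos t ht _)), Complex.real_smul, Complex.ofReal_inv,
      div_eq_inv_mul]
  have h1 := integrableOn_image_iff_integrableOn_abs_deriv_smul MeasurableSet.univ hd hinj g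
  have h2 := integral_image_eq_integral_abs_deriv_smul MeasurableSet.univ hd hinj g
  rw [himg] at h1 h2
  simp only [integrableOn_univ, setIntegral_univ, e] at h1 h2
  exact ⟨h1.1 hg, h2.symm⟩

end Diffeo

/-! ### The integrands in the new space variable -/

section Solution
variable {T : ℝ} {z : ℝ → ℝ → ℂ} {a k : ℝ → ℝ → ℝ} {t : ℝ}

theorem IsSolution.matDeriv_compInv (h : IsSolution T z a) (hk : IsDiffeoFamily T k)
    (ht : t ∈ Ioo 0 T) (x : ℝ) :
    matDeriv k (compInv k z) x t = dTime z (invDiffeo k x t) t :=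
  (hk.hasFDerivAt_compInv ht
    ((contDiffAt_of_strip h.contDiffOn ht).differentiableAt one_ne_zero)).2.2

theorem IsSolution.hasDerivAt_matDeriv (h : IsSolution T z a) (hk : IsDiffeoFamily T k)
    (ht : t ∈ Ioo 0 T) (x : ℝ) :
    HasDerivAt (fun x => matDeriv k (compInv k z) x t)
      (dSpace (dTime z) (invDiffeo k x t) t / ((dSpace k (invDiffeo k x t) t : ℝ) : ℂ)) x := by
  simp only [h.matDeriv_compInv hk ht]
  have h1 := (h.hasDerivAt_velocity_space ht (invDiffeo k x t)).scomp x (hk.hasDerivAt_inv ht x)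
  rw [h.dSpace_velocity ht]
  refine h1.congr_deriv ?_
  rw [Complex.real_smul, Complex.ofReal_inv, div_eq_inv_mul]

theorem IsSolution.dSpace_im_compInv (h : IsSolution T z a) (hk : IsDiffeoFamily T k)
    (ht : t ∈ Ioo 0 T) (x : ℝ) :
    dSpace (fun x s => (compInv k z x s).im) x t =
      dSpace (fun x s => (z x s).im) (invDiffeo k x t) t / dSpace k (invDiffeo k x t) t := by
  rw [h.dSpace_height ht]
  have h1 : HasDerivAt (fun x => (z x t).im) (dSpace z (invDiffeo k x t) t).im (invDiffeo k x t) :=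
    Complex.imCLM.hasFDerivAt.comp_hasDerivAt _ (h.hasDerivAt_space ht _)
  have h2 := (h1.comp x (hk.hasDerivAt_inv ht x)).deriv
  rw [div_eq_mul_inv, ← h2]
  rfl

theorem IsSolution.integrand₁_compInv (h : IsSolution T z a) (hk : IsDiffeoFamily T k)
    (ht : t ∈ Ioo 0 T) (α β : ℝ) :
    integrand₁ (compInv k z) (matDeriv k (compInv k z)) α t β =
      integrand₁ z (dTime z) (invDiffeo k α t) t (invDiffeo k β t) /
        ((dSpace k (invDiffeo k β t) t : ℝ) : ℂ) := by
  rw [integrand₁, integrand₁, show dSpace (matDeriv k (compInv k z)) β t = _ from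
    (h.hasDerivAt_matDeriv hk ht β).deriv, h.matDeriv_compInv hk ht, h.matDeriv_compInv hk ht,
    show compInv k z α t = z (invDiffeo k α t) t from rfl,
    show compInv k z β t = z (invDiffeo k β t) t from rfl]
  ring

theorem IsSolution.integrand₂_compInv (h : IsSolution T z a) (hk : IsDiffeoFamily T k)
    (ht : t ∈ Ioo 0 T) (α β : ℝ) :
    integrand₂ (compInv k z) (matDeriv k (compInv k z)) α t β =
      integrand₂ z (dTime z) (invDiffeo k α t) t (invDiffeo k β t) /
        ((dSpace k (invDiffeo k β t) t : ℝ) : ℂ) := by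
  rw [integrand₂, integrand₂, h.dSpace_im_compInv hk ht, h.matDeriv_compInv hk ht,
    h.matDeriv_compInv hk ht, show compInv k z α t = z (invDiffeo k α t) t from rfl,
    show compInv k z β t = z (invDiffeo k β t) t from rfl]
  push_cast
  ring

end Solution

end WaterWave

end

/-! ### The identity in an arbitrary parametrisation -/

theorem proposition3p1 (T : ℝ) (z : ℝ → ℝ → ℂ) (a k : ℝ → ℝ → ℝ)
    (hz : WaterWave.IsSolution T z a) (hk : WaterWave.IsDiffeoFamily T k)
    (ζ θ : ℝ → ℝ → ℂ) (hζ : ζ = WaterWave.compInv k z)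
    (hθ : θ = WaterWave.compInv k (WaterWave.bigPi z)) :
    ∀ t ∈ Set.Ioo 0 T, ∀ α : ℝ,
      -- all the quantities in the identity exist in the classical sense
      (∃ v, WaterWave.HasHilbert (fun β => z β t) (fun β => WaterWave.zSubConj z β t) α v) ∧
      DifferentiableAt ℝ (fun p : ℝ × ℝ => ζ p.1 p.2) (α, t) ∧
      DifferentiableAt ℝ (fun p : ℝ × ℝ => θ p.1 p.2) (α, t) ∧
      DifferentiableAt ℝ (fun p : ℝ × ℝ => WaterWave.matDeriv k θ p.1 p.2) (α, t) ∧
      WaterWave.matDeriv k ζ α t = WaterWave.compInv k (WaterWave.dTime z) α t ∧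
      DifferentiableAt ℝ (fun x => WaterWave.matDeriv k ζ x t) α ∧
      MeasureTheory.Integrable (WaterWave.integrand₁ ζ (WaterWave.matDeriv k ζ) α t) ∧
      MeasureTheory.Integrable (WaterWave.integrand₂ ζ (WaterWave.matDeriv k ζ) α t) ∧
      -- the identity
      WaterWave.matDeriv k (WaterWave.matDeriv k θ) α t
          - Complex.I * (WaterWave.coeffA k a α t : ℂ) * WaterWave.dSpace θ α t =
        (4 / Real.pi : ℂ) * (∫ β, WaterWave.integrand₁ ζ (WaterWave.matDeriv k ζ) α t β)
          + (2 / Real.pi : ℂ) * (∫ β, WaterWave.integrand₂ ζ (WaterWave.matDeriv k ζ) α t β) := by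
  open WaterWave in
  subst hζ hθ
  intro t ht α
  have d1 := hk.hasFDerivAt_compInv ht (x := α)
    ((contDiffAt_of_strip hz.contDiffOn ht).differentiableAt one_ne_zero)
  have d2 : ∀ t ∈ Set.Ioo 0 T, ∀ α, _ := fun t ht α =>
    hk.hasFDerivAt_compInv ht (x := α) (hz.differentiableAt_bigPi ht _)
  have d3 := hk.hasFDerivAt_compInv ht (x := α) (hz.differentiableAt_dTime_bigPi ht _)
  have e : ∀ t ∈ Set.Ioo 0 T, ∀ x, matDeriv k (compInv k (bigPi z)) x t =
      compInv k (dTime (bigPi z)) x t := fun t ht x => (d2 t ht x).2.2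
  have i1 := hk.integral_comp_inv ht (hz.integral_integrand₁ ht (invDiffeo k α t)).1
  have i2 := hk.integral_comp_inv ht (hz.integrable_integrand₂ ht (invDiffeo k α t))
  have f1 : integrand₁ (compInv k z) (matDeriv k (compInv k z)) α t = _ :=
    funext (hz.integrand₁_compInv hk ht α)
  have f2 : integrand₂ (compInv k z) (matDeriv k (compInv k z)) α t = _ :=
    funext (hz.integrand₂_compInv hk ht α)
  refine ⟨⟨_, (hz.bigPi_eq ht α).1⟩, d1.1, (d2 t ht α).1, ?_, d1.2.2,
    (hz.hasDerivAt_matDeriv hk ht α).differentiableAt, ?_, ?_, ?_⟩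
  · refine d3.1.congr_of_eventuallyEq ?_
    filter_upwards [eventually_snd_mem ht] with p hp
    exact e p.2 hp p.1
  · rw [f1]; exact i1.1
  · rw [f2]; exact i2.1
  -- The Jacobian 1/k_α in each integrand is absorbed by the change of variables, the factor k_α in
  -- A cancels the 1/k_α from the space derivative, and D_t² has become ∂_t² before composition.
  · rw [f1, f2, i1.2, i2.2, ← hz.identity ht, matDeriv_congr e ht, d3.2.2, (d2 t ht α).2.1]
    have hm : ((dSpace k (invDiffeo k α t) t : ℝ) : ℂ) ≠ 0 := by
      exact_mod_cast (hk.deriv_pos t ht (invDiffeo k α t)).ne'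
    rw [show coeffA k a α t = a (invDiffeo k α t) t * dSpace k (invDiffeo k α t) t from rfl,
      show compInv k (dTime (dTime (bigPi z))) α t =
        dTime (dTime (bigPi z)) (invDiffeo k α t) t from rfl]
    push_cast
    field_simp
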